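/- **Setting.** For each sample size $n\ge 1$ let $\mathbf y=\mathbf f+\boldsymbol\epsilon\in\mathbb R^n$ with $\mathbf f=\mathbf X\boldsymbol\beta$, where $\mathbf X\in\mathbb R^{n\times p_n}$ is nonrandom, has full column rank, and $1\le p_n\le n$. The errors $\epsilon_1,\dots,\epsilon_n$ are i.i.d. sub-Gaussian with mean $0$ and variance $\sigma^2>0$, where $\sigma^2$ and the sub-Gaussian parameter do not depend on $n$. Let $\mathbf P_j$ be the orthogonal projection onto the span of the first $j$ columns of $\mathbf X$ ($\mathbf P_0=0$), and let $\boldsymbol\phi_j$ be unit vectors with $\mathbf P_j-\mathbf P_{j-1}=\boldsymbol\phi_j\boldsymbol\phi_j^\top$. Put $\theta_j=\boldsymbol\phi_j^\top\mathbf f/\sqrt n$, $1\le j\le p_n$, and $\|\boldsymbol\theta_{-m}\|^2=\sum_{l=m+1}^{p_n}\theta_l^2$. Assume $\limsup_n n^{-1}\|\mathbf f\|^2<\infty$. A nested candidate set is $\mathcal M=\{\{1,\dots,k_m\}:1\le m\le M_n\}$ with $M_n\ge1$ and $1\le k_1<\dots<k_{M_n}\le p_n$ (all depending on $n$); $\mathcal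 M_A$ is the set of all nested models, $k_m=m$, $M_n=p_n$. For $\mathbf w$ in the unit simplex $\mathcal W_{M_n}\subset\mathbb R^{M_n}$ put $\mathbf P_{\mathbf w}=\sum_m w_m\mathbf P_{k_m}$ and $\hat{\mathbf f}_{\mathbf w}=\mathbf P_{\mathbf w}\mathbf y$. Its risk is $$R_n(\mathbf w|\mathcal M,\mathbf f)=n^{-1}\mathbb E\|\hat{\mathbf f}_{\mathbf w}-\mathbf f\|^2=n^{-1}\|\mathbf f-\mathbf P_{\mathbf w}\mathbf f\|^2+n^{-1}\sigma^2\operatorname{tr}(\mathbf P_{\mathbf w}^\top\mathbf P_{\mathbf w}),$$ and $R_n(\mathbf w^*|\mathcal M,\mathbf f)=\min_{\mathbf w\in\mathcal W_{M_n}}R_n(\mathbf w|\mathcal M,\mathbf f)$. Given an estimator $\hat\sigma^2$ of $\sigma^2$, the MMA weights $\hat{\mathbf w}$ are a (measurable) minimizer over $\mathcal W_{M_n}$ of $$n^{-1}\|\mathbf y-\hat{\mathbf f}_{\mathbf w}\|^2+2n^{-1}\hat\sigma^2\sum_m k_mw_m .$$ Let $Q_n(\hat{\mathbf w}|\mathcal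 M,\mathbf f)$ be either of the two quantities $n^{-1}\mathbb E\|\hat{\mathbf f}_{\hat{\mathbf w}}-\mathbf f\|^2$ and $n^{-1}\mathbb E\|\mathbf f-\mathbf P_{\hat{\mathbf w}}\mathbf f\|^2+n^{-1}\sigma^2\,\mathbb E\operatorname{tr}(\mathbf P_{\hat{\mathbf w}}^\top\mathbf P_{\hat{\mathbf w}})$. With $k_0=0$, $S_j=\sum_{l=k_j+1}^{k_{M_n}}\theta_l^2$ for $0\le j\le M_n$ and $M_n'=\min\{1\le j\le M_n:S_j=0\}$, let $$\psi(\mathcal M)=\Big[M_n\wedge\Big(1+\sum_{j=1}^{M_n-1}\frac{k_{j+1}-k_j}{4k_j}+\sum_{j=1}^{M_n'-1}\frac{S_{j-1}-S_j}{4S_j}\Big)\Big](1+\log M_n)^2 .$$ **Theorem.** (i) If $k_{M_n}\mathbb E(\hat\sigma^2-\sigma^2)^2=o[nR_n(\mathbf w^*|\mathcal M,\mathbf f)]$ (the expectation being finite for all large $n$) and $\psi(\mathcal M)=o[nR_n(\mathbf w^*|\mathcal M,\mathbf f)]$, then, for both versions of $Q_n$, $$Q_n(\hat{\mathbf w}|\mathcal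 M,\mathbf f)\le[1+o(1)]\,R_n(\mathbf w^*|\mathcal M,\mathbf f)\qquad(n\to\infty).$$ (ii) Let $0<\kappa<1$, $m_n=\lfloor\kappa n\rfloor\wedge p_n$, and let MMA use $\mathcal M=\mathcal M_A$ and $\hat\sigma^2=(n-m_n)^{-1}\|\mathbf y-\mathbf P_{m_n}\mathbf y\|^2$. If $$\tfrac1n\vee\|\boldsymbol\theta_{-m_n}\|^4=o[R_n(\mathbf w^*|\mathcal M_A,\mathbf f)],\qquad [\log p_n+\varphi(\boldsymbol\theta)](\log p_n)^2=o[nR_n(\mathbf w^*|\mathcal M_A,\mathbf f)],$$ where $\varphi(\boldsymbol\theta)=\sum_{j=1}^{p_n'-1}\theta_j^2\big/\sum_{l=j+1}^{p_n}\theta_l^2$ and $p_n'=\min\{1\le j\le p_n:\sum_{l=j+1}^{p_n}\theta_l^2=0\}$, then, for both versions of $Q_n$, $$Q_n(\hat{\mathbf w}|\mathcal M_A,\mathbf f)\le[1+o(1)]\,R_n(\mathbf w^*|\mathcal M_A,\mathbf f)\qquad(n\to\infty).$$ -/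

import Mathlib

open MeasureTheory ProbabilityTheory Filter Topology
open scoped NNReal Matrix

namespace MMA

noncomputable section

/-! ### Least squares, nested candidate models and model averaging -/

/-- Squared Euclidean norm of a vector. -/
def sqNorm {n : ℕ} (v : Fin n → ℝ) : ℝ := ∑ i, v i ^ 2

/-- The columns of `X` with index in `I`. -/
def subDesign {n p : ℕ} (X : Matrix (Fin n) (Fin p) ℝ) (I : Finset (Fin p)) :
    Matrix (Fin n) I ℝ :=
  X.submatrix id (fun j : I => (j : Fin p))

/-- The least squares (hat) matrix `X_I (X_Iᵀ X_I)⁻¹ X_Iᵀ` of the candidate model `I`. -/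
def projMatrix {n p : ℕ} (X : Matrix (Fin n) (Fin p) ℝ) (I : Finset (Fin p)) :
    Matrix (Fin n) (Fin n) ℝ :=
  subDesign X I * ((subDesign X I)ᵀ * subDesign X I)⁻¹ * (subDesign X I)ᵀ

/-- The candidate model consisting of the first `k` of the `p` regressors. -/
def nestedModel (p k : ℕ) : Finset (Fin p) := Finset.univ.filter (fun j => (j : ℕ) < k)

/-- `k 0 = 0` and `1 ≤ k 1 < k 2 < ⋯ < k M ≤ p`, with `M ≥ 1`: the sizes of a nonempty nested
family of candidate models. -/
structure IsNestedSizes (p M : ℕ) (k : ℕ → ℕ) : Prop where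
  one_le : 1 ≤ M
  zero : k 0 = 0
  lt_succ : ∀ j < M, k j < k (j + 1)
  le : k M ≤ p

/-- The candidate models `{1, …, k 1}, …, {1, …, k M}`; the index `m : Fin M` stands for the
`(m + 1)`-st model. -/
def nestedFamily (p M : ℕ) (k : ℕ → ℕ) : Fin M → Finset (Fin p) :=
  fun m => nestedModel p (k (m + 1))

/-- All nested models `{1}, {1, 2}, …, {1, …, p}`. -/
def allNested (p : ℕ) : Fin p → Finset (Fin p) := nestedFamily p p (fun j => j)

/-- The matrix `P_w = ∑ m, w_m P_m` of the model averaging estimator with weights `w`. -/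
def maMatrix {n p M : ℕ} (X : Matrix (Fin n) (Fin p) ℝ) (I : Fin M → Finset (Fin p))
    (w : Fin M → ℝ) : Matrix (Fin n) (Fin n) ℝ :=
  ∑ m, w m • projMatrix X (I m)

/-- The model averaging estimator of the mean vector. -/
def maEstimator {n p M : ℕ} (X : Matrix (Fin n) (Fin p) ℝ) (I : Fin M → Finset (Fin p))
    (w : Fin M → ℝ) (y : Fin n → ℝ) : Fin n → ℝ :=
  maMatrix X I w *ᵥ y

/-- The normalized squared loss `n⁻¹ ‖g - f‖²`. -/
def loss {n : ℕ} (g f : Fin n → ℝ) : ℝ := sqNorm (g - f) / n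

/-- The response vector `y = f + ε` at the outcome `ω`. -/
def response {n : ℕ} {Ω : Type*} (f : Fin n → ℝ) (ε : Fin n → Ω → ℝ) (ω : Ω) : Fin n → ℝ :=
  fun i => f i + ε i ω

/-- The risk (expected loss) `R_n(w | M, f)` of the averaging estimator with the nonrandom
weights `w`. -/
def maRisk {n p M : ℕ} {Ω : Type*} [MeasurableSpace Ω] (μ : Measure Ω) (ε : Fin n → Ω → ℝ)
    (X : Matrix (Fin n) (Fin p) ℝ) (f : Fin n → ℝ) (I : Fin M → Finset (Fin p))
    (w : Fin M → ℝ) : ℝ :=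
  ∫ ω, loss (maEstimator X I w (response f ε ω)) f ∂μ

/-- The optimal risk `R_n(w* | M, f)`: the minimum of the risk over the unit simplex of weights
(the minimum is attained, as the risk is a continuous function on a compact set). -/
def optRisk {n p M : ℕ} {Ω : Type*} [MeasurableSpace Ω] (μ : Measure Ω) (ε : Fin n → Ω → ℝ)
    (X : Matrix (Fin n) (Fin p) ℝ) (f : Fin n → ℝ) (I : Fin M → Finset (Fin p)) : ℝ :=
  sInf (maRisk μ ε X f I '' stdSimplex ℝ (Fin M))

/-- `n⁻¹ ‖f - P_w f‖² + n⁻¹ σ² tr (P_wᵀ P_w)`, into which random weights get plugged. -/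
def plugInRisk {n p M : ℕ} (σ : ℝ) (X : Matrix (Fin n) (Fin p) ℝ) (f : Fin n → ℝ)
    (I : Fin M → Finset (Fin p)) (w : Fin M → ℝ) : ℝ :=
  sqNorm (f - maMatrix X I w *ᵥ f) / n
    + σ ^ 2 / n * ((maMatrix X I w)ᵀ * maMatrix X I w).trace

/-- The MMA criterion `n⁻¹ ‖y - P_w y‖² + 2 n⁻¹ s ∑ m, |I_m| w_m`, where `s` is the value of the
estimator of the noise variance. -/
def criterion {n p M : ℕ} (X : Matrix (Fin n) (Fin p) ℝ) (I : Fin M → Finset (Fin p))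
    (s : ℝ) (y : Fin n → ℝ) (w : Fin M → ℝ) : ℝ :=
  sqNorm (y - maEstimator X I w y) / n + 2 * s / n * ∑ m, ((I m).card : ℝ) * w m

/-- `w` minimizes the MMA criterion over the unit simplex. -/
def IsMMAWeight {n p M : ℕ} (X : Matrix (Fin n) (Fin p) ℝ) (I : Fin M → Finset (Fin p))
    (s : ℝ) (y : Fin n → ℝ) (w : Fin M → ℝ) : Prop :=
  w ∈ stdSimplex ℝ (Fin M) ∧ IsMinOn (criterion X I s y) (stdSimplex ℝ (Fin M)) w

/-- The least squares variance estimator `(n - m)⁻¹ ‖y - P_m y‖²`, from the first `m`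
regressors. -/
def varEstimator {n p : ℕ} (X : Matrix (Fin n) (Fin p) ℝ) (m : ℕ) (y : Fin n → ℝ) : ℝ :=
  sqNorm (y - projMatrix X (nestedModel p m) *ᵥ y) / ((n : ℝ) - m)

/-! ### Asymptotic optimality -/

/-- `Q n ≤ (1 + o(1)) R n` as `n → ∞`. -/
def AsympLE (Q R : ℕ → ℝ) : Prop :=
  ∃ δ : ℕ → ℝ, Tendsto δ atTop (𝓝 0) ∧ ∀ᶠ n in atTop, Q n ≤ (1 + δ n) * R n

/-- The averaging estimator with data-driven weights `what` has asymptotically at most the risk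
`target`, for both notions of its risk: the expected loss and the expected plug-in risk
(which are genuine, finite expectations). -/
def AsympOptimal {Ω : ℕ → Type*} [∀ n, MeasurableSpace (Ω n)] (μ : ∀ n, Measure (Ω n))
    (ε : ∀ n, Fin n → Ω n → ℝ) (σ : ℝ) {p M : ℕ → ℕ} (X : ∀ n, Matrix (Fin n) (Fin (p n)) ℝ)
    (f : ∀ n, Fin n → ℝ) (I : ∀ n, Fin (M n) → Finset (Fin (p n)))
    (what : ∀ n, Ω n → Fin (M n) → ℝ) (target : ℕ → ℝ) : Prop :=
  (∀ n, 1 ≤ n →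
    Integrable (fun ω => loss (maEstimator (X n) (I n) (what n ω) (response (f n) (ε n) ω)) (f n))
      (μ n) ∧
    Integrable (fun ω => plugInRisk σ (X n) (f n) (I n) (what n ω)) (μ n)) ∧
  AsympLE
    (fun n => ∫ ω, loss (maEstimator (X n) (I n) (what n ω) (response (f n) (ε n) ω)) (f n) ∂(μ n))
    target ∧
  AsympLE (fun n => ∫ ω, plugInRisk σ (X n) (f n) (I n) (what n ω) ∂(μ n)) target

/-! ### Transformed coefficients -/

/-- The orthonormal vectors `φ_1, …, φ_p` with `P_j - P_{j-1} = φ_j φ_jᵀ`, where `P_j` is the hat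
matrix of the first `j` regressors: Gram–Schmidt applied to the columns of `X`. (Each `φ_j` is
determined up to its sign, which no quantity below depends on.) -/
def basisVec {n p : ℕ} (X : Matrix (Fin n) (Fin p) ℝ) (j : Fin p) : Fin n → ℝ :=
  WithLp.ofLp (InnerProductSpace.gramSchmidtNormed ℝ
    (fun j : Fin p => (WithLp.toLp 2 (X.col j) : EuclideanSpace ℝ (Fin n))) j)

/-- The transformed coefficients `θ_l = φ_lᵀ f / √n`, `1 ≤ l ≤ p`, extended by zero. -/
def theta {n p : ℕ} (X : Matrix (Fin n) (Fin p) ℝ) (f : Fin n → ℝ) (l : ℕ) : ℝ :=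
  if h : 1 ≤ l ∧ l ≤ p then (basisVec X ⟨l - 1, by omega⟩ ⬝ᵥ f) / Real.sqrt n else 0

/-- `∑_{l = a+1}^{b} θ_l²`. -/
def blockSum (θ : ℕ → ℝ) (a b : ℕ) : ℝ := ∑ l ∈ Finset.Ioc a b, θ l ^ 2

/-- The smallest `1 ≤ j ≤ M` with `∑_{l = k_j + 1}^{k_M} θ_l² = 0`. -/
def cutoff (θ : ℕ → ℝ) (M : ℕ) (k : ℕ → ℕ) : ℕ :=
  sInf {j : ℕ | 1 ≤ j ∧ j ≤ M ∧ blockSum θ (k j) (k M) = 0}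

/-- The complexity `ψ` of the nested family with `M` models of sizes `k 1 < ⋯ < k M`. -/
def psi (θ : ℕ → ℝ) (M : ℕ) (k : ℕ → ℕ) : ℝ :=
  min (M : ℝ)
    (1 + ∑ j ∈ Finset.Ico 1 M, ((k (j + 1) : ℝ) - k j) / (4 * k j)
      + ∑ j ∈ Finset.Ico 1 (cutoff θ M k),
          (blockSum θ (k (j - 1)) (k M) - blockSum θ (k j) (k M)) / (4 * blockSum θ (k j) (k M)))
    * (1 + Real.log M) ^ 2

/-- `φ(θ) = ∑_{j=1}^{p'-1} θ_j² / ∑_{l=j+1}^{p} θ_l²`, where `p'` is the smallest `1 ≤ j ≤ p` with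
`∑_{l=j+1}^{p} θ_l² = 0`. -/
def varphi (θ : ℕ → ℝ) (p : ℕ) : ℝ :=
  ∑ j ∈ Finset.Ico 1 (cutoff θ p (fun j => j)), θ j ^ 2 / blockSum θ j p

/-! ### The vectors `basisVec` are the intended ones -/

section
open InnerProductSpace

lemma linearIndependent_toLp {n p : ℕ} {X : Matrix (Fin n) (Fin p) ℝ}
    (hX : LinearIndependent ℝ X.col) :
    LinearIndependent ℝ
      (fun j : Fin p => (WithLp.toLp 2 (X.col j) : EuclideanSpace ℝ (Fin n))) :=
  hX.map' (WithLp.linearEquiv 2 ℝ (Fin n → ℝ)).symm.toLinearMap (LinearEquiv.ker _)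

lemma basisVec_dotProduct {n p : ℕ} {X : Matrix (Fin n) (Fin p) ℝ}
    (hX : LinearIndependent ℝ X.col) (i j : Fin p) :
    basisVec X i ⬝ᵥ basisVec X j = if i = j then 1 else 0 := by
  have h := orthonormal_iff_ite.1 (gramSchmidtNormed_orthonormal (linearIndependent_toLp hX)) j i
  rw [EuclideanSpace.inner_eq_star_dotProduct] at h
  simpa [basisVec, eq_comm] using h

lemma span_basisVec {n p : ℕ} (X : Matrix (Fin n) (Fin p) ℝ) (k : ℕ) :
    Submodule.span ℝ (basisVec X '' {j | (j : ℕ) < k})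
      = Submodule.span ℝ (X.col '' {j | (j : ℕ) < k}) := by
  set v : Fin p → EuclideanSpace ℝ (Fin n) := fun j => WithLp.toLp 2 (X.col j) with hv
  have key : Submodule.span ℝ (gramSchmidtNormed ℝ v '' {j | (j : ℕ) < k})
      = Submodule.span ℝ (v '' {j | (j : ℕ) < k}) := by
    rw [span_gramSchmidtNormed]
    apply le_antisymm
    · rw [Submodule.span_le]
      rintro _ ⟨j, hj, rfl⟩
      refine Submodule.span_mono (Set.image_mono ?_) (gramSchmidt_mem_span ℝ v (le_refl j))
      intro i hi
      exact lt_of_le_of_lt (Fin.le_def.1 hi) hj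
    · rw [Submodule.span_le]
      rintro _ ⟨j, hj, rfl⟩
      refine Submodule.span_mono (Set.image_mono ?_) (mem_span_gramSchmidt ℝ v (le_refl j))
      intro i hi
      exact lt_of_le_of_lt (Fin.le_def.1 hi) hj
  have h2 := congrArg
    (Submodule.map (WithLp.linearEquiv 2 ℝ (Fin n → ℝ)).toLinearMap) key
  rw [Submodule.map_span, Submodule.map_span, ← Set.image_comp, ← Set.image_comp] at h2
  exact h2

/-- The hat matrix of the first `k` regressors is `∑_{j ≤ k} φ_j φ_jᵀ`. -/
theorem projMatrix_nestedModel {n p : ℕ} {X : Matrix (Fin n) (Fin p) ℝ}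
    (hX : LinearIndependent ℝ X.col) (k : ℕ) :
    projMatrix X (nestedModel p k)
      = ∑ j ∈ nestedModel p k, Matrix.vecMulVec (basisVec X j) (basisVec X j) := by
  set A := subDesign X (nestedModel p k) with hA
  set P := projMatrix X (nestedModel p k) with hP
  set Q := ∑ j ∈ nestedModel p k, Matrix.vecMulVec (basisVec X j) (basisVec X j) with hQ
  have hAli : LinearIndependent ℝ A.col :=
    hX.comp (fun j : nestedModel p k => (j : Fin p)) Subtype.val_injective
  have hunit : IsUnit (Aᵀ * A).det := by
    rw [← Matrix.isUnit_iff_isUnit_det, ← Matrix.mulVec_injective_iff_isUnit]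
    have hinj := Matrix.mulVec_injective_iff.2 hAli
    intro a b hab
    apply hinj
    have h0 : (Aᵀ * A) *ᵥ (a - b) = 0 := by rw [Matrix.mulVec_sub, sub_eq_zero]; exact hab
    have h1 : A *ᵥ (a - b) = 0 := by
      rw [← dotProduct_self_eq_zero]
      have : (a - b) ⬝ᵥ ((Aᵀ * A) *ᵥ (a - b)) = 0 := by rw [h0, dotProduct_zero]
      rwa [← Matrix.mulVec_mulVec, Matrix.dotProduct_mulVec, Matrix.vecMul_transpose] at this
    rwa [Matrix.mulVec_sub, sub_eq_zero] at h1
  have hPA : P * A = A := by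
    simp only [hP, projMatrix, ← hA]
    rw [Matrix.mul_assoc, Matrix.mul_assoc, Matrix.nonsing_inv_mul _ hunit, Matrix.mul_one]
  have hPT : Pᵀ = P := by
    simp only [hP, projMatrix, ← hA]
    simp [Matrix.transpose_mul, Matrix.transpose_nonsing_inv, Matrix.mul_assoc]
  have hQT : Qᵀ = Q := by
    simp [hQ, Matrix.transpose_sum, Matrix.transpose_vecMulVec]
  have hPcol : ∀ j : Fin p, (j : ℕ) < k → P *ᵥ X.col j = X.col j := by
    intro j hj
    have hj' : j ∈ nestedModel p k := by simpa [nestedModel] using hj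
    have := congrArg (fun B : Matrix _ _ ℝ => B.col ⟨j, hj'⟩) hPA
    funext i
    exact congrFun this i
  have hPφ : ∀ j ∈ nestedModel p k, P *ᵥ basisVec X j = basisVec X j := by
    intro j hj
    have hj' : (j : ℕ) < k := by simpa [nestedModel] using hj
    have hmem : basisVec X j ∈ Submodule.span ℝ (X.col '' {j | (j : ℕ) < k}) := by
      rw [← span_basisVec]; exact Submodule.subset_span ⟨j, hj', rfl⟩
    have hle : Submodule.span ℝ (X.col '' {j | (j : ℕ) < k})
        ≤ LinearMap.eqLocus P.mulVecLin LinearMap.id := by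
      rw [Submodule.span_le]
      rintro _ ⟨i, hi, rfl⟩
      exact hPcol i hi
    exact hle hmem
  have hQφ : ∀ j ∈ nestedModel p k, Q *ᵥ basisVec X j = basisVec X j := by
    intro j hj
    simp only [hQ, Matrix.sum_mulVec, Matrix.vecMulVec_mulVec, basisVec_dotProduct hX]
    simp [hj]
  have hQA : Q * A = A := by
    have hle : Submodule.span ℝ (basisVec X '' {j | (j : ℕ) < k})
        ≤ LinearMap.eqLocus Q.mulVecLin LinearMap.id := by
      rw [Submodule.span_le]
      rintro _ ⟨i, hi, rfl⟩
      exact hQφ i (by simpa [nestedModel] using hi)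
    rw [span_basisVec] at hle
    ext i j
    have hj : ((j : Fin p) : ℕ) < k := by simpa [nestedModel] using j.2
    exact congrFun (hle (Submodule.subset_span ⟨j, hj, rfl⟩) : Q *ᵥ X.col j = X.col j) i
  have hPQ : P * Q = Q := by
    simp only [hQ, Matrix.mul_sum, Matrix.mul_vecMulVec]
    exact Finset.sum_congr rfl (fun j hj => by rw [hPφ j hj])
  have hQP : Q * P = P := by
    simp only [hP, projMatrix, ← hA]
    rw [← Matrix.mul_assoc, ← Matrix.mul_assoc, hQA]
  calc P = Pᵀ := hPT.symm
    _ = (Q * P)ᵀ := by rw [hQP]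
    _ = P * Q := by rw [Matrix.transpose_mul, hPT, hQT]
    _ = Q := hPQ

/-- `P_j - P_{j-1} = φ_j φ_jᵀ`. -/
theorem projMatrix_sub {n p : ℕ} {X : Matrix (Fin n) (Fin p) ℝ}
    (hX : LinearIndependent ℝ X.col) (j : Fin p) :
    projMatrix X (nestedModel p (j + 1)) - projMatrix X (nestedModel p j)
      = Matrix.vecMulVec (basisVec X j) (basisVec X j) := by
  have h : nestedModel p (j + 1) = insert j (nestedModel p j) := by
    ext i
    simp only [nestedModel, Finset.mem_filter, Finset.mem_univ, true_and, Finset.mem_insert,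
      Fin.ext_iff]
    omega
  rw [projMatrix_nestedModel hX, projMatrix_nestedModel hX, h,
    Finset.sum_insert (by simp [nestedModel]), add_sub_cancel_right]

end

end

end MMA

/-! In the Gram–Schmidt coordinates a weight vector acts only through its tail weights `γ_j`, the
total weight of the models from the `j`-th on. They decrease from `γ_0 = 1` to `γ_M = 0`, and `P_w`
multiplies every coordinate `l` with `k_j ≤ l < k_{j+1}` by `γ_j`. Writing `f_l`, `e_l` for the
coordinates of the mean and of the noise, `n` times the plug-in risk is `∑ (1 - γ)² f_l² + σ² ∑ γ²`,
and `n` times the criterion is the same quantity, plus a term free of `w`, plus `2 ∑ (1 - γ)² f_l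
e_l + ∑ (γ² - 2γ)(e_l² - σ²) + 2 (s - σ²) ∑ γ`.

The theorem follows once each noise term is at most `δ · n R(w) + B / δ` for all `w` and `δ > 0`
simultaneously, with one integrable `B` whose mean is at most a constant times `psi` (the last term
contributes `k_M (s - σ²)² / σ²` instead). Comparing the minimizer with a fixed `w` then gives `(1 -
4δ) n R(ŵ) ≤ (1 + 4δ) n R(w) + O(B / δ)` (with the variance-error contribution included). Taking
expectations, letting `n → ∞` and then `δ → 0` gives the claim for the plug-in risk. The loss
differs from the plug-in risk by noise terms of the same kind.

The uniform bound uses only that the weights `(1 - γ)^r` and `γ^r` are monotone along the blocks. A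
Rademacher–Menshov bisection (`dyadic_sum_le`) bounds a sum `∑ h_j a_j` with monotone `h` by a small
multiple of `∑ h_j² (T_j - T_{j+1})`, which is a bias or variance part of the risk, plus an energy
free of `h`. If block sums of the noise have second moment at most `C (T_s - T_e)`, that energy has
mean at most `C L ∑ (T_j - T_{j+1}) / T_j`, where `L` is the number of dyadic levels. A second
factor `L` comes from dividing `δ` among the levels. For the linear terms `T` is the tail energy of
`f`; for the quadratic terms the blocks are read backwards and `T` is the model size. The two
relative variations are the two sums in `psi`, and `L²` is its squared logarithm. Only second
moments of linear and quadratic forms enter, so bounded fourth moments of the noise suffice.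

For all nested models the size sum in `psi` is harmonic and the other is `varphi / 4`. The squared
error of the least squares variance estimator has mean `O(1/n + ‖θ_{-m}‖⁴)`. -/

namespace MMA

/-! ### Weighted sums of a sequence with monotone weights -/

/-- The energy of the dyadic right halves of the interval `[s, s + 2 ^ L)`, each relative to the
value of `T` at its left end. -/
noncomputable def dyadicEnergy (a T : ℕ → ℝ) : ℕ → ℕ → ℝ
  | 0, _ => 0
  | L + 1, s => dyadicEnergy a T L s + dyadicEnergy a T L (s + 2 ^ L)
      + (∑ j ∈ Finset.Ico (s + 2 ^ L) (s + 2 ^ (L + 1)), a j) ^ 2 / T (s + 2 ^ L)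

lemma dyadicEnergy_nonneg (a : ℕ → ℝ) {T : ℕ → ℝ} (hT : ∀ i, 0 ≤ T i) (L s : ℕ) :
    0 ≤ dyadicEnergy a T L s := by
  induction L generalizing s with
  | zero => simp [dyadicEnergy]
  | succ L ih =>
    have := ih s
    have := ih (s + 2 ^ L)
    have := div_nonneg (sq_nonneg (∑ j ∈ Finset.Ico (s + 2 ^ L) (s + 2 ^ (L + 1)), a j))
      (hT (s + 2 ^ L))
    simp only [dyadicEnergy]
    linarith

lemma sum_Ico_dyadic (F : ℕ → ℝ) (L s : ℕ) :
    ∑ j ∈ Finset.Ico s (s + 2 ^ (L + 1)), F j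
      = ∑ j ∈ Finset.Ico s (s + 2 ^ L), F j
        + ∑ j ∈ Finset.Ico (s + 2 ^ L) (s + 2 ^ L + 2 ^ L), F j := by
  rw [show s + 2 ^ (L + 1) = s + 2 ^ L + 2 ^ L by ring]
  exact (Finset.sum_Ico_consecutive F (Nat.le_add_right _ _) (Nat.le_add_right _ _)).symm

/-- Weighted AM–GM with weight `t T`. The degenerate case `T = 0` must be allowed because the tail
energy of `f` may vanish; then `a = 0`, and `a ^ 2 / T` is zero as well. -/
lemma two_abs_mul_le {d a T t : ℝ} (hT : 0 ≤ T) (h0 : T = 0 → a = 0) (ht : 0 < t) :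
    2 * |d * a| ≤ t * (d ^ 2 * T) + a ^ 2 / T / t := by
  rcases hT.eq_or_lt with h | h
  · simp [h0 h.symm, ← h]
  · have h1 : a ^ 2 / T / t = t * T * (a / (t * T)) ^ 2 := by field_simp
    have h2 : |d * a| = t * T * (|d| * |a / (t * T)|) := by
      rw [abs_mul, abs_div, abs_of_pos (mul_pos ht h)]; field_simp
    have h3 := mul_nonneg (mul_pos ht h).le (sq_nonneg (|d| - |a / (t * T)|))
    have h4 := sq_abs d
    have h5 := sq_abs (a / (t * T))
    rw [h1, h2]
    rw [sub_sq, h4, h5] at h3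
    linear_combination h3

/-- Rademacher–Menshov type bound for a sum with monotone weights. -/
lemma dyadic_sum_le {a T h : ℕ → ℝ} (hh : Monotone h) (h0 : ∀ j, 0 ≤ h j) (hT : Antitone T)
    (hT0 : ∀ i, 0 ≤ T i) (ha : ∀ i j, i ≤ j → T i = 0 → a j = 0) {t : ℝ} (ht : 0 < t)
    (L s : ℕ) :
    2 * |∑ j ∈ Finset.Ico s (s + 2 ^ L), (h j - h s) * a j|
      ≤ t * L * ∑ j ∈ Finset.Ico s (s + 2 ^ L), (h (j + 1) ^ 2 - h j ^ 2) * T (j + 1)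
        + dyadicEnergy a T L s / t := by
  have hinc : ∀ j, 0 ≤ h (j + 1) ^ 2 - h j ^ 2 := fun j => by
    have := pow_le_pow_left₀ (h0 j) (hh (Nat.le_succ j)) 2
    simpa using this
  have hE : ∀ u v, 0 ≤ ∑ j ∈ Finset.Ico u v, (h (j + 1) ^ 2 - h j ^ 2) * T (j + 1) :=
    fun u v => Finset.sum_nonneg fun j _ => mul_nonneg (hinc j) (hT0 _)
  induction L generalizing s with
  | zero => simp [dyadicEnergy]
  | succ L ih =>
    set m := s + 2 ^ L with hm
    have hsm : s ≤ m := Nat.le_add_right _ _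
    -- The squared increment is at most the increment of `h ^ 2`, since `0 ≤ h s ≤ h m`; and `T m`
    -- is the smallest value of `T` up to `m`.
    have hmid : (h m - h s) ^ 2 * T m
        ≤ ∑ j ∈ Finset.Ico s m, (h (j + 1) ^ 2 - h j ^ 2) * T (j + 1) := by
      have h1 : ∑ j ∈ Finset.Ico s m, (h (j + 1) ^ 2 - h j ^ 2) = h m ^ 2 - h s ^ 2 :=
        Finset.sum_Ico_sub (fun j => h j ^ 2) hsm
      have h2 : (h m - h s) ^ 2 ≤ h m ^ 2 - h s ^ 2 := by
        nlinarith [h0 s, hh hsm]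
      calc (h m - h s) ^ 2 * T m ≤ (h m ^ 2 - h s ^ 2) * T m :=
            mul_le_mul_of_nonneg_right h2 (hT0 m)
        _ = ∑ j ∈ Finset.Ico s m, (h (j + 1) ^ 2 - h j ^ 2) * T m := by
            rw [← h1, Finset.sum_mul]
        _ ≤ _ := Finset.sum_le_sum fun j hj => mul_le_mul_of_nonneg_left
            (hT (by have := Finset.mem_Ico.1 hj; omega)) (hinc j)
    have hs : s + 2 ^ (L + 1) = m + 2 ^ L := by rw [hm]; ring
    -- On the right half the reference value moves from `h s` to `h m`. The correction is a constant
    -- times the plain sum of `a`, the only place where the two halves interact.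
    have hsplit : ∑ j ∈ Finset.Ico s (s + 2 ^ (L + 1)), (h j - h s) * a j
        = ∑ j ∈ Finset.Ico s m, (h j - h s) * a j
          + ∑ j ∈ Finset.Ico m (m + 2 ^ L), (h j - h m) * a j
          + (h m - h s) * ∑ j ∈ Finset.Ico m (m + 2 ^ L), a j := by
      have h1 : ∑ j ∈ Finset.Ico m (m + 2 ^ L), (h j - h s) * a j
          = ∑ j ∈ Finset.Ico m (m + 2 ^ L), (h j - h m) * a j
            + (h m - h s) * ∑ j ∈ Finset.Ico m (m + 2 ^ L), a j := by
        rw [Finset.mul_sum, ← Finset.sum_add_distrib]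
        exact Finset.sum_congr rfl fun j _ => by ring
      rw [sum_Ico_dyadic, ← hm, h1]
      exact (add_assoc _ _ _).symm
    have hcross := two_abs_mul_le (d := h m - h s) (a := ∑ j ∈ Finset.Ico m (m + 2 ^ L), a j)
      (hT0 m) (fun h => Finset.sum_eq_zero fun j hj => ha m j (Finset.mem_Ico.1 hj).1 h) ht
    have hl := ih s
    have hr := ih m
    have hEl := hE s m
    have hEr := hE m (m + 2 ^ L)
    -- The cross term spends one further `t` on the left half; this is the additional unit in `L +
    -- 1`. On the right half that unit is slack, which is `e2`.
    have e1 := mul_le_mul_of_nonneg_left hmid ht.le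
    have e2 := mul_nonneg ht.le hEr
    have e3 := abs_add_three (∑ j ∈ Finset.Ico s m, (h j - h s) * a j)
      (∑ j ∈ Finset.Ico m (m + 2 ^ L), (h j - h m) * a j)
      ((h m - h s) * ∑ j ∈ Finset.Ico m (m + 2 ^ L), a j)
    rw [hsplit, sum_Ico_dyadic (fun j => (h (j + 1) ^ 2 - h j ^ 2) * T (j + 1)), ← hm]
    simp only [dyadicEnergy]
    rw [← hm, hs]
    push_cast
    rw [← hm] at hl
    simp only [add_div]
    nlinarith

/-- Abel summation, moving the increments from `h ^ 2` to `T`: the decrements of `T` are the block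
energies that occur in the risk. -/
lemma sum_sq_sub_mul (h T : ℕ → ℝ) (h0 : h 0 = 0) (N : ℕ) :
    ∑ j ∈ Finset.range N, (h (j + 1) ^ 2 - h j ^ 2) * T (j + 1)
      = ∑ j ∈ Finset.range N, h j ^ 2 * (T j - T (j + 1)) + h N ^ 2 * T N := by
  induction N with
  | zero => simp [h0]
  | succ N ih => rw [Finset.sum_range_succ, Finset.sum_range_succ, ih]; ring

/-- The bisection bound with `t = δ / L`, so that the `L` levels together cost `δ`. The assumption
`T (2 ^ L) = 0` removes the boundary term of the Abel summation. -/
lemma monotone_weights_sum_le {a T h : ℕ → ℝ} (hh : Monotone h) (h0 : h 0 = 0)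
    (hT : Antitone T) (hT0 : ∀ i, 0 ≤ T i) (ha : ∀ i j, i ≤ j → T i = 0 → a j = 0)
    {L : ℕ} (hTL : T (2 ^ L) = 0) (hL : 0 < L) {δ : ℝ} (hδ : 0 < δ) :
    2 * |∑ j ∈ Finset.range (2 ^ L), h j * a j|
      ≤ δ * ∑ j ∈ Finset.range (2 ^ L), h j ^ 2 * (T j - T (j + 1))
        + L * dyadicEnergy a T L 0 / δ := by
  have hL' : (0 : ℝ) < L := by exact_mod_cast hL
  have key := dyadic_sum_le hh (fun j => h0 ▸ hh (Nat.zero_le j)) hT hT0 ha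
    (div_pos hδ hL') L 0
  simp only [h0, zero_add, sub_zero, Nat.Ico_zero_eq_range] at key
  rw [sum_sq_sub_mul h T h0, hTL, mul_zero, add_zero] at key
  calc _ ≤ _ := key
    _ = _ := by field_simp

/-- A dyadic block starting at `m` contributes at most `C (T m - T e) / T m`, and this is at most
the sum of `(T j - T (j + 1)) / T j` over the block, as `T m` is the largest denominator. Blocks of
one level are disjoint, so each of the `L` levels costs at most the whole sum. -/
lemma dyadicEnergy_integral_le {Ω : Type*} [MeasurableSpace Ω] {μ : Measure Ω}
    {a : ℕ → Ω → ℝ} {T : ℕ → ℝ} {C : ℝ} (hT : Antitone T) (hT0 : ∀ i, 0 ≤ T i) (hC : 0 ≤ C)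
    (hint : ∀ s e, Integrable (fun ω => (∑ j ∈ Finset.Ico s e, a j ω) ^ 2) μ)
    (hvar : ∀ s e, s ≤ e → ∫ ω, (∑ j ∈ Finset.Ico s e, a j ω) ^ 2 ∂μ ≤ C * (T s - T e))
    (L s : ℕ) :
    Integrable (fun ω => dyadicEnergy (fun j => a j ω) T L s) μ ∧
      ∫ ω, dyadicEnergy (fun j => a j ω) T L s ∂μ
        ≤ C * L * ∑ j ∈ Finset.Ico s (s + 2 ^ L), (T j - T (j + 1)) / T j := by
  have hnn : ∀ u v, 0 ≤ ∑ j ∈ Finset.Ico u v, (T j - T (j + 1)) / T j := fun u v =>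
    Finset.sum_nonneg fun j _ => div_nonneg (sub_nonneg.2 (hT (Nat.le_succ j))) (hT0 j)
  induction L generalizing s with
  | zero => simp [dyadicEnergy]
  | succ L ih =>
    obtain ⟨il, bl⟩ := ih s
    obtain ⟨ir, br⟩ := ih (s + 2 ^ L)
    set m := s + 2 ^ L with hm
    have hs : s + 2 ^ (L + 1) = m + 2 ^ L := by rw [hm]; ring
    have hi := (hint m (m + 2 ^ L)).div_const (T m)
    have hb : (∫ ω, (∑ j ∈ Finset.Ico m (m + 2 ^ L), a j ω) ^ 2 / T m ∂μ)
        ≤ C * ∑ j ∈ Finset.Ico m (m + 2 ^ L), (T j - T (j + 1)) / T j := by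
      rw [integral_div]
      have h1 : (T m - T (m + 2 ^ L)) / T m
          ≤ ∑ j ∈ Finset.Ico m (m + 2 ^ L), (T j - T (j + 1)) / T j := by
        have h2 : T m - T (m + 2 ^ L) = ∑ j ∈ Finset.Ico m (m + 2 ^ L), (T j - T (j + 1)) := by
          have := Finset.sum_Ico_sub (fun j => - T j) (Nat.le_add_right m (2 ^ L))
          simp only [sub_neg_eq_add] at this
          simp only [neg_add_eq_sub] at this
          exact this.symm
        rw [h2, Finset.sum_div]
        refine Finset.sum_le_sum fun j hj => ?_
        have hjm : m ≤ j := (Finset.mem_Ico.1 hj).1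
        have hd : 0 ≤ T j - T (j + 1) := sub_nonneg.2 (hT (Nat.le_succ j))
        rcases (hT0 j).eq_or_lt with h | h
        · have : T (j + 1) = 0 := le_antisymm (h ▸ hT (Nat.le_succ j)) (hT0 _)
          simp [← h, this]
        · exact div_le_div_of_nonneg_left hd h (hT hjm)
      calc _ ≤ C * (T m - T (m + 2 ^ L)) / T m :=
            div_le_div_of_nonneg_right (hvar m _ (Nat.le_add_right _ _)) (hT0 m)
        _ = C * ((T m - T (m + 2 ^ L)) / T m) := by ring
        _ ≤ _ := mul_le_mul_of_nonneg_left h1 hC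
    simp only [dyadicEnergy]
    rw [hs, ← hm]
    refine ⟨(il.add ir).add hi, ?_⟩
    rw [integral_add (by exact il.add ir) hi, integral_add il ir, ← hs,
      sum_Ico_dyadic (fun j => (T j - T (j + 1)) / T j), ← hm, hs]
    push_cast
    have := mul_nonneg hC (hnn s m)
    nlinarith

/-! ### Moments of linear and quadratic forms in the noise -/

lemma pow_four_le_exp (x : ℝ) : x ^ 4 ≤ 24 * (Real.exp x + Real.exp (-x)) := by
  have h : ∀ y : ℝ, 0 ≤ y → y ^ 4 ≤ 24 * Real.exp y := fun y hy => by
    have := Real.pow_div_factorial_le_exp y hy 4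
    rw [div_le_iff₀ (by positivity)] at this
    norm_num [Nat.factorial] at this
    linarith
  rcases le_total 0 x with hx | hx
  · linarith [h x hx, Real.exp_pos (-x)]
  · have := h (-x) (by linarith)
    rw [show (-x) ^ 4 = x ^ 4 by ring] at this
    linarith [Real.exp_pos x]

/-- The moment generating function is used at `1` and `-1` only, each value being at most `exp (c /
2)`. The bound depends on `c` alone, hence is the same for all sample sizes. -/
lemma fourth_moment_le {Ω : Type*} [MeasurableSpace Ω] {μ : Measure Ω} {Y : Ω → ℝ} {c : ℝ≥0}
    (h : HasSubgaussianMGF Y c μ) :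
    Integrable (fun ω => Y ω ^ 4) μ ∧ ∫ ω, Y ω ^ 4 ∂μ ≤ 48 * Real.exp (c / 2) := by
  have i1 := h.integrable_exp_mul 1
  have i2 := h.integrable_exp_mul (-1)
  have m1 := h.mgf_le 1
  have m2 := h.mgf_le (-1)
  simp only [mgf, one_mul, neg_mul, one_pow, mul_one, neg_sq] at i1 i2 m1 m2
  have hi := (i1.add i2).const_mul 24
  have h4 : Integrable (fun ω => Y ω ^ 4) μ := by
    refine hi.mono' (h.aestronglyMeasurable.pow 4) (ae_of_all _ fun ω => ?_)
    rw [Real.norm_of_nonneg (by positivity)]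
    exact pow_four_le_exp _
  refine ⟨h4, ?_⟩
  calc _ ≤ ∫ ω, 24 * (Real.exp (Y ω) + Real.exp (-Y ω)) ∂μ :=
        integral_mono h4 hi fun ω => pow_four_le_exp _
    _ ≤ _ := by
        rw [integral_const_mul, integral_add i1 i2]
        linarith

/-- Independent centred noise with variance `σ²` and fourth moments at most `K`. -/
structure IsNoise {n : ℕ} {Ω : Type*} [MeasurableSpace Ω] (μ : Measure Ω) (ε : Fin n → Ω → ℝ)
    (σ K : ℝ) : Prop where
  meas : ∀ i, Measurable (ε i)
  indep : iIndepFun ε μ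
  int4 : ∀ i, Integrable (fun ω => ε i ω ^ 4) μ
  mean : ∀ i, ∫ ω, ε i ω ∂μ = 0
  var : ∀ i, ∫ ω, ε i ω ^ 2 ∂μ = σ ^ 2
  fourth : ∀ i, ∫ ω, ε i ω ^ 4 ∂μ ≤ K

namespace IsNoise

variable {n : ℕ} {Ω : Type*} [MeasurableSpace Ω] {μ : Measure Ω}
  {ε : Fin n → Ω → ℝ} {σ K : ℝ}

lemma memLp_sq (h : IsNoise μ ε σ K) (i : Fin n) : MemLp (fun ω => ε i ω ^ 2) 2 μ := by
  rw [memLp_two_iff_integrable_sq ((h.meas i).pow_const 2).aestronglyMeasurable]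
  exact (h.int4 i).congr (ae_of_all _ fun ω => by ring)

/-- Adapts joint independence to inductions that adjoin one index: any measurable function of the
noise with indices in `S` is independent of any function of one further noise variable. -/
lemma indepFun_comp (h : IsNoise μ ε σ K) {S : Finset (Fin n)} {i : Fin n} (hi : i ∉ S)
    {q : (Fin n → ℝ) → ℝ} (hq : Measurable q)
    (hqS : ∀ x y : Fin n → ℝ, (∀ j ∈ S, x j = y j) → q x = q y) {G : ℝ → ℝ}
    (hG : Measurable G) :
    IndepFun (fun ω => q (fun j => ε j ω)) (fun ω => G (ε i ω)) μ := by
  have hind := h.indep.indepFun_finset S {i} (by simpa using hi) h.meas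
  -- `q` is factored through the restriction to `S` by padding with zeros, which is harmless since
  -- `q` ignores the coordinates outside `S`.
  have h1 : Measurable (fun v : S → ℝ => q (fun j => if hj : j ∈ S then v ⟨j, hj⟩ else 0)) := by
    refine hq.comp (measurable_pi_lambda _ fun j => ?_)
    by_cases hj : j ∈ S
    · simpa [hj] using measurable_pi_apply _
    · simp [hj]
  have h2 : Measurable (fun v : ({i} : Finset (Fin n)) → ℝ => G (v ⟨i, by simp⟩)) :=
    hG.comp (measurable_pi_apply _)
  have h3 := hind.comp h1 h2
  have e1 : (fun ω => q (fun j => ε j ω)) = (fun v : S → ℝ =>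
      q (fun j => if hj : j ∈ S then v ⟨j, hj⟩ else 0)) ∘ fun a (j : S) => ε j a := by
    funext ω
    exact hqS _ _ fun j hj => by simp [hj]
  rw [e1]
  exact h3

variable [IsProbabilityMeasure μ]

lemma int2 (h : IsNoise μ ε σ K) (i : Fin n) : Integrable (fun ω => ε i ω ^ 2) μ :=
  (h.memLp_sq i).integrable one_le_two

lemma memLp (h : IsNoise μ ε σ K) (i : Fin n) : MemLp (ε i) 2 μ :=
  (memLp_two_iff_integrable_sq (h.meas i).aestronglyMeasurable).2 (h.int2 i)

/-- Variance of a linear form. -/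
lemma linear_form (h : IsNoise μ ε σ K) (v : Fin n → ℝ) (S : Finset (Fin n)) :
    MemLp (fun ω => ∑ j ∈ S, v j * ε j ω) 2 μ ∧ ∫ ω, ∑ j ∈ S, v j * ε j ω ∂μ = 0 ∧
      ∫ ω, (∑ j ∈ S, v j * ε j ω) ^ 2 ∂μ = σ ^ 2 * ∑ j ∈ S, v j ^ 2 := by
  have hmem : ∀ S : Finset (Fin n), MemLp (fun ω => ∑ j ∈ S, v j * ε j ω) 2 μ := fun S =>
    memLp_finsetSum S fun j _ => (h.memLp j).const_mul (v j)
  refine ⟨hmem S, ?_, ?_⟩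
  · rw [integral_finsetSum S fun j _ => ((h.memLp j).const_mul (v j)).integrable one_le_two]
    exact Finset.sum_eq_zero fun j _ => by rw [integral_const_mul, h.mean, mul_zero]
  · induction S using Finset.induction_on with
    | empty => simp
    | insert i S hi ih =>
      have hind : IndepFun (fun ω => ∑ j ∈ S, v j * ε j ω) (fun ω => ε i ω) μ :=
        h.indepFun_comp hi (q := fun x => ∑ j ∈ S, v j * x j) (by fun_prop)
          (fun x y hxy => Finset.sum_congr rfl fun j hj => by rw [hxy j hj]) measurable_id
      have hc : ∫ ω, (∑ j ∈ S, v j * ε j ω) * ε i ω ∂μ = 0 := by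
        rw [hind.integral_fun_mul_eq_mul_integral (hmem S).1 (h.memLp i).1, h.mean, mul_zero]
      have e : ∀ ω, (∑ j ∈ insert i S, v j * ε j ω) ^ 2 = v i ^ 2 * ε i ω ^ 2
          + 2 * v i * ((∑ j ∈ S, v j * ε j ω) * ε i ω) + (∑ j ∈ S, v j * ε j ω) ^ 2 := fun ω => by
        rw [Finset.sum_insert hi]; ring
      have hI : Integrable (fun ω => (∑ j ∈ S, v j * ε j ω) * ε i ω) μ :=
        (hmem S).integrable_mul (h.memLp i)
      simp_rw [e]
      rw [integral_add (by exact ((h.int2 i).const_mul _).add (hI.const_mul _))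
          (hmem S).integrable_sq,
        integral_add ((h.int2 i).const_mul _) (hI.const_mul _), integral_const_mul,
        integral_const_mul, hc, h.var, ih, Finset.sum_insert hi]
      ring

/-- Variance bound for a quadratic form. -/
lemma quadratic_form (h : IsNoise μ ε σ K) (hK : 0 ≤ K) {A : Matrix (Fin n) (Fin n) ℝ}
    (hA : ∀ i j, A i j = A j i) (S : Finset (Fin n)) :
    MemLp (fun ω => ∑ i ∈ S, ∑ j ∈ S, A i j * (ε i ω * ε j ω) - σ ^ 2 * ∑ i ∈ S, A i i) 2 μ ∧
      ∫ ω, (∑ i ∈ S, ∑ j ∈ S, A i j * (ε i ω * ε j ω) - σ ^ 2 * ∑ i ∈ S, A i i) ^ 2 ∂μ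
        ≤ (2 * K + 4 * σ ^ 4) * ∑ i ∈ S, ∑ j ∈ S, A i j ^ 2 := by
  induction S using Finset.induction_on with
  | empty => simp
  | insert i S hi ih =>
    obtain ⟨hQ, hQb⟩ := ih
    set Q : Ω → ℝ :=
      fun ω => ∑ i ∈ S, ∑ j ∈ S, A i j * (ε i ω * ε j ω) - σ ^ 2 * ∑ i ∈ S, A i i with hQdef
    obtain ⟨hY, -, hYv⟩ := h.linear_form (fun j => A i j) S
    set Y : Ω → ℝ := fun ω => ∑ j ∈ S, A i j * ε j ω with hYdef
    -- The quadratic form is a martingale in the number of indices; adjoining `i` adds the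
    -- difference `A i i * (ε i ^ 2 - σ ^ 2) + 2 * Y * ε i`, with `Y` a function of the earlier
    -- noise.
    have e : ∀ ω, ∑ i' ∈ insert i S, ∑ j ∈ insert i S, A i' j * (ε i' ω * ε j ω)
          - σ ^ 2 * ∑ i' ∈ insert i S, A i' i'
        = Q ω + (A i i * (ε i ω ^ 2 - σ ^ 2) + 2 * (Y ω * ε i ω)) := fun ω => by
      have e1 : ∑ i' ∈ S, ∑ j ∈ insert i S, A i' j * (ε i' ω * ε j ω)
          = ∑ i' ∈ S, ∑ j ∈ S, A i' j * (ε i' ω * ε j ω) + Y ω * ε i ω := by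
        rw [hYdef, Finset.sum_mul, ← Finset.sum_add_distrib]
        refine Finset.sum_congr rfl fun i' _ => ?_
        rw [Finset.sum_insert hi, hA i' i]; ring
      have e2 : ∑ j ∈ S, A i j * (ε i ω * ε j ω) = Y ω * ε i ω := by
        rw [hYdef, Finset.sum_mul]
        exact Finset.sum_congr rfl fun _ _ => by ring
      rw [Finset.sum_insert hi, e1, Finset.sum_insert hi, e2, Finset.sum_insert hi, hQdef]
      ring
    have hqY : Measurable fun x : Fin n → ℝ => ∑ j ∈ S, A i j * x j := by fun_prop
    have hqQ : Measurable fun x : Fin n → ℝ =>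
        ∑ i ∈ S, ∑ j ∈ S, A i j * (x i * x j) - σ ^ 2 * ∑ i ∈ S, A i i := by fun_prop
    have hqY' : ∀ x y : Fin n → ℝ, (∀ j ∈ S, x j = y j) →
        ∑ j ∈ S, A i j * x j = ∑ j ∈ S, A i j * y j := fun x y hxy =>
      Finset.sum_congr rfl fun j hj => by rw [hxy j hj]
    have hqQ' : ∀ x y : Fin n → ℝ, (∀ j ∈ S, x j = y j) →
        ∑ i ∈ S, ∑ j ∈ S, A i j * (x i * x j) - σ ^ 2 * ∑ i ∈ S, A i i
          = ∑ i ∈ S, ∑ j ∈ S, A i j * (y i * y j) - σ ^ 2 * ∑ i ∈ S, A i i := fun x y hxy => by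
      congr 1
      exact Finset.sum_congr rfl fun a ha => Finset.sum_congr rfl fun b hb => by
        rw [hxy a ha, hxy b hb]
    have ind1 : IndepFun Q (fun ω => ε i ω ^ 2 - σ ^ 2) μ :=
      h.indepFun_comp hi hqQ hqQ' (G := fun x => x ^ 2 - σ ^ 2) (by fun_prop)
    have ind2 : IndepFun (fun ω => Q ω * Y ω) (ε i) μ :=
      h.indepFun_comp hi (hqQ.mul hqY)
        (fun x y hxy => by simp only [Pi.mul_apply]; rw [hqQ' x y hxy, hqY' x y hxy])
        measurable_id
    have ind3 : IndepFun (fun ω => Y ω ^ 2) (fun ω => ε i ω ^ 2) μ :=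
      h.indepFun_comp hi (hqY.pow_const 2)
        (fun x y hxy => by rw [hqY' x y hxy]) (G := fun x => x ^ 2) (by fun_prop)
    have hV : MemLp (fun ω => ε i ω ^ 2 - σ ^ 2) 2 μ := (h.memLp_sq i).sub (memLp_const _)
    have hYε2 : Integrable (fun ω => Y ω ^ 2 * ε i ω ^ 2) μ :=
      ind3.integrable_mul hY.integrable_sq (h.int2 i)
    have hYε : MemLp (fun ω => Y ω * ε i ω) 2 μ := by
      refine (memLp_two_iff_integrable_sq (hY.1.mul (h.meas i).aestronglyMeasurable)).2 ?_
      exact hYε2.congr (ae_of_all _ fun ω => by simp only [Pi.mul_apply]; ring)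
    have hD : MemLp (fun ω => A i i * (ε i ω ^ 2 - σ ^ 2) + 2 * (Y ω * ε i ω)) 2 μ :=
      (hV.const_mul _).add (hYε.const_mul 2)
    have hVm : ∫ ω, (ε i ω ^ 2 - σ ^ 2) ∂μ = 0 := by
      rw [integral_sub (h.int2 i) (integrable_const _), h.var]; simp
    have c1 : ∫ ω, Q ω * (ε i ω ^ 2 - σ ^ 2) ∂μ = 0 := by
      rw [ind1.integral_fun_mul_eq_mul_integral hQ.1 hV.1, hVm, mul_zero]
    have c2 : ∫ ω, Q ω * Y ω * ε i ω ∂μ = 0 := by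
      rw [ind2.integral_fun_mul_eq_mul_integral (hQ.1.mul hY.1) (h.memLp i).1, h.mean, mul_zero]
    have c3 : ∫ ω, Y ω ^ 2 * ε i ω ^ 2 ∂μ = σ ^ 4 * ∑ j ∈ S, A i j ^ 2 := by
      rw [ind3.integral_fun_mul_eq_mul_integral hY.integrable_sq.1 (h.int2 i).1, hYv, h.var]
      ring
    have c4 : ∫ ω, (ε i ω ^ 2 - σ ^ 2) ^ 2 ∂μ ≤ K := by
      have : ∀ ω, (ε i ω ^ 2 - σ ^ 2) ^ 2 = ε i ω ^ 4 - 2 * σ ^ 2 * ε i ω ^ 2 + σ ^ 4 :=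
        fun ω => by ring
      simp_rw [this]
      rw [integral_add (by exact (h.int4 i).sub ((h.int2 i).const_mul _)) (integrable_const _),
        integral_sub (h.int4 i) ((h.int2 i).const_mul _), integral_const_mul, h.var]
      have := h.fourth i
      simp
      nlinarith [sq_nonneg (σ ^ 2)]
    -- Orthogonality of the martingale difference to the past, so that second moments add up.
    have hQD : ∫ ω, Q ω * (A i i * (ε i ω ^ 2 - σ ^ 2) + 2 * (Y ω * ε i ω)) ∂μ = 0 := by
      have i1 : Integrable (fun ω => Q ω * (ε i ω ^ 2 - σ ^ 2)) μ := hQ.integrable_mul hV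
      have i2 : Integrable (fun ω => Q ω * Y ω * ε i ω) μ :=
        (hQ.integrable_mul hYε).congr (ae_of_all _ fun ω => by simp [mul_assoc])
      have : ∀ ω, Q ω * (A i i * (ε i ω ^ 2 - σ ^ 2) + 2 * (Y ω * ε i ω))
          = A i i * (Q ω * (ε i ω ^ 2 - σ ^ 2)) + 2 * (Q ω * Y ω * ε i ω) := fun ω => by ring
      simp_rw [this]
      rw [integral_add (i1.const_mul _) (i2.const_mul _), integral_const_mul,
        integral_const_mul, c1, c2]
      simp
    -- From `(a + b)² ≤ 2 a² + 2 b²`, which dispenses with third moments.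
    have hDb : ∫ ω, (A i i * (ε i ω ^ 2 - σ ^ 2) + 2 * (Y ω * ε i ω)) ^ 2 ∂μ
        ≤ 2 * K * A i i ^ 2 + 8 * σ ^ 4 * ∑ j ∈ S, A i j ^ 2 := by
      have iV := hV.integrable_sq
      calc _ ≤ ∫ ω, (2 * A i i ^ 2 * (ε i ω ^ 2 - σ ^ 2) ^ 2
              + 8 * (Y ω ^ 2 * ε i ω ^ 2)) ∂μ := by
            refine integral_mono hD.integrable_sq
              ((iV.const_mul _).add (hYε2.const_mul 8)) fun ω => ?_
            simp only
            nlinarith [sq_nonneg (A i i * (ε i ω ^ 2 - σ ^ 2) - 2 * (Y ω * ε i ω))]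
        _ ≤ _ := by
            rw [integral_add (iV.const_mul _) (hYε2.const_mul 8), integral_const_mul,
              integral_const_mul, c3]
            nlinarith [sq_nonneg (A i i)]
    simp_rw [e]
    refine ⟨hQ.add hD, ?_⟩
    have hsum : ∑ i' ∈ insert i S, ∑ j ∈ insert i S, A i' j ^ 2
        = ∑ i' ∈ S, ∑ j ∈ S, A i' j ^ 2 + (A i i ^ 2 + 2 * ∑ j ∈ S, A i j ^ 2) := by
      have e1 : ∑ i' ∈ S, ∑ j ∈ insert i S, A i' j ^ 2
          = ∑ i' ∈ S, ∑ j ∈ S, A i' j ^ 2 + ∑ j ∈ S, A i j ^ 2 := by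
        rw [← Finset.sum_add_distrib]
        refine Finset.sum_congr rfl fun i' _ => ?_
        rw [Finset.sum_insert hi, hA i' i]; ring
      rw [Finset.sum_insert hi, e1, Finset.sum_insert hi]
      ring
    have hexp : ∀ ω, (Q ω + (A i i * (ε i ω ^ 2 - σ ^ 2) + 2 * (Y ω * ε i ω))) ^ 2
        = Q ω ^ 2 + 2 * (Q ω * (A i i * (ε i ω ^ 2 - σ ^ 2) + 2 * (Y ω * ε i ω)))
          + (A i i * (ε i ω ^ 2 - σ ^ 2) + 2 * (Y ω * ε i ω)) ^ 2 := fun ω => by ring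
    have iQD : Integrable
        (fun ω => Q ω * (A i i * (ε i ω ^ 2 - σ ^ 2) + 2 * (Y ω * ε i ω))) μ :=
      hQ.integrable_mul hD
    simp_rw [hexp]
    rw [integral_add (by exact hQ.integrable_sq.add (iQD.const_mul 2)) hD.integrable_sq,
      integral_add hQ.integrable_sq (iQD.const_mul 2), integral_const_mul, hQD, hsum]
    have p1 : 0 ≤ ∑ j ∈ S, A i j ^ 2 := Finset.sum_nonneg fun _ _ => sq_nonneg _
    have p2 : 0 ≤ K * ∑ j ∈ S, A i j ^ 2 := mul_nonneg hK p1
    have p3 : 0 ≤ σ ^ 4 * A i i ^ 2 := by positivity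
    nlinarith

end IsNoise

/-! ### Model averaging in orthonormal coordinates -/

noncomputable section

/-- The vectors `basisVec X`, indexed by the natural numbers and extended by zero. -/
def coordVec {n p : ℕ} (X : Matrix (Fin n) (Fin p) ℝ) (l : ℕ) : Fin n → ℝ :=
  if h : l < p then basisVec X ⟨l, h⟩ else 0

/-- The coordinates of a vector with respect to `coordVec X`. -/
def coef {n p : ℕ} (X : Matrix (Fin n) (Fin p) ℝ) (v : Fin n → ℝ) (l : ℕ) : ℝ :=
  coordVec X l ⬝ᵥ v

/-- The total weight of the models that contain the regressor with index `l`. -/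
def shrinkage {M : ℕ} (k : ℕ → ℕ) (w : Fin M → ℝ) (l : ℕ) : ℝ :=
  ∑ m : Fin M, if l < k (m + 1) then w m else 0

/-- The total weight of the models from the `j`-th on (counted from zero). -/
def tailWeight {M : ℕ} (w : Fin M → ℝ) (j : ℕ) : ℝ :=
  ∑ m : Fin M, if j ≤ m then w m else 0

section Coordinates

variable {n p : ℕ} {X : Matrix (Fin n) (Fin p) ℝ}

lemma coordVec_dotProduct (hX : LinearIndependent ℝ X.col) {i j : ℕ} (hi : i < p) (hj : j < p) :
    coordVec X i ⬝ᵥ coordVec X j = if i = j then 1 else 0 := by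
  simp [coordVec, hi, hj, basisVec_dotProduct hX]

lemma sqNorm_eq_dotProduct (v : Fin n → ℝ) : sqNorm v = v ⬝ᵥ v := by
  simp [sqNorm, dotProduct, sq]

lemma dotProduct_sum_coordVec (hX : LinearIndependent ℝ X.col) (a b : ℕ → ℝ) :
    (∑ l ∈ Finset.range p, a l • coordVec X l) ⬝ᵥ (∑ l ∈ Finset.range p, b l • coordVec X l)
      = ∑ l ∈ Finset.range p, a l * b l := by
  rw [sum_dotProduct]
  refine Finset.sum_congr rfl fun i hi => ?_
  rw [dotProduct_sum]
  have : ∀ j ∈ Finset.range p, (a i • coordVec X i) ⬝ᵥ (b j • coordVec X j)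
      = if i = j then a i * b j else 0 := fun j hj => by
    rw [smul_dotProduct, dotProduct_smul,
      coordVec_dotProduct hX (Finset.mem_range.1 hi) (Finset.mem_range.1 hj)]
    split_ifs <;> simp
  rw [Finset.sum_congr rfl this]
  simp [Finset.mem_range.1 hi]

lemma sqNorm_sum_coordVec (hX : LinearIndependent ℝ X.col) (a : ℕ → ℝ) :
    sqNorm (∑ l ∈ Finset.range p, a l • coordVec X l) = ∑ l ∈ Finset.range p, a l ^ 2 := by
  rw [sqNorm_eq_dotProduct, dotProduct_sum_coordVec hX]
  simp [sq]

lemma coef_add (v w : Fin n → ℝ) (l : ℕ) : coef X (v + w) l = coef X v l + coef X w l :=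
  dotProduct_add _ _ _

lemma sum_coef_smul (v : Fin n → ℝ) :
    (∑ l ∈ Finset.range p, coef X v l • coordVec X l)
      = (∑ j : Fin p, Matrix.vecMulVec (basisVec X j) (basisVec X j)) *ᵥ v := by
  rw [Matrix.sum_mulVec, Finset.sum_range]
  refine Finset.sum_congr rfl fun j _ => ?_
  ext i
  simp [coef, coordVec, Matrix.vecMulVec_mulVec, mul_comm]

/-- The mean lies in the column space and so equals its own expansion. Hence loss and bias live in
the `p` coordinates, although the response has a component outside their span. -/
lemma sum_coef_smul_mulVec (hX : LinearIndependent ℝ X.col) (β : Fin p → ℝ) :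
    (∑ l ∈ Finset.range p, coef X (X *ᵥ β) l • coordVec X l) = X *ᵥ β := by
  set Q := ∑ j : Fin p, Matrix.vecMulVec (basisVec X j) (basisVec X j) with hQ
  have hQφ : ∀ j, Q *ᵥ basisVec X j = basisVec X j := fun j => by
    simp only [hQ, Matrix.sum_mulVec, Matrix.vecMulVec_mulVec, basisVec_dotProduct hX]
    simp
  have hle : Submodule.span ℝ (basisVec X '' {j | (j : ℕ) < p})
      ≤ LinearMap.eqLocus Q.mulVecLin LinearMap.id := by
    rw [Submodule.span_le]
    rintro _ ⟨i, -, rfl⟩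
    exact hQφ i
  rw [span_basisVec] at hle
  have hmem : X *ᵥ β ∈ Submodule.span ℝ (X.col '' {j | (j : ℕ) < p}) := by
    have : X *ᵥ β = ∑ j, β j • X.col j := by
      ext i; simp [Matrix.mulVec, dotProduct, mul_comm]
    rw [this]
    exact Submodule.sum_mem _ fun j _ => Submodule.smul_mem _ _
      (Submodule.subset_span ⟨j, j.2, rfl⟩)
  rw [sum_coef_smul]
  exact hle hmem

variable {M : ℕ} {k : ℕ → ℕ}

lemma maMatrix_eq (hX : LinearIndependent ℝ X.col) (w : Fin M → ℝ) :
    maMatrix X (nestedFamily p M k) w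
      = ∑ j : Fin p, shrinkage k w j • Matrix.vecMulVec (basisVec X j) (basisVec X j) := by
  simp only [maMatrix, nestedFamily, projMatrix_nestedModel hX, shrinkage, Finset.sum_smul]
  simp only [nestedModel, Finset.sum_filter, Finset.smul_sum]
  rw [Finset.sum_comm]
  refine Finset.sum_congr rfl fun j _ => Finset.sum_congr rfl fun m _ => ?_
  split_ifs <;> simp

lemma maMatrix_mulVec (hX : LinearIndependent ℝ X.col) (w : Fin M → ℝ) (v : Fin n → ℝ) :
    maMatrix X (nestedFamily p M k) w *ᵥ v
      = ∑ l ∈ Finset.range p, (shrinkage k w l * coef X v l) • coordVec X l := by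
  rw [maMatrix_eq hX, Matrix.sum_mulVec, Finset.sum_range]
  refine Finset.sum_congr rfl fun j _ => ?_
  ext i
  simp [coef, coordVec, Matrix.vecMulVec_mulVec, Matrix.smul_mulVec]
  ring

lemma trace_maMatrix (hX : LinearIndependent ℝ X.col) (w : Fin M → ℝ) :
    ((maMatrix X (nestedFamily p M k) w)ᵀ * maMatrix X (nestedFamily p M k) w).trace
      = ∑ l ∈ Finset.range p, shrinkage k w l ^ 2 := by
  have h1 : (maMatrix X (nestedFamily p M k) w)ᵀ * maMatrix X (nestedFamily p M k) w
      = ∑ j : Fin p, shrinkage k w j ^ 2 • Matrix.vecMulVec (basisVec X j) (basisVec X j) := by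
    rw [maMatrix_eq hX, Matrix.transpose_sum, Finset.sum_mul]
    refine Finset.sum_congr rfl fun j _ => ?_
    rw [Finset.mul_sum, Finset.sum_eq_single j]
    · rw [Matrix.transpose_smul, Matrix.transpose_vecMulVec, Matrix.smul_mul, Matrix.mul_smul,
        Matrix.vecMulVec_mul_vecMulVec, basisVec_dotProduct hX, smul_smul, sq]
      simp
    · intro i _ hij
      rw [Matrix.transpose_smul, Matrix.transpose_vecMulVec, Matrix.smul_mul, Matrix.mul_smul,
        Matrix.vecMulVec_mul_vecMulVec, basisVec_dotProduct hX]
      simp [hij.symm]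
    · simp
  rw [h1, Matrix.trace_sum, Finset.sum_range]
  refine Finset.sum_congr rfl fun j _ => ?_
  rw [Matrix.trace_smul, Matrix.trace_vecMulVec, basisVec_dotProduct hX]
  simp

lemma sum_card_mul (hk : ∀ j < M, k (j + 1) ≤ p) (w : Fin M → ℝ) :
    ∑ m, ((nestedFamily p M k m).card : ℝ) * w m = ∑ l ∈ Finset.range p, shrinkage k w l := by
  simp only [shrinkage]
  rw [Finset.sum_comm]
  refine Finset.sum_congr rfl fun m _ => ?_
  have h2 : (Finset.range p).filter (fun l => l < k (m + 1)) = Finset.range (k (m + 1)) := by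
    ext l
    have := hk m m.2
    simp; omega
  have h3 : (nestedFamily p M k m).card = ((Finset.range p).filter (fun l => l < k (m + 1))).card := by
    simp only [nestedFamily, nestedModel, Finset.card_filter]
    exact (Finset.sum_range (fun l => if l < k (m + 1) then 1 else 0)).symm
  rw [h3, ← Finset.sum_filter, Finset.sum_const, nsmul_eq_mul]

lemma loss_eq (hX : LinearIndependent ℝ X.col) {f : Fin n → ℝ} {β : Fin p → ℝ}
    (hf : f = X *ᵥ β) (w : Fin M → ℝ) (e : Fin n → ℝ) :
    loss (maEstimator X (nestedFamily p M k) w (f + e)) f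
      = (∑ l ∈ Finset.range p,
          (shrinkage k w l * (coef X f l + coef X e l) - coef X f l) ^ 2) / n := by
  have h1 : maEstimator X (nestedFamily p M k) w (f + e) - f
      = ∑ l ∈ Finset.range p,
        (shrinkage k w l * (coef X f l + coef X e l) - coef X f l) • coordVec X l := by
    have h2 := sum_coef_smul_mulVec hX β
    rw [← hf] at h2
    rw [maEstimator, maMatrix_mulVec hX]
    simp only [coef_add, sub_smul, Finset.sum_sub_distrib, h2]
  rw [loss, h1, sqNorm_sum_coordVec hX]

lemma plugInRisk_eq (hX : LinearIndependent ℝ X.col) {f : Fin n → ℝ} {β : Fin p → ℝ}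
    (hf : f = X *ᵥ β) (σ : ℝ) (w : Fin M → ℝ) :
    plugInRisk σ X f (nestedFamily p M k) w
      = (∑ l ∈ Finset.range p, ((1 - shrinkage k w l) ^ 2 * coef X f l ^ 2
          + σ ^ 2 * shrinkage k w l ^ 2)) / n := by
  have h1 : f - maMatrix X (nestedFamily p M k) w *ᵥ f
      = ∑ l ∈ Finset.range p, ((1 - shrinkage k w l) * coef X f l) • coordVec X l := by
    have h2 := sum_coef_smul_mulVec hX β
    rw [← hf] at h2
    rw [maMatrix_mulVec hX]
    simp only [sub_mul, one_mul, sub_smul, Finset.sum_sub_distrib, h2]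
  rw [plugInRisk, h1, sqNorm_sum_coordVec hX, trace_maMatrix hX, Finset.sum_add_distrib,
    ← Finset.mul_sum]
  simp only [mul_pow]
  ring

/-- The second summand does not involve `w` and drops out when two weight vectors are compared; the
third is the noise to be controlled. The penalty `2 s ∑ γ` is centred by `σ ^ 2`, which turns `γ²
e²` and `-2 γ e²` into mean-zero terms and leaves the error `s - σ ^ 2`. -/
lemma criterion_eq (hX : LinearIndependent ℝ X.col) (hk : ∀ j < M, k (j + 1) ≤ p)
    {f : Fin n → ℝ} {β : Fin p → ℝ} (hf : f = X *ᵥ β) (σ s : ℝ) (e : Fin n → ℝ) (w : Fin M → ℝ) :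
    criterion X (nestedFamily p M k) s (f + e) w
      = plugInRisk σ X f (nestedFamily p M k) w
        + (sqNorm (f + e) - ∑ l ∈ Finset.range p, (coef X f l + coef X e l) ^ 2
          + ∑ l ∈ Finset.range p, coef X e l ^ 2) / n
        + (2 * ∑ l ∈ Finset.range p, (1 - shrinkage k w l) ^ 2 * (coef X f l * coef X e l)
          + ∑ l ∈ Finset.range p,
            (shrinkage k w l ^ 2 - 2 * shrinkage k w l) * (coef X e l ^ 2 - σ ^ 2)
          + 2 * (s - σ ^ 2) * ∑ l ∈ Finset.range p, shrinkage k w l) / n := by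
  set y := f + e with hy
  set P := maEstimator X (nestedFamily p M k) w y with hP
  have hPe : P = ∑ l ∈ Finset.range p, (shrinkage k w l * coef X y l) • coordVec X l :=
    maMatrix_mulVec hX w y
  have h1 : P ⬝ᵥ P = ∑ l ∈ Finset.range p, (shrinkage k w l * coef X y l) ^ 2 := by
    rw [← sqNorm_eq_dotProduct, hPe, sqNorm_sum_coordVec hX]
  have h2 : P ⬝ᵥ y = ∑ l ∈ Finset.range p, shrinkage k w l * coef X y l ^ 2 := by
    rw [hPe, sum_dotProduct]
    refine Finset.sum_congr rfl fun l _ => ?_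
    rw [smul_dotProduct, smul_eq_mul, ← coef]; ring
  have h3 : sqNorm (y - P) = sqNorm y + ∑ l ∈ Finset.range p,
      ((shrinkage k w l * coef X y l) ^ 2 - 2 * (shrinkage k w l * coef X y l ^ 2)) := by
    rw [sqNorm_eq_dotProduct, sub_dotProduct, dotProduct_sub, dotProduct_sub,
      dotProduct_comm y P, h1, h2, sqNorm_eq_dotProduct, Finset.sum_sub_distrib, ← Finset.mul_sum]
    ring
  rw [criterion, ← hP, h3, sum_card_mul hk, plugInRisk_eq hX hf]
  have h4 : ∀ l, coef X y l = coef X f l + coef X e l := fun l => coef_add _ _ _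
  have h5 : ∑ l ∈ Finset.range p,
      ((shrinkage k w l * coef X y l) ^ 2 - 2 * (shrinkage k w l * coef X y l ^ 2))
        + 2 * s * ∑ l ∈ Finset.range p, shrinkage k w l
      = (∑ l ∈ Finset.range p, ((1 - shrinkage k w l) ^ 2 * coef X f l ^ 2
          + σ ^ 2 * shrinkage k w l ^ 2))
        + (- ∑ l ∈ Finset.range p, (coef X f l + coef X e l) ^ 2
          + ∑ l ∈ Finset.range p, coef X e l ^ 2)
        + (2 * ∑ l ∈ Finset.range p, (1 - shrinkage k w l) ^ 2 * (coef X f l * coef X e l)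
          + ∑ l ∈ Finset.range p,
            (shrinkage k w l ^ 2 - 2 * shrinkage k w l) * (coef X e l ^ 2 - σ ^ 2)
          + 2 * (s - σ ^ 2) * ∑ l ∈ Finset.range p, shrinkage k w l) := by
    simp only [Finset.mul_sum, ← Finset.sum_neg_distrib, ← Finset.sum_add_distrib]
    refine Finset.sum_congr rfl fun l _ => ?_
    rw [h4]; ring
  have h6 := congrArg (· / (n : ℝ)) h5
  linear_combination h6

end Coordinates

/-! ### Block structure of nested families -/

section Blocks

variable {p M : ℕ} {k : ℕ → ℕ}

lemma IsNestedSizes.monotoneOn (hk : IsNestedSizes p M k) {i j : ℕ} (hij : i ≤ j) (hj : j ≤ M) :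
    k i ≤ k j := by
  induction j, hij using Nat.le_induction with
  | base => exact le_rfl
  | succ j hij ih => exact (ih (by omega)).trans (hk.lt_succ j (by omega)).le

lemma IsNestedSizes.strictMonoOn (hk : IsNestedSizes p M k) {i j : ℕ} (hij : i < j)
    (hj : j ≤ M) : k i < k j :=
  (hk.lt_succ i (by omega)).trans_le (hk.monotoneOn hij hj)

lemma shrinkage_eq_tailWeight (hk : IsNestedSizes p M k) (w : Fin M → ℝ) {j l : ℕ} (hj : j < M)
    (hl : l ∈ Finset.Ico (k j) (k (j + 1))) : shrinkage k w l = tailWeight w j := by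
  rw [Finset.mem_Ico] at hl
  refine Finset.sum_congr rfl fun m _ => ?_
  have h : l < k (m + 1) ↔ j ≤ m := by
    constructor
    · intro h
      by_contra hlt
      have := hk.monotoneOn (show (m : ℕ) + 1 ≤ j by omega) hj.le
      omega
    · intro h
      have := hk.monotoneOn (show j + 1 ≤ (m : ℕ) + 1 by omega) m.2
      omega
  simp [h]

lemma shrinkage_eq_zero (hk : IsNestedSizes p M k) (w : Fin M → ℝ) {l : ℕ} (hl : k M ≤ l) :
    shrinkage k w l = 0 := by
  refine Finset.sum_eq_zero fun m _ => ?_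
  have := hk.monotoneOn (show (m : ℕ) + 1 ≤ M from m.2) le_rfl
  rw [if_neg (by omega)]

/-- The shrinkage factor is constant on each block of regressors separating two successive models
and zero beyond the largest model, whence the remainder with `Φ 0`. -/
lemma sum_shrinkage (hk : IsNestedSizes p M k) (w : Fin M → ℝ) (Φ : ℝ → ℝ) (F : ℕ → ℝ) :
    ∑ l ∈ Finset.range p, Φ (shrinkage k w l) * F l
      = ∑ j ∈ Finset.range M, Φ (tailWeight w j) * ∑ l ∈ Finset.Ico (k j) (k (j + 1)), F l
        + Φ 0 * ∑ l ∈ Finset.Ico (k M) p, F l := by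
  have h1 : ∀ N ≤ M, ∑ l ∈ Finset.range (k N), Φ (shrinkage k w l) * F l
      = ∑ j ∈ Finset.range N,
          Φ (tailWeight w j) * ∑ l ∈ Finset.Ico (k j) (k (j + 1)), F l := by
    intro N hN
    induction N with
    | zero => simp [hk.zero]
    | succ N ih =>
      rw [Finset.sum_range_succ, ← ih (by omega), ← Finset.sum_range_add_sum_Ico _
        (hk.lt_succ N (by omega)).le, Finset.mul_sum]
      congr 1
      exact Finset.sum_congr rfl fun l hl => by
        rw [shrinkage_eq_tailWeight hk w (by omega) hl]
  rw [← Finset.sum_range_add_sum_Ico _ hk.le, h1 M le_rfl, Finset.mul_sum]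
  congr 1
  exact Finset.sum_congr rfl fun l hl => by
    rw [shrinkage_eq_zero hk w (Finset.mem_Ico.1 hl).1]

lemma tailWeight_zero {w : Fin M → ℝ} (hw : w ∈ stdSimplex ℝ (Fin M)) : tailWeight w 0 = 1 := by
  simpa [tailWeight] using hw.2

lemma tailWeight_of_le (w : Fin M → ℝ) {j : ℕ} (hj : M ≤ j) : tailWeight w j = 0 :=
  Finset.sum_eq_zero fun m _ => if_neg (by omega)

lemma tailWeight_antitone {w : Fin M → ℝ} (hw : w ∈ stdSimplex ℝ (Fin M)) :
    Antitone (tailWeight w) := fun i j hij => Finset.sum_le_sum fun m _ => by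
  have := hw.1 m
  split_ifs <;> first | omega | simp_all

lemma tailWeight_nonneg {w : Fin M → ℝ} (hw : w ∈ stdSimplex ℝ (Fin M)) (j : ℕ) :
    0 ≤ tailWeight w j := Finset.sum_nonneg fun m _ => by
  have := hw.1 m
  split_ifs <;> simp_all

lemma tailWeight_le_one {w : Fin M → ℝ} (hw : w ∈ stdSimplex ℝ (Fin M)) (j : ℕ) :
    tailWeight w j ≤ 1 :=
  (tailWeight_antitone hw (Nat.zero_le j)).trans_eq (tailWeight_zero hw)

lemma shrinkage_nonneg {w : Fin M → ℝ} (hw : w ∈ stdSimplex ℝ (Fin M)) (l : ℕ) :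
    0 ≤ shrinkage k w l := Finset.sum_nonneg fun m _ => by
  have := hw.1 m
  split_ifs <;> simp_all

lemma shrinkage_le_one {w : Fin M → ℝ} (hw : w ∈ stdSimplex ℝ (Fin M)) (l : ℕ) :
    shrinkage k w l ≤ 1 := by
  rw [← hw.2]
  refine Finset.sum_le_sum fun m _ => ?_
  have := hw.1 m
  split_ifs <;> simp_all

end Blocks

end

/-! ### The noise in orthonormal coordinates -/

section Noise

variable {n p : ℕ} {X : Matrix (Fin n) (Fin p) ℝ} {Ω : Type*} [MeasurableSpace Ω]
  {μ : Measure Ω} [IsProbabilityMeasure μ] {ε : Fin n → Ω → ℝ} {σ K : ℝ}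

lemma sum_ite_range {S : Finset ℕ} (hS : S ⊆ Finset.range p) {E : Type*} [AddCommMonoid E]
    (F : ℕ → E) : (∑ l ∈ Finset.range p, if l ∈ S then F l else 0) = ∑ l ∈ S, F l := by
  rw [Finset.sum_ite_mem, Finset.inter_eq_right.2 hS]

/-- The rotated noise coordinates are in general not independent, so the sum is rewritten as a
linear form in the original noise; orthonormality preserves the norm of the coefficient vector. -/
lemma IsNoise.sum_coef (h : IsNoise μ ε σ K) (hX : LinearIndependent ℝ X.col) {S : Finset ℕ}
    (hS : S ⊆ Finset.range p) (c : ℕ → ℝ) :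
    MemLp (fun ω => ∑ l ∈ S, c l * coef X (fun i => ε i ω) l) 2 μ ∧
      ∫ ω, ∑ l ∈ S, c l * coef X (fun i => ε i ω) l ∂μ = 0 ∧
      ∫ ω, (∑ l ∈ S, c l * coef X (fun i => ε i ω) l) ^ 2 ∂μ = σ ^ 2 * ∑ l ∈ S, c l ^ 2 := by
  set v : Fin n → ℝ := ∑ l ∈ S, c l • coordVec X l with hv
  have e : ∀ ω, ∑ l ∈ S, c l * coef X (fun i => ε i ω) l = ∑ i, v i * ε i ω := fun ω => by
    change _ = v ⬝ᵥ fun i => ε i ω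
    rw [hv, sum_dotProduct]
    exact Finset.sum_congr rfl fun l _ => by rw [smul_dotProduct, smul_eq_mul]; rfl
  have hv2 : ∑ i, v i ^ 2 = ∑ l ∈ S, c l ^ 2 := by
    have := sqNorm_sum_coordVec hX (fun l => if l ∈ S then c l else 0)
    simp only [ite_smul, zero_smul, ite_pow, ne_eq, OfNat.ofNat_ne_zero, not_false_eq_true,
      zero_pow, sum_ite_range hS] at this
    exact this
  simp_rw [e]
  rw [← hv2]
  exact h.linear_form v Finset.univ

/-- The sum of squares is the quadratic form of the orthogonal projection onto the chosen
coordinates. Its trace, which centres the form, and its squared Frobenius norm, which bounds the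
variance, both equal `S.card`. -/
lemma IsNoise.sum_coef_sq (h : IsNoise μ ε σ K) (hK : 0 ≤ K) (hX : LinearIndependent ℝ X.col)
    {S : Finset ℕ} (hS : S ⊆ Finset.range p) :
    MemLp (fun ω => ∑ l ∈ S, (coef X (fun i => ε i ω) l ^ 2 - σ ^ 2)) 2 μ ∧
      ∫ ω, (∑ l ∈ S, (coef X (fun i => ε i ω) l ^ 2 - σ ^ 2)) ^ 2 ∂μ
        ≤ (2 * K + 4 * σ ^ 4) * S.card := by
  set A : Matrix (Fin n) (Fin n) ℝ := fun i j => ∑ l ∈ S, coordVec X l i * coordVec X l j with hA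
  have horth : ∀ l ∈ S, ∀ l' ∈ S,
      ∑ i, coordVec X l i * coordVec X l' i = if l = l' then 1 else 0 := fun l hl l' hl' =>
    coordVec_dotProduct hX (Finset.mem_range.1 (hS hl)) (Finset.mem_range.1 (hS hl'))
  have htr : ∑ i, A i i = S.card := by
    simp only [hA]
    rw [Finset.sum_comm, Finset.sum_congr rfl fun l hl => (horth l hl l hl).trans (if_pos rfl)]
    simp
  have hsq : ∑ i, ∑ j, A i j ^ 2 = S.card := by
    have h1 : ∀ i j, A i j ^ 2 = ∑ l ∈ S, ∑ l' ∈ S,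
        (coordVec X l i * coordVec X l' i) * (coordVec X l j * coordVec X l' j) := fun i j => by
      rw [sq, hA, Finset.sum_mul_sum]
      exact Finset.sum_congr rfl fun _ _ => Finset.sum_congr rfl fun _ _ => by ring
    have h2 : ∑ i, ∑ j, A i j ^ 2 = ∑ l ∈ S, ∑ l' ∈ S,
        (∑ i, coordVec X l i * coordVec X l' i) * (∑ j, coordVec X l j * coordVec X l' j) := by
      simp_rw [h1, Finset.sum_mul_sum]
      calc _ = ∑ i, ∑ l ∈ S, ∑ j, ∑ l' ∈ S,
            (coordVec X l i * coordVec X l' i) * (coordVec X l j * coordVec X l' j) :=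
            Finset.sum_congr rfl fun _ _ => Finset.sum_comm
        _ = ∑ l ∈ S, ∑ i, ∑ j, ∑ l' ∈ S,
            (coordVec X l i * coordVec X l' i) * (coordVec X l j * coordVec X l' j) :=
            Finset.sum_comm
        _ = ∑ l ∈ S, ∑ i, ∑ l' ∈ S, ∑ j,
            (coordVec X l i * coordVec X l' i) * (coordVec X l j * coordVec X l' j) :=
            Finset.sum_congr rfl fun _ _ => Finset.sum_congr rfl fun _ _ => Finset.sum_comm
        _ = _ := Finset.sum_congr rfl fun _ _ => Finset.sum_comm
    rw [h2, Finset.sum_congr rfl fun l hl => Finset.sum_congr rfl fun l' hl' => by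
      rw [horth l hl l' hl']]
    simp
  have e : ∀ ω, ∑ l ∈ S, (coef X (fun i => ε i ω) l ^ 2 - σ ^ 2)
      = ∑ i, ∑ j, A i j * (ε i ω * ε j ω) - σ ^ 2 * ∑ i, A i i := fun ω => by
    have h1 : ∑ i, ∑ j, A i j * (ε i ω * ε j ω)
        = ∑ l ∈ S, coef X (fun i => ε i ω) l ^ 2 := by
      have h2 : ∀ l, coef X (fun i => ε i ω) l ^ 2
          = ∑ i, ∑ j, (coordVec X l i * ε i ω) * (coordVec X l j * ε j ω) := fun l => by
        rw [sq, coef, dotProduct, Finset.sum_mul_sum]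
      simp only [hA, h2, Finset.sum_mul]
      calc _ = ∑ i, ∑ l ∈ S, ∑ j, coordVec X l i * coordVec X l j * (ε i ω * ε j ω) :=
            Finset.sum_congr rfl fun _ _ => Finset.sum_comm
        _ = ∑ l ∈ S, ∑ i, ∑ j, coordVec X l i * coordVec X l j * (ε i ω * ε j ω) :=
            Finset.sum_comm
        _ = _ := Finset.sum_congr rfl fun _ _ => Finset.sum_congr rfl fun _ _ =>
            Finset.sum_congr rfl fun _ _ => by ring
    rw [h1, htr, Finset.sum_sub_distrib, Finset.sum_const, nsmul_eq_mul]
    ring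
  simp_rw [e]
  rw [← hsq]
  exact h.quadratic_form hK
    (fun i j => Finset.sum_congr rfl fun l _ => mul_comm _ _) Finset.univ

end Noise

/-! ### Telescoping sums over blocks -/

lemma sum_blocks {κ : ℕ → ℕ} (hκ : Monotone κ) (F : ℕ → ℝ) {s e : ℕ} (hse : s ≤ e) :
    ∑ j ∈ Finset.Ico s e, ∑ l ∈ Finset.Ico (κ j) (κ (j + 1)), F l
      = ∑ l ∈ Finset.Ico (κ s) (κ e), F l := by
  induction e, hse using Nat.le_induction with
  | base => simp
  | succ e hse ih =>
    rw [Finset.sum_Ico_succ_top hse, ih,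
      Finset.sum_Ico_consecutive F (hκ hse) (hκ (Nat.le_succ e))]

lemma sum_blocks_antitone {κ : ℕ → ℕ} (hκ : Antitone κ) (F : ℕ → ℝ) {s e : ℕ} (hse : s ≤ e) :
    ∑ j ∈ Finset.Ico s e, ∑ l ∈ Finset.Ico (κ (j + 1)) (κ j), F l
      = ∑ l ∈ Finset.Ico (κ e) (κ s), F l := by
  induction e, hse using Nat.le_induction with
  | base => simp
  | succ e hse ih =>
    rw [Finset.sum_Ico_succ_top hse, ih, add_comm,
      Finset.sum_Ico_consecutive F (hκ (Nat.le_succ e)) (hκ hse)]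

/-- Undoes the reversal of the blocks: index `0` and the indices beyond `M` are padding, and index
`M - j` stands for block `j`. -/
lemma sum_range_reflect_of_zero {M N : ℕ} (hMN : M < N) {F G : ℕ → ℝ} (h0 : F 0 = 0)
    (hz : ∀ i, M < i → F i = 0) (hFG : ∀ j < M, F (M - j) = G j) :
    ∑ i ∈ Finset.range N, F i = ∑ j ∈ Finset.range M, G j := by
  rw [Finset.eventually_constant_sum (N := M + 1) (fun i hi => hz i hi) hMN,
    Finset.sum_range_succ', h0, add_zero, ← Finset.sum_range_reflect]
  refine Finset.sum_congr rfl fun j hj => ?_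
  rw [Finset.mem_range] at hj
  rw [← hFG j hj]
  congr 1
  omega

/-! ### Complexity of a nested family -/

/-- Every term is at most one. The first one is bounded so because `κ 0` may be zero; in the others
the denominator is lowered to `κ j`. -/
lemma sum_div_head_le {M : ℕ} {κ : ℕ → ℝ} (h0 : 0 ≤ κ 0) (hκ : ∀ j < M, κ j < κ (j + 1)) :
    ∑ j ∈ Finset.range M, (κ (j + 1) - κ j) / κ (j + 1)
      ≤ min (M : ℝ) (1 + ∑ j ∈ Finset.Ico 1 M, (κ (j + 1) - κ j) / κ j) := by
  have hnn : ∀ j ≤ M, 0 ≤ κ j := by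
    intro j hj
    induction j with
    | zero => exact h0
    | succ j ih => exact (ih (by omega)).trans (hκ j (by omega)).le
  have hpos : ∀ j < M, 0 < κ (j + 1) := fun j hj => (hnn j hj.le).trans_lt (hκ j hj)
  have h1 : ∀ j < M, (κ (j + 1) - κ j) / κ (j + 1) ≤ 1 := fun j hj => by
    rw [div_le_one (hpos j hj)]; linarith [hnn j hj.le]
  refine le_min ?_ ?_
  · calc _ ≤ ∑ j ∈ Finset.range M, (1 : ℝ) :=
          Finset.sum_le_sum fun j hj => h1 j (Finset.mem_range.1 hj)
      _ = M := by simp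
  · rcases Nat.eq_zero_or_pos M with rfl | hM
    · simp
    · rw [Finset.range_eq_Ico, Finset.sum_eq_sum_Ico_succ_bot hM]
      refine add_le_add (h1 0 hM) (Finset.sum_le_sum fun j hj => ?_)
      rw [Finset.mem_Ico] at hj
      have hj0 : 0 < κ j := by
        have := hpos (j - 1) (by omega)
        rwa [show j - 1 + 1 = j by omega] at this
      exact div_le_div_of_nonneg_left (by linarith [hκ j hj.2]) hj0 (hκ j hj.2).le

/-- The terms from `M'` on are quotients with denominator zero, hence zero. The last remaining one
is at most one, and in the earlier ones lowering the denominator to `S (j + 1)` shifts the index by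
one. -/
lemma sum_div_tail_le {M M' : ℕ} {S : ℕ → ℝ} (hS0 : ∀ j, 0 ≤ S j)
    (hS : ∀ j < M, S (j + 1) ≤ S j) (h1 : 1 ≤ M') (hM : M' ≤ M) (hM' : S M' = 0)
    (hlt : ∀ j, 1 ≤ j → j < M' → S j ≠ 0) :
    ∑ j ∈ Finset.range M, (S j - S (j + 1)) / S j
      ≤ min (M : ℝ) (1 + ∑ j ∈ Finset.Ico 1 M', (S (j - 1) - S j) / S j) := by
  have hle : ∀ j, (S j - S (j + 1)) / S j ≤ 1 := fun j =>
    div_le_one_of_le₀ (by linarith [hS0 (j + 1)]) (hS0 j)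
  have hz : ∀ j, M' ≤ j → j ≤ M → S j = 0 := by
    intro j hj
    induction j, hj using Nat.le_induction with
    | base => exact fun _ => hM'
    | succ j hj ih =>
      intro hjM
      exact le_antisymm ((hS j (by omega)).trans_eq (ih (by omega))) (hS0 _)
  refine le_min ?_ ?_
  · calc _ ≤ ∑ j ∈ Finset.range M, (1 : ℝ) := Finset.sum_le_sum fun j _ => hle j
      _ = M := by simp
  · rw [← Finset.sum_range_add_sum_Ico _ hM]
    have : ∑ j ∈ Finset.Ico M' M, (S j - S (j + 1)) / S j = 0 :=
      Finset.sum_eq_zero fun j hj => by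
        rw [Finset.mem_Ico] at hj
        rw [hz j hj.1 hj.2.le, div_zero]
    rw [this, add_zero]
    obtain ⟨m, rfl⟩ : ∃ m, M' = m + 1 := ⟨M' - 1, by omega⟩
    rw [Finset.sum_range_succ, add_comm]
    refine add_le_add (hle m) ?_
    rw [Finset.sum_Ico_eq_sum_range, Nat.add_sub_cancel]
    refine Finset.sum_le_sum fun j hj => ?_
    rw [Finset.mem_range] at hj
    rw [Nat.add_sub_cancel_left, add_comm 1 j]
    refine div_le_div_of_nonneg_left (by linarith [hS j (by omega)]) ?_ (hS j (by omega))
    exact (hS0 _).lt_of_ne' (hlt _ (by omega) (by omega))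

lemma blockSum_nonneg (θ : ℕ → ℝ) (a b : ℕ) : 0 ≤ blockSum θ a b :=
  Finset.sum_nonneg fun _ _ => sq_nonneg _

lemma cutoff_spec {θ : ℕ → ℝ} {M : ℕ} {k : ℕ → ℕ} (hM : 1 ≤ M) :
    1 ≤ cutoff θ M k ∧ cutoff θ M k ≤ M ∧ blockSum θ (k (cutoff θ M k)) (k M) = 0 :=
  Nat.sInf_mem (s := {j : ℕ | 1 ≤ j ∧ j ≤ M ∧ blockSum θ (k j) (k M) = 0})
    ⟨M, hM, le_rfl, by simp [blockSum]⟩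

lemma blockSum_ne_zero_of_lt_cutoff {θ : ℕ → ℝ} {M : ℕ} {k : ℕ → ℕ} (hM : 1 ≤ M) {j : ℕ}
    (h1 : 1 ≤ j) (hj : j < cutoff θ M k) : blockSum θ (k j) (k M) ≠ 0 := fun h =>
  Nat.notMem_of_lt_sInf hj ⟨h1, by have := (cutoff_spec (θ := θ) (k := k) hM).2.1; omega, h⟩

lemma blockSum_anti (θ : ℕ → ℝ) {a a' b : ℕ} (h : a ≤ a') : blockSum θ a' b ≤ blockSum θ a b :=
  Finset.sum_le_sum_of_subset_of_nonneg (Finset.Ioc_subset_Ioc_left h) fun _ _ _ => sq_nonneg _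

/-- Both relative variation sums of a nested family are controlled by `psi`. -/
lemma sums_le_psi {p M : ℕ} {k : ℕ → ℕ} (hk : IsNestedSizes p M k) (θ : ℕ → ℝ) :
    (∑ j ∈ Finset.range M, (blockSum θ (k j) (k M) - blockSum θ (k (j + 1)) (k M))
        / blockSum θ (k j) (k M)) * (1 + Real.log M) ^ 2 ≤ 4 * psi θ M k ∧
      (∑ j ∈ Finset.range M, ((k (j + 1) : ℝ) - k j) / k (j + 1)) * (1 + Real.log M) ^ 2
        ≤ 4 * psi θ M k := by
  obtain ⟨c1, c2, c3⟩ := cutoff_spec (θ := θ) (k := k) hk.one_le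
  have hS : ∀ j < M, blockSum θ (k (j + 1)) (k M) ≤ blockSum θ (k j) (k M) := fun j hj =>
    blockSum_anti θ (hk.lt_succ j hj).le
  have b1 := sum_div_tail_le (S := fun j => blockSum θ (k j) (k M))
    (fun j => blockSum_nonneg _ _ _) hS c1 c2 c3
    (fun j hj hj' => blockSum_ne_zero_of_lt_cutoff hk.one_le hj hj')
  have b2 := sum_div_head_le (M := M) (κ := fun j => (k j : ℝ)) (by positivity)
    (fun j hj => by exact_mod_cast hk.lt_succ j hj)
  have n1 : 0 ≤ ∑ j ∈ Finset.Ico 1 M, ((k (j + 1) : ℝ) - k j) / k j :=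
    Finset.sum_nonneg fun j hj => div_nonneg
      (sub_nonneg.2 (by exact_mod_cast (hk.lt_succ j (Finset.mem_Ico.1 hj).2).le)) (by positivity)
  have n2 : 0 ≤ ∑ j ∈ Finset.Ico 1 (cutoff θ M k),
      (blockSum θ (k (j - 1)) (k M) - blockSum θ (k j) (k M)) / blockSum θ (k j) (k M) :=
    Finset.sum_nonneg fun j hj => by
      rw [Finset.mem_Ico] at hj
      have := hS (j - 1) (by omega)
      rw [show j - 1 + 1 = j by omega] at this
      exact div_nonneg (sub_nonneg.2 this) (blockSum_nonneg _ _ _)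
  have hM0 : (0 : ℝ) ≤ M := by positivity
  -- The factor `4` cancels the quarters inside `psi`: four times its minimum is `min (4 M) (4 + …)`
  -- without them.
  have key : ∀ x : ℝ, (x ≤ M) →
      x ≤ 1 + ∑ j ∈ Finset.Ico 1 M, ((k (j + 1) : ℝ) - k j) / k j
        + ∑ j ∈ Finset.Ico 1 (cutoff θ M k),
          (blockSum θ (k (j - 1)) (k M) - blockSum θ (k j) (k M)) / blockSum θ (k j) (k M) →
      x * (1 + Real.log M) ^ 2 ≤ 4 * psi θ M k := by
    intro x h1 h2
    rw [psi, ← mul_assoc]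
    refine mul_le_mul_of_nonneg_right ?_ (sq_nonneg _)
    have e1 : ∑ j ∈ Finset.Ico 1 M, ((k (j + 1) : ℝ) - k j) / (4 * k j)
        = (∑ j ∈ Finset.Ico 1 M, ((k (j + 1) : ℝ) - k j) / k j) / 4 := by
      rw [Finset.sum_div]
      exact Finset.sum_congr rfl fun j _ => by rw [div_div, mul_comm]
    have e2 : ∑ j ∈ Finset.Ico 1 (cutoff θ M k),
          (blockSum θ (k (j - 1)) (k M) - blockSum θ (k j) (k M)) / (4 * blockSum θ (k j) (k M))
        = (∑ j ∈ Finset.Ico 1 (cutoff θ M k),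
          (blockSum θ (k (j - 1)) (k M) - blockSum θ (k j) (k M))
            / blockSum θ (k j) (k M)) / 4 := by
      rw [Finset.sum_div]
      exact Finset.sum_congr rfl fun j _ => by rw [div_div, mul_comm]
    rw [e1, e2, mul_min_of_nonneg _ _ (by norm_num)]
    refine le_min (by linarith) (by linarith)
  obtain ⟨b1a, b1b⟩ := le_min_iff.1 b1
  obtain ⟨b2a, b2b⟩ := le_min_iff.1 b2
  exact ⟨key _ b1a (by linarith), key _ b2a (by linarith)⟩

lemma coef_sq_eq {n p : ℕ} (hn : 1 ≤ n) (X : Matrix (Fin n) (Fin p) ℝ) (f : Fin n → ℝ) {l : ℕ}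
    (hl : l < p) : coef X f l ^ 2 = n * theta X f (l + 1) ^ 2 := by
  have h : 1 ≤ l + 1 ∧ l + 1 ≤ p := ⟨by omega, by omega⟩
  have hn' : (0 : ℝ) < n := by exact_mod_cast hn
  rw [theta, dif_pos h, div_pow, Real.sq_sqrt hn'.le, mul_div_cancel₀ _ hn'.ne']
  simp [coef, coordVec, hl]

lemma sum_coef_sq_eq {n p : ℕ} (hn : 1 ≤ n) (X : Matrix (Fin n) (Fin p) ℝ) (f : Fin n → ℝ)
    {a b : ℕ} (hb : b ≤ p) :
    ∑ l ∈ Finset.Ico a b, coef X f l ^ 2 = n * blockSum (theta X f) a b := by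
  rw [blockSum, Finset.mul_sum]
  have : Finset.Ioc a b = Finset.Ico (a + 1) (b + 1) := by ext; simp
  rw [this, ← Finset.sum_Ico_add' (fun l => (n : ℝ) * theta X f l ^ 2) a b 1]
  refine Finset.sum_congr rfl fun l hl => coef_sq_eq hn X f ?_
  have := (Finset.mem_Ico.1 hl).2
  omega

/-! ### Uniform bounds for the noise terms -/

/-- The number of dyadic levels needed for `M` blocks, compared with the logarithm in `psi`; `log 2
> 1/2` accounts for the constant. -/
lemma natLog_succ_le {M : ℕ} (hM : 1 ≤ M) :
    ((Nat.log 2 M + 1 : ℕ) : ℝ) ^ 2 ≤ 4 * (1 + Real.log M) ^ 2 := by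
  have h1 : ((2 : ℝ)) ^ Nat.log 2 M ≤ M := by
    exact_mod_cast Nat.pow_log_le_self 2 (by omega : M ≠ 0)
  have h2 := Real.log_le_log (by positivity) h1
  rw [Real.log_pow] at h2
  have h3 := Real.log_two_gt_d9
  have h4 : (0 : ℝ) ≤ Nat.log 2 M := by positivity
  have h5 : ((Nat.log 2 M + 1 : ℕ) : ℝ) ≤ 2 * (1 + Real.log M) := by
    push_cast; nlinarith
  calc _ ≤ (2 * (1 + Real.log M)) ^ 2 := pow_le_pow_left₀ (by positivity) h5 2
    _ = _ := by ring

section Processes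

variable {n p M : ℕ} {k : ℕ → ℕ} {X : Matrix (Fin n) (Fin p) ℝ} {Ω : Type*} [MeasurableSpace Ω]
  {μ : Measure Ω} [IsProbabilityMeasure μ] {ε : Fin n → Ω → ℝ} {σ K : ℝ}

/-- Uniform bound for linear forms of the noise with nondecreasing block weights. -/
lemma exists_linear_bound (h : IsNoise μ ε σ K) (hn : 1 ≤ n) (hX : LinearIndependent ℝ X.col)
    (hk : IsNestedSizes p M k) (f : Fin n → ℝ) :
    ∃ W : Ω → ℝ, (∀ ω, 0 ≤ W ω) ∧ Integrable W μ ∧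
      ∫ ω, W ω ∂μ ≤ 16 * σ ^ 2 * psi (theta X f) M k ∧
      ∀ ω, ∀ b : ℕ → ℝ, Monotone b → b 0 = 0 → ∀ δ > 0,
        2 * |∑ j ∈ Finset.range M, b j * ∑ l ∈ Finset.Ico (k j) (k (j + 1)),
            coef X f l * coef X (fun i => ε i ω) l|
          ≤ δ * ∑ j ∈ Finset.range M, b j ^ 2 * ∑ l ∈ Finset.Ico (k j) (k (j + 1)), coef X f l ^ 2
            + W ω / δ := by
  set L := Nat.log 2 M + 1 with hL
  have hML : M < 2 ^ L := Nat.lt_pow_succ_log_self (by norm_num) M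
  -- Sizes are frozen after `M`, so that the dyadic range `2 ^ L > M` is filled up with empty blocks
  -- and the tail energy `T` vanishes at its end.
  set κ : ℕ → ℕ := fun j => k (min j M) with hκ
  have hκm : Monotone κ := fun i j hij => hk.monotoneOn (by omega) (by omega)
  have hκM : ∀ j, M ≤ j → κ j = k M := fun j hj => by simp [hκ, hj]
  have hκj : ∀ j, j ≤ M → κ j = k j := fun j hj => by simp [hκ, hj]
  have hκp : ∀ j, κ j ≤ p := fun j => (hk.monotoneOn (by omega) le_rfl).trans hk.le
  set T : ℕ → ℝ := fun j => ∑ l ∈ Finset.Ico (κ j) (k M), coef X f l ^ 2 with hT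
  set a : ℕ → Ω → ℝ := fun j ω =>
    ∑ l ∈ Finset.Ico (κ j) (κ (j + 1)), coef X f l * coef X (fun i => ε i ω) l with ha
  have hT0 : ∀ j, 0 ≤ T j := fun j => Finset.sum_nonneg fun _ _ => sq_nonneg _
  have hTa : Antitone T := fun i j hij => Finset.sum_le_sum_of_subset_of_nonneg
    (Finset.Ico_subset_Ico_left (hκm hij)) fun _ _ _ => sq_nonneg _
  have hkM : ∀ j, κ j ≤ k M := fun j => hk.monotoneOn (by omega) le_rfl
  have hTsub : ∀ s e, s ≤ e → T s - T e = ∑ l ∈ Finset.Ico (κ s) (κ e), coef X f l ^ 2 :=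
    fun s e hse => by
      simp only [hT]
      rw [← Finset.sum_Ico_consecutive _ (hκm hse) (hkM e)]
      ring
  have hS : ∀ s e, Finset.Ico (κ s) (κ e) ⊆ Finset.range p := fun s e l hl => by
    have := hκp e
    have := (Finset.mem_Ico.1 hl).2
    rw [Finset.mem_range]; omega
  have hasum : ∀ s e, s ≤ e → ∀ ω, ∑ j ∈ Finset.Ico s e, a j ω
      = ∑ l ∈ Finset.Ico (κ s) (κ e), coef X f l * coef X (fun i => ε i ω) l :=
    fun s e hse ω => sum_blocks hκm _ hse
  have hvar : ∀ s e, s ≤ e →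
      ∫ ω, (∑ j ∈ Finset.Ico s e, a j ω) ^ 2 ∂μ ≤ σ ^ 2 * (T s - T e) := fun s e hse => by
    simp_rw [hasum s e hse]
    rw [(h.sum_coef hX (hS s e) (coef X f)).2.2, hTsub s e hse]
  have hint : ∀ s e, Integrable (fun ω => (∑ j ∈ Finset.Ico s e, a j ω) ^ 2) μ := fun s e => by
    rcases le_total s e with hse | hse
    · simp_rw [hasum s e hse]
      exact (h.sum_coef hX (hS s e) (coef X f)).1.integrable_sq
    · simp [Finset.Ico_eq_empty_of_le hse]
  have hzero : ∀ ω i j, i ≤ j → T i = 0 → a j ω = 0 := fun ω i j hij hTi => by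
    refine Finset.sum_eq_zero fun l hl => ?_
    rw [Finset.mem_Ico] at hl
    have h1 := (Finset.sum_eq_zero_iff_of_nonneg fun _ _ => sq_nonneg _).1 hTi l
      (Finset.mem_Ico.2 ⟨(hκm hij).trans hl.1, hl.2.trans_le (hkM _)⟩)
    rw [pow_eq_zero_iff two_ne_zero] at h1
    rw [h1, zero_mul]
  obtain ⟨hWi, hWb⟩ := dyadicEnergy_integral_le hTa hT0 (sq_nonneg σ) hint hvar L 0
  refine ⟨fun ω => L * dyadicEnergy (fun j => a j ω) T L 0,
    fun ω => mul_nonneg (by positivity) (dyadicEnergy_nonneg _ hT0 _ _), hWi.const_mul _, ?_, ?_⟩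
  · rw [integral_const_mul]
    have hV : ∑ j ∈ Finset.Ico 0 (0 + 2 ^ L), (T j - T (j + 1)) / T j
        = ∑ j ∈ Finset.range M, (blockSum (theta X f) (k j) (k M)
          - blockSum (theta X f) (k (j + 1)) (k M)) / blockSum (theta X f) (k j) (k M) := by
      rw [zero_add, Nat.Ico_zero_eq_range,
        Finset.eventually_constant_sum (N := M) (fun j hj => by simp [hT, hκM j hj]) hML.le]
      refine Finset.sum_congr rfl fun j hj => ?_
      rw [Finset.mem_range] at hj
      simp only [hT]
      rw [hκj j hj.le, hκj (j + 1) hj, sum_coef_sq_eq hn X f hk.le, sum_coef_sq_eq hn X f hk.le,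
        ← mul_sub, mul_div_mul_left _ _ (by positivity : (n : ℝ) ≠ 0)]
    rw [hV] at hWb
    set V := ∑ j ∈ Finset.range M, (blockSum (theta X f) (k j) (k M)
          - blockSum (theta X f) (k (j + 1)) (k M)) / blockSum (theta X f) (k j) (k M) with hVdef
    have hV0 : 0 ≤ V := Finset.sum_nonneg fun j hj => div_nonneg
      (sub_nonneg.2 (blockSum_anti _ (hk.lt_succ j (Finset.mem_range.1 hj)).le))
      (blockSum_nonneg _ _ _)
    calc _ ≤ (L : ℝ) * (σ ^ 2 * L * V) := mul_le_mul_of_nonneg_left hWb (by positivity)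
      _ = σ ^ 2 * V * (L : ℝ) ^ 2 := by ring
      _ ≤ σ ^ 2 * V * (4 * (1 + Real.log M) ^ 2) :=
          mul_le_mul_of_nonneg_left (natLog_succ_le hk.one_le) (by positivity)
      _ = 4 * σ ^ 2 * (V * (1 + Real.log M) ^ 2) := by ring
      _ ≤ 4 * σ ^ 2 * (4 * psi (theta X f) M k) :=
          mul_le_mul_of_nonneg_left (sums_le_psi hk _).1 (by positivity)
      _ = _ := by ring
  · intro ω b hb hb0 δ hδ
    have key := monotone_weights_sum_le hb hb0 hTa hT0 (hzero ω) (L := L)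
      (by simp [hT, hκM _ hML.le]) (by omega) hδ
    rw [Finset.eventually_constant_sum (N := M) (fun j hj => by
        simp [ha, hκM j hj, hκM (j + 1) (by omega)]) hML.le,
      Finset.eventually_constant_sum (N := M) (fun j hj => by
        simp [hT, hκM j hj, hκM (j + 1) (by omega)]) hML.le] at key
    have e1 : ∀ j ∈ Finset.range M, b j * a j ω = b j * ∑ l ∈ Finset.Ico (k j) (k (j + 1)),
        coef X f l * coef X (fun i => ε i ω) l := fun j hj => by
      rw [Finset.mem_range] at hj
      simp only [ha]
      rw [hκj j hj.le, hκj (j + 1) hj]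
    have e2 : ∀ j ∈ Finset.range M, b j ^ 2 * (T j - T (j + 1))
        = b j ^ 2 * ∑ l ∈ Finset.Ico (k j) (k (j + 1)), coef X f l ^ 2 := fun j hj => by
      rw [Finset.mem_range] at hj
      rw [hTsub j _ (Nat.le_succ j), hκj j hj.le, hκj (j + 1) hj]
    rwa [Finset.sum_congr rfl e1, Finset.sum_congr rfl e2] at key

/-- Uniform bound for quadratic forms of the noise with nonincreasing block weights. -/
lemma exists_quadratic_bound (h : IsNoise μ ε σ K) (hK : 0 ≤ K) (hX : LinearIndependent ℝ X.col)
    (hk : IsNestedSizes p M k) (θ : ℕ → ℝ) :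
    ∃ W : Ω → ℝ, (∀ ω, 0 ≤ W ω) ∧ Integrable W μ ∧
      ∫ ω, W ω ∂μ ≤ 16 * (2 * K + 4 * σ ^ 4) * psi θ M k ∧
      ∀ ω, ∀ b : ℕ → ℝ, Antitone b → b M = 0 → ∀ δ > 0,
        2 * |∑ j ∈ Finset.range M, b j * ∑ l ∈ Finset.Ico (k j) (k (j + 1)),
            (coef X (fun i => ε i ω) l ^ 2 - σ ^ 2)|
          ≤ δ * ∑ j ∈ Finset.range M, b j ^ 2 * ((k (j + 1) : ℝ) - k j) + W ω / δ := by
  set L := Nat.log 2 M + 1 with hL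
  have hML : M < 2 ^ L := Nat.lt_pow_succ_log_self (by norm_num) M
  set C := 2 * K + 4 * σ ^ 4 with hC
  have hC0 : 0 ≤ C := by positivity
  -- Blocks in reverse order: `i = M - j` is the block from `k j` to `k (j + 1)`. Index `0` is an
  -- empty block, as both of its ends are `k M`, and everything beyond `M` is empty at zero.
  set κ : ℕ → ℕ := fun i => k (min M (M + 1 - i)) with hκ
  have hκm : Antitone κ := fun i j hij => hk.monotoneOn (by omega) (by omega)
  have hκ1 : ∀ j < M, κ (M - j) = k (j + 1) := fun j hj => by
    simp only [hκ]; congr 1; omega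
  have hκ2 : ∀ j < M, κ (M - j + 1) = k j := fun j hj => by
    simp only [hκ]; congr 1; omega
  have hκM : ∀ i, M < i → κ i = 0 := fun i hi => by
    simp only [hκ]; rw [show min M (M + 1 - i) = 0 by omega, hk.zero]
  have hκ0 : κ (0 + 1) = κ 0 := by
    simp only [hκ]; congr 1; omega
  have hκp : ∀ j, κ j ≤ p := fun j => (hk.monotoneOn (by omega) le_rfl).trans hk.le
  set T : ℕ → ℝ := fun j => κ j with hT
  set a : ℕ → Ω → ℝ := fun j ω =>
    ∑ l ∈ Finset.Ico (κ (j + 1)) (κ j), (coef X (fun i => ε i ω) l ^ 2 - σ ^ 2) with ha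
  have hT0 : ∀ j, 0 ≤ T j := fun j => by positivity
  have hTa : Antitone T := fun i j hij => Nat.cast_le.2 (hκm hij)
  have hS : ∀ s e, Finset.Ico (κ e) (κ s) ⊆ Finset.range p := fun s e l hl => by
    have := hκp s
    have := (Finset.mem_Ico.1 hl).2
    rw [Finset.mem_range]; omega
  have hasum : ∀ s e, s ≤ e → ∀ ω, ∑ j ∈ Finset.Ico s e, a j ω
      = ∑ l ∈ Finset.Ico (κ e) (κ s), (coef X (fun i => ε i ω) l ^ 2 - σ ^ 2) :=
    fun s e hse ω => sum_blocks_antitone hκm _ hse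
  have hvar : ∀ s e, s ≤ e →
      ∫ ω, (∑ j ∈ Finset.Ico s e, a j ω) ^ 2 ∂μ ≤ C * (T s - T e) := fun s e hse => by
    simp_rw [hasum s e hse]
    refine (h.sum_coef_sq hK hX (hS s e)).2.trans_eq ?_
    rw [Nat.card_Ico, Nat.cast_sub (hκm hse)]
  have hint : ∀ s e, Integrable (fun ω => (∑ j ∈ Finset.Ico s e, a j ω) ^ 2) μ := fun s e => by
    rcases le_total s e with hse | hse
    · simp_rw [hasum s e hse]
      exact (h.sum_coef_sq hK hX (hS s e)).1.integrable_sq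
    · simp [Finset.Ico_eq_empty_of_le hse]
  have hzero : ∀ ω i j, i ≤ j → T i = 0 → a j ω = 0 := fun ω i j hij hTi => by
    have h1 : κ i = 0 := Nat.cast_eq_zero.1 hTi
    have h2 : κ j = 0 := Nat.le_zero.1 ((hκm hij).trans_eq h1)
    simp [ha, h2]
  obtain ⟨hWi, hWb⟩ := dyadicEnergy_integral_le hTa hT0 hC0 hint hvar L 0
  refine ⟨fun ω => L * dyadicEnergy (fun j => a j ω) T L 0,
    fun ω => mul_nonneg (by positivity) (dyadicEnergy_nonneg _ hT0 _ _), hWi.const_mul _, ?_, ?_⟩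
  · rw [integral_const_mul]
    have hV : ∑ j ∈ Finset.Ico 0 (0 + 2 ^ L), (T j - T (j + 1)) / T j
        = ∑ j ∈ Finset.range M, ((k (j + 1) : ℝ) - k j) / k (j + 1) := by
      rw [zero_add, Nat.Ico_zero_eq_range]
      refine sum_range_reflect_of_zero hML (by simp only [hT]; rw [hκ0]; simp)
        (fun i hi => by simp [hT, hκM i hi]) fun j hj => ?_
      simp only [hT]
      rw [hκ1 j hj, hκ2 j hj]
    rw [hV] at hWb
    set V := ∑ j ∈ Finset.range M, ((k (j + 1) : ℝ) - k j) / k (j + 1) with hVdef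
    have hV0 : 0 ≤ V := Finset.sum_nonneg fun j hj => div_nonneg
      (sub_nonneg.2 (by exact_mod_cast (hk.lt_succ j (Finset.mem_range.1 hj)).le)) (by positivity)
    calc _ ≤ (L : ℝ) * (C * L * V) := mul_le_mul_of_nonneg_left hWb (by positivity)
      _ = C * V * (L : ℝ) ^ 2 := by ring
      _ ≤ C * V * (4 * (1 + Real.log M) ^ 2) :=
          mul_le_mul_of_nonneg_left (natLog_succ_le hk.one_le) (by positivity)
      _ = 4 * C * (V * (1 + Real.log M) ^ 2) := by ring
      _ ≤ 4 * C * (4 * psi θ M k) :=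
          mul_le_mul_of_nonneg_left (sums_le_psi hk θ).2 (by positivity)
      _ = _ := by ring
  · intro ω b hb hb0 δ hδ
    -- Reversal makes the weights nondecreasing and starts them at `b M = 0`. Truncated subtraction
    -- keeps them at `b 0` beyond `M`, which is still monotone.
    have key := monotone_weights_sum_le (h := fun i => b (M - i))
      (fun i j hij => hb (by omega)) (by simpa using hb0) hTa hT0 (hzero ω) (L := L)
      (by simp [hT, hκM _ hML]) (by omega) hδ
    rw [sum_range_reflect_of_zero (G := fun j => b j * ∑ l ∈ Finset.Ico (k j) (k (j + 1)),
            (coef X (fun i => ε i ω) l ^ 2 - σ ^ 2)) hML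
        (by simp [hb0]) (fun i hi => by simp [ha, hκM i hi]) (fun j hj => by
          simp only [ha]
          rw [hκ1 j hj, hκ2 j hj, show M - (M - j) = j by omega]),
      sum_range_reflect_of_zero (G := fun j => b j ^ 2 * ((k (j + 1) : ℝ) - k j)) hML
        (by simp [hb0]) (fun i hi => by simp [hT, hκM i hi, hκM (i + 1) (by omega)])
        (fun j hj => by
          simp only [hT]
          rw [hκ1 j hj, hκ2 j hj, show M - (M - j) = j by omega])] at key
    exact key

end Processes

/-! ### Oracle inequality for a fixed sample size -/

section Oracle

variable {n p M : ℕ} {k : ℕ → ℕ} {X : Matrix (Fin n) (Fin p) ℝ} {Ω : Type*} [MeasurableSpace Ω]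
  {μ : Measure Ω} {ε : Fin n → Ω → ℝ} {σ K : ℝ} {f : Fin n → ℝ} {β : Fin p → ℝ}

lemma mul_plugInRisk (hn : 1 ≤ n) (hX : LinearIndependent ℝ X.col) (hf : f = X *ᵥ β)
    (w : Fin M → ℝ) :
    n * plugInRisk σ X f (nestedFamily p M k) w
      = ∑ l ∈ Finset.range p, (1 - shrinkage k w l) ^ 2 * coef X f l ^ 2
        + σ ^ 2 * ∑ l ∈ Finset.range p, shrinkage k w l ^ 2 := by
  have hn' : (n : ℝ) ≠ 0 := by positivity
  rw [plugInRisk_eq hX hf, mul_div_cancel₀ _ hn', Finset.sum_add_distrib, ← Finset.mul_sum]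

lemma mul_plugInRisk_nonneg (hn : 1 ≤ n) (hX : LinearIndependent ℝ X.col) (hf : f = X *ᵥ β)
    (w : Fin M → ℝ) : 0 ≤ n * plugInRisk σ X f (nestedFamily p M k) w := by
  rw [mul_plugInRisk hn hX hf]
  have h1 := Finset.sum_nonneg fun l (_ : l ∈ Finset.range p) =>
    mul_nonneg (sq_nonneg (1 - shrinkage k w l)) (sq_nonneg (coef X f l))
  have h2 := Finset.sum_nonneg fun l (_ : l ∈ Finset.range p) => sq_nonneg (shrinkage k w l)
  positivity

lemma sum_bias_le (hn : 1 ≤ n) (hX : LinearIndependent ℝ X.col) (hf : f = X *ᵥ β)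
    (hk : IsNestedSizes p M k) (w : Fin M → ℝ) :
    ∑ j ∈ Finset.range M, (1 - tailWeight w j) ^ 2
        * ∑ l ∈ Finset.Ico (k j) (k (j + 1)), coef X f l ^ 2
      ≤ n * plugInRisk σ X f (nestedFamily p M k) w := by
  rw [mul_plugInRisk hn hX hf, sum_shrinkage hk w (fun x => (1 - x) ^ 2)]
  have h1 := Finset.sum_nonneg fun l (_ : l ∈ Finset.Ico (k M) p) => sq_nonneg (coef X f l)
  have h2 := Finset.sum_nonneg fun l (_ : l ∈ Finset.range p) => sq_nonneg (shrinkage k w l)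
  have h3 := mul_nonneg (sq_nonneg σ) h2
  linarith

lemma sum_variance_le (hn : 1 ≤ n) (hX : LinearIndependent ℝ X.col) (hf : f = X *ᵥ β)
    (hk : IsNestedSizes p M k) (w : Fin M → ℝ) :
    σ ^ 2 * ∑ j ∈ Finset.range M, tailWeight w j ^ 2 * ((k (j + 1) : ℝ) - k j)
      ≤ n * plugInRisk σ X f (nestedFamily p M k) w := by
  have h0 := sum_shrinkage hk w (fun x => x ^ 2) (fun _ => 1)
  have h2 : ∀ j ∈ Finset.range M,
      tailWeight w j ^ 2 * ∑ l ∈ Finset.Ico (k j) (k (j + 1)), (1 : ℝ)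
        = tailWeight w j ^ 2 * ((k (j + 1) : ℝ) - k j) := fun j hj => by
    rw [Finset.sum_const, Nat.card_Ico, nsmul_eq_mul, mul_one,
      Nat.cast_sub (hk.lt_succ j (Finset.mem_range.1 hj)).le]
  rw [Finset.sum_congr rfl h2] at h0
  simp only [mul_one, ne_eq, OfNat.ofNat_ne_zero, not_false_eq_true, zero_pow, zero_mul,
    add_zero] at h0
  rw [mul_plugInRisk hn hX hf, h0]
  have h1 := Finset.sum_nonneg fun l (_ : l ∈ Finset.range p) =>
    mul_nonneg (sq_nonneg (1 - shrinkage k w l)) (sq_nonneg (coef X f l))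
  linarith

/-- Cauchy–Schwarz over the `k M` coordinates that some model uses gives `(∑ γ)² ≤ k M ∑ γ²`, and
`σ² ∑ γ²` is part of the risk; AM–GM then splits the product. This is where `k M` multiplies the
squared error of the variance estimator. -/
lemma two_mul_sum_shrinkage_le (hn : 1 ≤ n) (hX : LinearIndependent ℝ X.col) (hf : f = X *ᵥ β)
    (hσ : 0 < σ) (hk : IsNestedSizes p M k) (w : Fin M → ℝ) (d : ℝ) {δ : ℝ} (hδ : 0 < δ) :
    |2 * d * ∑ l ∈ Finset.range p, shrinkage k w l|
      ≤ δ * (n * plugInRisk σ X f (nestedFamily p M k) w) + k M * d ^ 2 / σ ^ 2 / δ := by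
  set G := ∑ l ∈ Finset.range p, shrinkage k w l ^ 2 with hG
  have hGR : σ ^ 2 * G ≤ n * plugInRisk σ X f (nestedFamily p M k) w := by
    rw [mul_plugInRisk hn hX hf]
    have h1 := Finset.sum_nonneg fun l (_ : l ∈ Finset.range p) =>
      mul_nonneg (sq_nonneg (1 - shrinkage k w l)) (sq_nonneg (coef X f l))
    linarith
  have hx : ∑ l ∈ Finset.range p, shrinkage k w l = ∑ l ∈ Finset.range (k M), shrinkage k w l :=
    Finset.eventually_constant_sum (fun l hl => shrinkage_eq_zero hk w hl) hk.le
  have hsq : (∑ l ∈ Finset.range p, shrinkage k w l) ^ 2 ≤ k M * G := by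
    rw [hx]
    refine (sq_sum_le_card_mul_sum_sq).trans ?_
    rw [Finset.card_range]
    exact mul_le_mul_of_nonneg_left (Finset.sum_le_sum_of_subset_of_nonneg
      (Finset.range_subset_range.2 hk.le) fun _ _ _ => sq_nonneg _) (by positivity)
  have hkM : (0 : ℝ) < k M := by
    have := hk.strictMonoOn (show 0 < M from hk.one_le) le_rfl
    exact_mod_cast (by omega : 0 < k M)
  set x := ∑ l ∈ Finset.range p, shrinkage k w l with hxdef
  have h1 : x ^ 2 / k M ≤ G := by rw [div_le_iff₀ hkM]; linarith
  have h2 : |2 * d * x| ≤ δ * σ ^ 2 * (x ^ 2 / k M) + k M * d ^ 2 / σ ^ 2 / δ := by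
    have e : k M * d ^ 2 / σ ^ 2 / δ = (δ * σ ^ 2 / k M) * (d * k M / (δ * σ ^ 2)) ^ 2 := by
      field_simp
    have e2 : 2 * d * x = (δ * σ ^ 2 / k M) * (2 * (d * k M / (δ * σ ^ 2)) * x) := by
      field_simp
    have hc : 0 < δ * σ ^ 2 / k M := by positivity
    rw [e, e2, abs_mul, abs_of_pos hc, show δ * σ ^ 2 * (x ^ 2 / k M) = (δ * σ ^ 2 / k M) * x ^ 2
      by ring, ← mul_add]
    refine mul_le_mul_of_nonneg_left ?_ hc.le
    rw [abs_le]
    constructor <;> nlinarith [sq_nonneg (d * k M / (δ * σ ^ 2) + x),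
      sq_nonneg (d * k M / (δ * σ ^ 2) - x)]
  have h3 : δ * σ ^ 2 * (x ^ 2 / k M) ≤ δ * (n * plugInRisk σ X f (nestedFamily p M k) w) := by
    rw [mul_assoc]
    refine mul_le_mul_of_nonneg_left (le_trans ?_ hGR) hδ.le
    exact mul_le_mul_of_nonneg_left h1 (sq_nonneg σ)
  linarith

/-- A single `B`, chosen before `w` and `δ`, serves both processes, so no supremum over the simplex
has to be measured. Both exponents are needed: the criterion contains `γ`, `γ²` and `(1 - γ)²`, the
loss `γ²` and `γ (1 - γ) = (1 - γ) - (1 - γ)²`. -/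
lemma exists_noise_bound [IsProbabilityMeasure μ] (h : IsNoise μ ε σ K) (hK : 0 ≤ K) (hσ : 0 < σ)
    (hn : 1 ≤ n) (hX : LinearIndependent ℝ X.col) (hf : f = X *ᵥ β) (hk : IsNestedSizes p M k) :
    ∃ B : Ω → ℝ, (∀ ω, 0 ≤ B ω) ∧ Integrable B μ ∧
      ∫ ω, B ω ∂μ ≤ 16 * (σ ^ 2 + (2 * K + 4 * σ ^ 4) / σ ^ 2) * psi (theta X f) M k ∧
      ∀ ω, ∀ w ∈ stdSimplex ℝ (Fin M), ∀ δ > 0, ∀ r ∈ ({1, 2} : Set ℕ),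
        2 * |∑ j ∈ Finset.range M, (1 - tailWeight w j) ^ r
            * ∑ l ∈ Finset.Ico (k j) (k (j + 1)), coef X f l * coef X (fun i => ε i ω) l|
          ≤ δ * (n * plugInRisk σ X f (nestedFamily p M k) w) + B ω / δ ∧
        2 * |∑ j ∈ Finset.range M, tailWeight w j ^ r
            * ∑ l ∈ Finset.Ico (k j) (k (j + 1)), (coef X (fun i => ε i ω) l ^ 2 - σ ^ 2)|
          ≤ δ * (n * plugInRisk σ X f (nestedFamily p M k) w) + B ω / δ := by
  obtain ⟨W₁, n₁, i₁, b₁, h₁⟩ := exists_linear_bound h hn hX hk f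
  obtain ⟨W₂, n₂, i₂, b₂, h₂⟩ := exists_quadratic_bound h hK hX hk (theta X f)
  refine ⟨fun ω => W₁ ω + W₂ ω / σ ^ 2,
    fun ω => add_nonneg (n₁ ω) (div_nonneg (n₂ ω) (sq_nonneg σ)), i₁.add (i₂.div_const _), ?_, ?_⟩
  · rw [integral_add i₁ (i₂.div_const _), integral_div]
    have : (∫ ω, W₂ ω ∂μ) / σ ^ 2
        ≤ 16 * (2 * K + 4 * σ ^ 4) * psi (theta X f) M k / σ ^ 2 :=
      div_le_div_of_nonneg_right b₂ (sq_nonneg σ)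
    calc _ ≤ 16 * σ ^ 2 * psi (theta X f) M k
          + 16 * (2 * K + 4 * σ ^ 4) * psi (theta X f) M k / σ ^ 2 := add_le_add b₁ this
      _ = _ := by ring
  · intro ω w hw δ hδ r hr
    have hr0 : r ≠ 0 := by rcases hr with rfl | rfl <;> norm_num
    have hr1 : 1 ≤ r := Nat.one_le_iff_ne_zero.2 hr0
    have hg0 := tailWeight_nonneg hw
    have hg1 := tailWeight_le_one hw
    have hga := tailWeight_antitone hw
    -- For numbers in `[0, 1]` the squared weight is at most the one appearing in the risk,
    -- whichever the exponent.
    have hpow : ∀ x : ℝ, 0 ≤ x → x ≤ 1 → (x ^ r) ^ 2 ≤ x ^ 2 := fun x hx hx1 =>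
      pow_le_pow_left₀ (pow_nonneg hx _) (pow_le_of_le_one hx hx1 hr0) 2
    constructor
    · have key := h₁ ω (fun j => (1 - tailWeight w j) ^ r)
        (fun i j hij => pow_le_pow_left₀ (sub_nonneg.2 (hg1 i))
          (sub_le_sub_left (hga hij) 1) r) (by simp [tailWeight_zero hw, hr0]) δ hδ
      refine key.trans (add_le_add ?_ ?_)
      · refine mul_le_mul_of_nonneg_left (le_trans (Finset.sum_le_sum fun j _ => ?_)
          (sum_bias_le hn hX hf hk w)) hδ.le
        exact mul_le_mul_of_nonneg_right
          (hpow _ (sub_nonneg.2 (hg1 j)) (by linarith [hg0 j]))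
          (Finset.sum_nonneg fun _ _ => sq_nonneg _)
      · exact div_le_div_of_nonneg_right
          (le_add_of_nonneg_right (div_nonneg (n₂ ω) (sq_nonneg σ))) hδ.le
    · have key := h₂ ω (fun j => tailWeight w j ^ r)
        (fun i j hij => pow_le_pow_left₀ (hg0 j) (hga hij) r)
        (by simp [tailWeight_of_le w le_rfl, hr0]) (δ * σ ^ 2) (by positivity)
      refine key.trans (add_le_add ?_ ?_)
      · rw [mul_assoc]
        refine mul_le_mul_of_nonneg_left (le_trans (mul_le_mul_of_nonneg_left
          (Finset.sum_le_sum fun j hj => ?_) (sq_nonneg σ)) (sum_variance_le hn hX hf hk w)) hδ.le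
        exact mul_le_mul_of_nonneg_right (hpow _ (hg0 j) (hg1 j))
          (sub_nonneg.2 (by exact_mod_cast (hk.lt_succ j (Finset.mem_range.1 hj)).le))
      · rw [mul_comm δ, ← div_div]
        exact div_le_div_of_nonneg_right (le_add_of_nonneg_left (n₁ ω)) hδ.le

/-- Oracle inequalities for the plug-in risk and the loss. -/
lemma exists_oracle_bound [IsProbabilityMeasure μ] (h : IsNoise μ ε σ K) (hK : 0 ≤ K)
    (hσ : 0 < σ) (hn : 1 ≤ n) (hX : LinearIndependent ℝ X.col) (hf : f = X *ᵥ β)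
    (hk : IsNestedSizes p M k) :
    ∃ B : Ω → ℝ, (∀ ω, 0 ≤ B ω) ∧ Integrable B μ ∧
      ∫ ω, B ω ∂μ ≤ 16 * (σ ^ 2 + (2 * K + 4 * σ ^ 4) / σ ^ 2) * psi (theta X f) M k ∧
      (∀ ω s v, IsMMAWeight X (nestedFamily p M k) s (response f ε ω) v →
        ∀ w ∈ stdSimplex ℝ (Fin M), ∀ δ > 0,
        (1 - 4 * δ) * (n * plugInRisk σ X f (nestedFamily p M k) v)
          ≤ (1 + 4 * δ) * (n * plugInRisk σ X f (nestedFamily p M k) w)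
            + 8 * (B ω + k M * (s - σ ^ 2) ^ 2 / σ ^ 2) / δ) ∧
      ∀ ω, ∀ w ∈ stdSimplex ℝ (Fin M), ∀ δ > 0,
        n * loss (maEstimator X (nestedFamily p M k) w (response f ε ω)) f
          ≤ (1 + 3 * δ) * (n * plugInRisk σ X f (nestedFamily p M k) w) + 3 * B ω / δ := by
  obtain ⟨B, hB0, hBi, hBb, hB⟩ := exists_noise_bound h hK hσ hn hX hf hk
  have hresp : ∀ ω, response f ε ω = f + fun i => ε i ω := fun ω => rfl
  have hn' : (0 : ℝ) < n := by exact_mod_cast hn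
  refine ⟨B, hB0, hBi, hBb, ?_, ?_⟩
  · intro ω s v hv w hw δ hδ
    set e : Fin n → ℝ := fun i => ε i ω with he
    set R : (Fin M → ℝ) → ℝ := fun w => n * plugInRisk σ X f (nestedFamily p M k) w with hR
    have hR0 : ∀ w, 0 ≤ R w := fun w => mul_plugInRisk_nonneg hn hX hf w
    set D : (Fin M → ℝ) → ℝ := fun w =>
      2 * (∑ j ∈ Finset.range M, (1 - tailWeight w j) ^ 2
            * ∑ l ∈ Finset.Ico (k j) (k (j + 1)), coef X f l * coef X e l)
        + ((∑ j ∈ Finset.range M, tailWeight w j ^ 2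
            * ∑ l ∈ Finset.Ico (k j) (k (j + 1)), (coef X e l ^ 2 - σ ^ 2))
          - 2 * ∑ j ∈ Finset.range M, tailWeight w j ^ 1
            * ∑ l ∈ Finset.Ico (k j) (k (j + 1)), (coef X e l ^ 2 - σ ^ 2))
        + 2 * (s - σ ^ 2) * ∑ l ∈ Finset.range p, shrinkage k w l with hD
    have hcrit : ∃ c : ℝ, ∀ w, n * criterion X (nestedFamily p M k) s (f + e) w
        = R w + c + D w := by
      refine ⟨(sqNorm (f + e) - ∑ l ∈ Finset.range p, (coef X f l + coef X e l) ^ 2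
          + ∑ l ∈ Finset.range p, coef X e l ^ 2)
          -- Beyond the largest model the shrinkage is zero for every `w`, so this part of the
          -- linear noise term is constant.
          + 2 * ∑ l ∈ Finset.Ico (k M) p, coef X f l * coef X e l, fun w => ?_⟩
      rw [criterion_eq hX (fun j hj => (hk.monotoneOn hj le_rfl).trans hk.le) hf σ s e w,
        mul_add, mul_add, mul_div_cancel₀ _ hn'.ne', mul_div_cancel₀ _ hn'.ne',
        sum_shrinkage hk w (fun x => (1 - x) ^ 2), sum_shrinkage hk w (fun x => x ^ 2 - 2 * x)]
      have hx : ∀ Q : ℕ → ℝ, ∑ j ∈ Finset.range M, (tailWeight w j ^ 2 - 2 * tailWeight w j) * Q j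
          = ∑ j ∈ Finset.range M, tailWeight w j ^ 2 * Q j
            - 2 * ∑ j ∈ Finset.range M, tailWeight w j ^ 1 * Q j := fun Q => by
        rw [Finset.mul_sum, ← Finset.sum_sub_distrib]
        exact Finset.sum_congr rfl fun j _ => by ring
      simp only [hR, hD, hx]
      ring
    -- The three noise sums and the variance error cost at most `δ R` each, whence the factor `4`;
    -- comparing two weight vectors doubles the remainder to `8`.
    have habs : ∀ w ∈ stdSimplex ℝ (Fin M),
        |D w| ≤ 4 * δ * R w + 4 * (B ω + k M * (s - σ ^ 2) ^ 2 / σ ^ 2) / δ := by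
      intro w hw
      obtain ⟨a1, a2⟩ := hB ω w hw δ hδ 2 (by simp)
      obtain ⟨-, a3⟩ := hB ω w hw δ hδ 1 (by simp)
      have a4 := two_mul_sum_shrinkage_le hn hX hf hσ hk w (s - σ ^ 2) hδ
      have p1 : 0 ≤ δ * R w := mul_nonneg hδ.le (hR0 w)
      have p2 : 0 ≤ B ω / δ := div_nonneg (hB0 ω) hδ.le
      have p3 : 0 ≤ k M * (s - σ ^ 2) ^ 2 / σ ^ 2 / δ := by positivity
      have e1 : 4 * δ * R w + 4 * (B ω + k M * (s - σ ^ 2) ^ 2 / σ ^ 2) / δ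
          = 4 * (δ * R w) + 4 * (B ω / δ) + 4 * (k M * (s - σ ^ 2) ^ 2 / σ ^ 2 / δ) := by ring
      rw [e1]
      simp only [hD]
      change 2 * |_| ≤ δ * R w + B ω / δ at a1 a2 a3
      change |_| ≤ δ * R w + _ at a4
      generalize hZ1 : ∑ j ∈ Finset.range M, (1 - tailWeight w j) ^ 2
            * ∑ l ∈ Finset.Ico (k j) (k (j + 1)), coef X f l * coef X e l = Z1 at a1 ⊢
      generalize hZ2 : ∑ j ∈ Finset.range M, tailWeight w j ^ 2
            * ∑ l ∈ Finset.Ico (k j) (k (j + 1)), (coef X e l ^ 2 - σ ^ 2) = Z2 at a2 ⊢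
      generalize hZ3 : ∑ j ∈ Finset.range M, tailWeight w j ^ 1
            * ∑ l ∈ Finset.Ico (k j) (k (j + 1)), (coef X e l ^ 2 - σ ^ 2) = Z3 at a3 ⊢
      generalize 2 * (s - σ ^ 2) * ∑ l ∈ Finset.range p, shrinkage k w l = Z4 at a4 ⊢
      have q1 := abs_le.1 (show |Z1| ≤ (δ * R w + B ω / δ) / 2 by linarith)
      have q2 := abs_le.1 (show |Z2| ≤ (δ * R w + B ω / δ) / 2 by linarith)
      have q3 := abs_le.1 (show |Z3| ≤ (δ * R w + B ω / δ) / 2 by linarith)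
      have q4 := abs_le.1 a4
      rw [abs_le]
      constructor <;> linarith [q1.1, q1.2, q2.1, q2.2, q3.1, q3.2, q4.1, q4.2]
    obtain ⟨c, hc⟩ := hcrit
    have hmin := mul_le_mul_of_nonneg_left (isMinOn_iff.1 hv.2 w hw) hn'.le
    rw [hresp, hc, hc] at hmin
    have d1 := abs_le.1 (habs v hv.1)
    have d2 := abs_le.1 (habs w hw)
    have e2 : 8 * (B ω + k M * (s - σ ^ 2) ^ 2 / σ ^ 2) / δ
        = 2 * (4 * (B ω + k M * (s - σ ^ 2) ^ 2 / σ ^ 2) / δ) := by ring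
    rw [e2]
    change (1 - 4 * δ) * R v ≤ (1 + 4 * δ) * R w + _
    linarith [d1.1, d2.2]
  · intro ω w hw δ hδ
    set e : Fin n → ℝ := fun i => ε i ω with he
    -- The cross term carries the weight `γ (1 - γ)`, which is not monotone; it is written as the
    -- difference of the monotone weights `(1 - γ)` and `(1 - γ)²`.
    have hloss : n * loss (maEstimator X (nestedFamily p M k) w (response f ε ω)) f
        = n * plugInRisk σ X f (nestedFamily p M k) w
          + ∑ j ∈ Finset.range M, tailWeight w j ^ 2
            * ∑ l ∈ Finset.Ico (k j) (k (j + 1)), (coef X e l ^ 2 - σ ^ 2)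
          - 2 * (∑ j ∈ Finset.range M, (1 - tailWeight w j) ^ 1
              * ∑ l ∈ Finset.Ico (k j) (k (j + 1)), coef X f l * coef X e l
            - ∑ j ∈ Finset.range M, (1 - tailWeight w j) ^ 2
              * ∑ l ∈ Finset.Ico (k j) (k (j + 1)), coef X f l * coef X e l) := by
      have s1 := sum_shrinkage hk w (fun x => x ^ 2) (fun l => coef X e l ^ 2 - σ ^ 2)
      have s2 := sum_shrinkage hk w (fun x => (1 - x) ^ 1 - (1 - x) ^ 2)
        (fun l => coef X f l * coef X e l)
      simp only [ne_eq, OfNat.ofNat_ne_zero, not_false_eq_true, zero_pow, zero_mul, add_zero,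
        sub_zero, one_pow, sub_self, sub_mul (_ ^ 1), Finset.sum_sub_distrib (fun _ => _ * _)] at s1 s2
      rw [← s1, ← s2, hresp, loss_eq hX hf, mul_div_cancel₀ _ hn'.ne', mul_plugInRisk hn hX hf]
      simp only [Finset.mul_sum, ← Finset.sum_add_distrib, ← Finset.sum_sub_distrib]
      exact Finset.sum_congr rfl fun l _ => by ring
    obtain ⟨a1, a2⟩ := hB ω w hw δ hδ 2 (by simp)
    obtain ⟨a3, -⟩ := hB ω w hw δ hδ 1 (by simp)
    have p1 : 0 ≤ δ * (n * plugInRisk σ X f (nestedFamily p M k) w) :=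
      mul_nonneg hδ.le (mul_plugInRisk_nonneg hn hX hf w)
    have p2 : 0 ≤ B ω / δ := div_nonneg (hB0 ω) hδ.le
    rw [hloss, mul_div_assoc]
    have q1 := neg_abs_le (∑ j ∈ Finset.range M, (1 - tailWeight w j) ^ 1
              * ∑ l ∈ Finset.Ico (k j) (k (j + 1)), coef X f l * coef X e l)
    have q2 := le_abs_self (∑ j ∈ Finset.range M, (1 - tailWeight w j) ^ 2
              * ∑ l ∈ Finset.Ico (k j) (k (j + 1)), coef X f l * coef X e l)
    have q3 := le_abs_self (∑ j ∈ Finset.range M, tailWeight w j ^ 2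
            * ∑ l ∈ Finset.Ico (k j) (k (j + 1)), (coef X e l ^ 2 - σ ^ 2))
    linarith

end Oracle

/-! ### Expected risks -/

section Expectation

variable {n p M : ℕ} {k : ℕ → ℕ} {X : Matrix (Fin n) (Fin p) ℝ} {Ω : Type*} [MeasurableSpace Ω]
  {μ : Measure Ω} {ε : Fin n → Ω → ℝ} {σ K : ℝ} {f : Fin n → ℝ}
  {β : Fin p → ℝ}

lemma measurable_coef (h : IsNoise μ ε σ K) (l : ℕ) :
    Measurable fun ω => coef X (fun i => ε i ω) l := by
  simp only [coef, dotProduct]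
  exact Finset.measurable_sum _ fun i _ => (h.meas i).const_mul _

variable [IsProbabilityMeasure μ]

/-- For nonrandom weights the cross terms have mean zero and each `e_l²` has mean `σ²`, so the
expected loss is the plug-in risk. For data-driven weights this fails, and the two notions are
treated separately. -/
lemma maRisk_eq (h : IsNoise μ ε σ K) (hX : LinearIndependent ℝ X.col)
    (hf : f = X *ᵥ β) (w : Fin M → ℝ) :
    maRisk μ ε X f (nestedFamily p M k) w = plugInRisk σ X f (nestedFamily p M k) w := by
  have hc : ∀ l < p, MemLp (fun ω => coef X (fun i => ε i ω) l) 2 μ ∧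
      ∫ ω, coef X (fun i => ε i ω) l ∂μ = 0 ∧
      ∫ ω, coef X (fun i => ε i ω) l ^ 2 ∂μ = σ ^ 2 := fun l hl => by
    simpa using h.sum_coef hX (S := {l}) (by simpa using hl) (fun _ => 1)
  have e : ∀ ω, loss (maEstimator X (nestedFamily p M k) w (response f ε ω)) f
      = (∑ l ∈ Finset.range p, ((1 - shrinkage k w l) ^ 2 * coef X f l ^ 2
          + shrinkage k w l ^ 2 * coef X (fun i => ε i ω) l ^ 2
          + 2 * (shrinkage k w l - 1) * shrinkage k w l * coef X f l
            * coef X (fun i => ε i ω) l)) / n := fun ω => by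
    have : response f ε ω = f + fun i => ε i ω := rfl
    rw [this, loss_eq hX hf]
    congr 1
    exact Finset.sum_congr rfl fun l _ => by ring
  rw [maRisk]
  simp_rw [e]
  rw [integral_div, plugInRisk_eq hX hf]
  congr 1
  have i1 : ∀ l < p, Integrable (fun ω => (1 - shrinkage k w l) ^ 2 * coef X f l ^ 2
          + shrinkage k w l ^ 2 * coef X (fun i => ε i ω) l ^ 2) μ := fun l hl =>
    (integrable_const _).add ((hc l hl).1.integrable_sq.const_mul _)
  have i2 : ∀ l < p, Integrable (fun ω => 2 * (shrinkage k w l - 1) * shrinkage k w l * coef X f l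
            * coef X (fun i => ε i ω) l) μ := fun l hl =>
    ((hc l hl).1.integrable one_le_two).const_mul _
  have i3 : ∀ l < p, Integrable (fun ω => (1 - shrinkage k w l) ^ 2 * coef X f l ^ 2
      + shrinkage k w l ^ 2 * coef X (fun i => ε i ω) l ^ 2
      + 2 * (shrinkage k w l - 1) * shrinkage k w l * coef X f l
        * coef X (fun i => ε i ω) l) μ := fun l hl => (i1 l hl).add (i2 l hl)
  rw [integral_finsetSum _ fun l hl => i3 l (Finset.mem_range.1 hl)]
  refine Finset.sum_congr rfl fun l hl => ?_
  obtain ⟨c1, c2, c3⟩ := hc l (Finset.mem_range.1 hl)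
  rw [integral_add (i1 l (Finset.mem_range.1 hl)) (i2 l (Finset.mem_range.1 hl)),
    integral_add (integrable_const _) (c1.integrable_sq.const_mul _), integral_const_mul,
    integral_const_mul, integral_const_mul, c2, c3]
  simp
  ring

/-- Transfers a bound valid for every `w` to the infimum, so that attainment of the minimum plays no
role. -/
lemma le_mul_optRisk (h : IsNoise μ ε σ K) (hn : 1 ≤ n) (hX : LinearIndependent ℝ X.col)
    (hf : f = X *ᵥ β) (hM : 1 ≤ M) {x : ℝ}
    (hx : ∀ w ∈ stdSimplex ℝ (Fin M), x ≤ n * plugInRisk σ X f (nestedFamily p M k) w) :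
    x ≤ n * optRisk μ ε X f (nestedFamily p M k) := by
  have hn' : (0 : ℝ) < n := by exact_mod_cast hn
  have : NeZero M := ⟨by omega⟩
  rw [← div_le_iff₀' hn']
  refine le_csInf (Set.Nonempty.image _ ⟨_, single_mem_stdSimplex ℝ (0 : Fin M)⟩) ?_
  rintro _ ⟨w, hw, rfl⟩
  rw [div_le_iff₀' hn', maRisk_eq h hX hf]
  exact hx w hw

/-- The first regressor belongs to every candidate model and is never shrunk, so its variance is
always paid. In particular the optimal risk is positive. -/
lemma sq_le_mul_plugInRisk (hn : 1 ≤ n) (hX : LinearIndependent ℝ X.col) (hf : f = X *ᵥ β)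
    (hk : IsNestedSizes p M k) {w : Fin M → ℝ} (hw : w ∈ stdSimplex ℝ (Fin M)) :
    σ ^ 2 ≤ n * plugInRisk σ X f (nestedFamily p M k) w := by
  refine le_trans ?_ (sum_variance_le hn hX hf hk w)
  have hM : 0 < M := hk.one_le
  have h0 : ∀ j ∈ Finset.range M, 0 ≤ tailWeight w j ^ 2 * ((k (j + 1) : ℝ) - k j) :=
    fun j hj => mul_nonneg (sq_nonneg _)
      (sub_nonneg.2 (by exact_mod_cast (hk.lt_succ j (Finset.mem_range.1 hj)).le))
  have h1 := Finset.single_le_sum h0 (Finset.mem_range.2 hM)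
  have h2 : (1 : ℝ) ≤ k 1 := by
    have := hk.lt_succ 0 hM
    exact_mod_cast (by omega : 1 ≤ k (0 + 1))
  rw [tailWeight_zero hw, hk.zero] at h1
  simp only [one_pow, one_mul, zero_add, Nat.cast_zero, sub_zero] at h1
  nlinarith [sq_nonneg σ]

lemma measurable_shrinkage {what : Ω → Fin M → ℝ} (hw : Measurable what) (l : ℕ) :
    Measurable fun ω => shrinkage k (what ω) l := by
  refine Finset.measurable_sum _ fun m _ => ?_
  split_ifs
  · exact (measurable_pi_apply m).comp hw
  · exact measurable_const

lemma integrable_plugInRisk (hX : LinearIndependent ℝ X.col) (hf : f = X *ᵥ β)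
    {what : Ω → Fin M → ℝ} (hw : Measurable what) (hs : ∀ ω, what ω ∈ stdSimplex ℝ (Fin M)) :
    Integrable (fun ω => plugInRisk σ X f (nestedFamily p M k) (what ω)) μ := by
  simp_rw [plugInRisk_eq hX hf]
  refine Integrable.div_const (integrable_finsetSum _ fun l _ => ?_) _
  have hm := measurable_shrinkage (k := k) hw l
  refine Integrable.mono' (g := fun _ => coef X f l ^ 2 + σ ^ 2) (integrable_const _)
    (by fun_prop) (ae_of_all _ fun ω => ?_)
  have h0 := shrinkage_nonneg (k := k) (hs ω) l
  have h1 := shrinkage_le_one (k := k) (hs ω) l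
  rw [Real.norm_of_nonneg (by positivity)]
  refine add_le_add (mul_le_of_le_one_left (sq_nonneg _) ?_)
    (mul_le_of_le_one_right (sq_nonneg _) ?_)
  · exact pow_le_one₀ (by linarith) (by linarith)
  · exact pow_le_one₀ h0 h1

lemma integrable_loss (h : IsNoise μ ε σ K) (hX : LinearIndependent ℝ X.col) (hf : f = X *ᵥ β)
    {what : Ω → Fin M → ℝ} (hw : Measurable what) (hs : ∀ ω, what ω ∈ stdSimplex ℝ (Fin M)) :
    Integrable (fun ω => loss (maEstimator X (nestedFamily p M k) (what ω) (response f ε ω)) f)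
      μ := by
  have e : ∀ ω, loss (maEstimator X (nestedFamily p M k) (what ω) (response f ε ω)) f
      = (∑ l ∈ Finset.range p, (shrinkage k (what ω) l
        * (coef X f l + coef X (fun i => ε i ω) l) - coef X f l) ^ 2) / n :=
    fun ω => loss_eq hX hf _ _
  simp_rw [e]
  refine Integrable.div_const (integrable_finsetSum _ fun l hl => ?_) _
  have hm := measurable_shrinkage (k := k) hw l
  have hc := measurable_coef (X := X) h l
  have hi : Integrable (fun ω => coef X (fun i => ε i ω) l ^ 2) μ := by
    have := (h.sum_coef hX (S := {l}) (by simpa using hl) (fun _ => 1)).1.integrable_sq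
    simpa using this
  refine Integrable.mono' (g := fun ω => 2 * coef X f l ^ 2 + 2 * coef X (fun i => ε i ω) l ^ 2)
    ((integrable_const _).add (hi.const_mul 2)) (by fun_prop) (ae_of_all _ fun ω => ?_)
  have h0 := shrinkage_nonneg (k := k) (hs ω) l
  have h1 := shrinkage_le_one (k := k) (hs ω) l
  rw [Real.norm_of_nonneg (by positivity)]
  generalize shrinkage k (what ω) l = γ at h0 h1
  generalize coef X f l = a
  generalize coef X (fun i => ε i ω) l = b
  have q1 : (γ * (a + b) - a) ^ 2 ≤ 2 * ((1 - γ) ^ 2 * a ^ 2) + 2 * (γ ^ 2 * b ^ 2) := by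
    nlinarith [sq_nonneg ((1 - γ) * a + γ * b)]
  have q2 : (1 - γ) ^ 2 * a ^ 2 ≤ a ^ 2 :=
    mul_le_of_le_one_left (sq_nonneg _) (pow_le_one₀ (by linarith) (by linarith))
  have q3 : γ ^ 2 * b ^ 2 ≤ b ^ 2 :=
    mul_le_of_le_one_left (sq_nonneg _) (pow_le_one₀ h0 h1)
  linarith

/-- Oracle inequality in expectation. -/
lemma expected_oracle (h : IsNoise μ ε σ K) (hK : 0 ≤ K)
    (hσ : 0 < σ) (hn : 1 ≤ n) (hX : LinearIndependent ℝ X.col) (hf : f = X *ᵥ β)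
    (hk : IsNestedSizes p M k) {s : Ω → ℝ} (hs : Integrable (fun ω => (s ω - σ ^ 2) ^ 2) μ)
    {what : Ω → Fin M → ℝ} (hw : Measurable what)
    (hopt : ∀ ω, IsMMAWeight X (nestedFamily p M k) (s ω) (response f ε ω) (what ω))
    {δ A : ℝ} (hδ : 0 < δ)
    (hA : 16 * (σ ^ 2 + (2 * K + 4 * σ ^ 4) / σ ^ 2) * psi (theta X f) M k
      + (k M * ∫ ω, (s ω - σ ^ 2) ^ 2 ∂μ) / σ ^ 2 ≤ A) :
    (1 - 4 * δ) * (n * ∫ ω, plugInRisk σ X f (nestedFamily p M k) (what ω) ∂μ)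
        ≤ (1 + 4 * δ) * (n * optRisk μ ε X f (nestedFamily p M k)) + 8 * A / δ ∧
      n * ∫ ω, loss (maEstimator X (nestedFamily p M k) (what ω) (response f ε ω)) f ∂μ
        ≤ (1 + 3 * δ) * (n * ∫ ω, plugInRisk σ X f (nestedFamily p M k) (what ω) ∂μ)
          + 3 * A / δ := by
  obtain ⟨B, hB0, hBi, hBb, h1, h2⟩ := exists_oracle_bound h hK hσ hn hX hf hk
  have hmem : ∀ ω, what ω ∈ stdSimplex ℝ (Fin M) := fun ω => (hopt ω).1
  have hPi : Integrable (fun ω => plugInRisk σ X f (nestedFamily p M k) (what ω)) μ :=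
    integrable_plugInRisk hX hf hw hmem
  have hLi := integrable_loss (k := k) h hX hf hw hmem
  have hv0 : 0 ≤ (k M * ∫ ω, (s ω - σ ^ 2) ^ 2 ∂μ) / σ ^ 2 :=
    div_nonneg (mul_nonneg (by positivity) (integral_nonneg fun _ => sq_nonneg _)) (sq_nonneg σ)
  have hSi : Integrable (fun ω => k M * (s ω - σ ^ 2) ^ 2 / σ ^ 2) μ :=
    (hs.const_mul _).div_const _
  have hBSi : Integrable (fun ω => B ω + k M * (s ω - σ ^ 2) ^ 2 / σ ^ 2) μ := hBi.add hSi
  have hBA : ∫ ω, (B ω + k M * (s ω - σ ^ 2) ^ 2 / σ ^ 2) ∂μ ≤ A := by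
    rw [integral_add hBi hSi, integral_div, integral_const_mul]
    linarith
  constructor
  · have key : ∀ w ∈ stdSimplex ℝ (Fin M),
        (1 - 4 * δ) * (n * ∫ ω, plugInRisk σ X f (nestedFamily p M k) (what ω) ∂μ)
          ≤ (1 + 4 * δ) * (n * plugInRisk σ X f (nestedFamily p M k) w) + 8 * A / δ := by
      intro w hw'
      calc _ = ∫ ω, (1 - 4 * δ) * (n * plugInRisk σ X f (nestedFamily p M k) (what ω)) ∂μ := by
            rw [integral_const_mul, integral_const_mul]
        _ ≤ ∫ ω, ((1 + 4 * δ) * (n * plugInRisk σ X f (nestedFamily p M k) w)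
            + 8 * (B ω + k M * (s ω - σ ^ 2) ^ 2 / σ ^ 2) / δ) ∂μ :=
            integral_mono ((hPi.const_mul _).const_mul _)
              ((integrable_const _).add ((hBSi.const_mul 8).div_const _))
              fun ω => h1 ω (s ω) (what ω) (hopt ω) w hw' δ hδ
        _ ≤ _ := by
            rw [integral_add (integrable_const _) ((hBSi.const_mul 8).div_const _), integral_div,
              integral_const, probReal_univ, one_smul, integral_const_mul]
            gcongr
    have h4 : 0 < 1 + 4 * δ := by linarith
    -- The inequality is solved for the risk at `w`, giving a lower bound free of `w`, which then
    -- passes to the infimum.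
    have := le_mul_optRisk (k := k) h hn hX hf hk.one_le
      (x := ((1 - 4 * δ) * (n * ∫ ω, plugInRisk σ X f (nestedFamily p M k) (what ω) ∂μ)
        - 8 * A / δ) / (1 + 4 * δ)) fun w hw' => by
      rw [div_le_iff₀' h4]
      linarith [key w hw']
    rw [div_le_iff₀' h4] at this
    linarith
  · calc _ = ∫ ω, n * loss (maEstimator X (nestedFamily p M k) (what ω) (response f ε ω)) f ∂μ := by
          rw [integral_const_mul]
      _ ≤ ∫ ω, ((1 + 3 * δ) * (n * plugInRisk σ X f (nestedFamily p M k) (what ω))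
          + 3 * B ω / δ) ∂μ :=
          integral_mono (hLi.const_mul _)
            (((hPi.const_mul _).const_mul _).add ((hBi.const_mul 3).div_const _))
            fun ω => h2 ω (what ω) (hmem ω) δ hδ
      _ ≤ _ := by
          rw [integral_add ((hPi.const_mul _).const_mul _) ((hBi.const_mul 3).div_const _),
            integral_const_mul, integral_const_mul, integral_div, integral_const_mul]
          gcongr
          linarith

/-! ### The least squares variance estimator -/

lemma projMatrix_mulVec (hX : LinearIndependent ℝ X.col) (m : ℕ) (v : Fin n → ℝ) :
    projMatrix X (nestedModel p m) *ᵥ v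
      = ∑ l ∈ Finset.range p, (if l < m then coef X v l else 0) • coordVec X l := by
  rw [projMatrix_nestedModel hX, nestedModel, Finset.sum_filter, Matrix.sum_mulVec,
    Finset.sum_range]
  refine Finset.sum_congr rfl fun j _ => ?_
  split_ifs
  · ext i
    simp [coef, coordVec, Matrix.vecMulVec_mulVec, mul_comm]
  · simp

/-- The centred residual sum of squares splits into the omitted bias, a linear form, and the
difference of the centred square sums of the full noise and of its first `m` coordinates. -/
lemma sqNorm_residual (hX : LinearIndependent ℝ X.col) (hf : f = X *ᵥ β) {m : ℕ} (hm : m ≤ p)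
    (e : Fin n → ℝ) :
    sqNorm (f + e - projMatrix X (nestedModel p m) *ᵥ (f + e)) - (n - m) * σ ^ 2
      = ∑ l ∈ Finset.Ico m p, coef X f l ^ 2
        + 2 * ∑ l ∈ Finset.Ico m p, coef X f l * coef X e l
        + (∑ i, (e i ^ 2 - σ ^ 2) - ∑ l ∈ Finset.Ico 0 m, (coef X e l ^ 2 - σ ^ 2)) := by
  set y := f + e with hy
  have hfe := sum_coef_smul_mulVec hX β
  rw [← hf] at hfe
  have hsum : ∀ F : ℕ → ℝ, ∑ l ∈ Finset.range p, (if l < m then F l else 0)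
      = ∑ l ∈ Finset.range m, F l := fun F => by
    rw [← Finset.sum_filter]
    congr 1
    ext l; simp; omega
  have hP1 : projMatrix X (nestedModel p m) *ᵥ y ⬝ᵥ projMatrix X (nestedModel p m) *ᵥ y
      = ∑ l ∈ Finset.range m, coef X y l ^ 2 := by
    rw [← sqNorm_eq_dotProduct, projMatrix_mulVec hX m, sqNorm_sum_coordVec hX, ← hsum]
    exact Finset.sum_congr rfl fun l _ => by split_ifs <;> simp
  have hP2 : projMatrix X (nestedModel p m) *ᵥ y ⬝ᵥ y = ∑ l ∈ Finset.range m, coef X y l ^ 2 := by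
    rw [projMatrix_mulVec hX m, sum_dotProduct, ← hsum]
    refine Finset.sum_congr rfl fun l _ => ?_
    rw [smul_dotProduct, smul_eq_mul, ← coef]
    split_ifs <;> ring
  have hff : f ⬝ᵥ f = ∑ l ∈ Finset.range p, coef X f l ^ 2 := by
    rw [← sqNorm_eq_dotProduct]
    conv_lhs => rw [← hfe]
    exact sqNorm_sum_coordVec hX _
  have hfe' : f ⬝ᵥ e = ∑ l ∈ Finset.range p, coef X f l * coef X e l := by
    conv_lhs => rw [← hfe]
    rw [sum_dotProduct]
    exact Finset.sum_congr rfl fun l _ => by rw [smul_dotProduct, smul_eq_mul, ← coef]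
  have hyy : y ⬝ᵥ y = f ⬝ᵥ f + 2 * (f ⬝ᵥ e) + e ⬝ᵥ e := by
    rw [hy, add_dotProduct, dotProduct_add, dotProduct_add, dotProduct_comm e f]; ring
  have hee : e ⬝ᵥ e = ∑ i, e i ^ 2 := by rw [← sqNorm_eq_dotProduct]; rfl
  rw [sqNorm_eq_dotProduct, sub_dotProduct, dotProduct_sub, dotProduct_sub,
    dotProduct_comm y (_ *ᵥ y), hP1, hP2, hyy, hff, hfe', hee,
    ← Finset.sum_range_add_sum_Ico _ hm, ← Finset.sum_range_add_sum_Ico _ hm,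
    Finset.sum_sub_distrib, Finset.sum_sub_distrib, Nat.Ico_zero_eq_range]
  have h1 : ∑ l ∈ Finset.range m, coef X y l ^ 2 = ∑ l ∈ Finset.range m, coef X f l ^ 2
      + 2 * ∑ l ∈ Finset.range m, coef X f l * coef X e l
      + ∑ l ∈ Finset.range m, coef X e l ^ 2 := by
    rw [Finset.mul_sum, ← Finset.sum_add_distrib, ← Finset.sum_add_distrib]
    refine Finset.sum_congr rfl fun l _ => ?_
    rw [hy, coef_add]; ring
  rw [h1]
  simp
  ring

lemma sq_sum_four_le (a b c d : ℝ) :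
    (a + 2 * b + (c - d)) ^ 2 ≤ (4 * a ^ 2 + 16 * b ^ 2) + (4 * c ^ 2 + 4 * d ^ 2) := by
  linear_combination sq_nonneg (a - 2 * b) + sq_nonneg (a - c) + sq_nonneg (a + d)
    + sq_nonneg (2 * b - c) + sq_nonneg (2 * b + d) + sq_nonneg (c + d)

lemma integral_sq_sum_four_le {b c d : Ω → ℝ} (hb : MemLp b 2 μ) (hc : MemLp c 2 μ)
    (hd : MemLp d 2 μ) (a : ℝ) :
    MemLp (fun ω => a + 2 * b ω + (c ω - d ω)) 2 μ ∧
      ∫ ω, (a + 2 * b ω + (c ω - d ω)) ^ 2 ∂μ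
        ≤ 4 * a ^ 2 + 16 * ∫ ω, b ω ^ 2 ∂μ + (4 * ∫ ω, c ω ^ 2 ∂μ + 4 * ∫ ω, d ω ^ 2 ∂μ) := by
  have hb2 : MemLp (fun ω => 2 * b ω) 2 μ := hb.const_mul 2
  have hab : MemLp (fun ω => a + 2 * b ω) 2 μ := (memLp_const a).add hb2
  have hcd : MemLp (fun ω => c ω - d ω) 2 μ := hc.sub hd
  have hmem : MemLp (fun ω => a + 2 * b ω + (c ω - d ω)) 2 μ := hab.add hcd
  have i1 : Integrable (fun ω => 4 * a ^ 2 + 16 * b ω ^ 2) μ :=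
    (integrable_const _).add (hb.integrable_sq.const_mul 16)
  have i2 : Integrable (fun ω => 4 * c ω ^ 2 + 4 * d ω ^ 2) μ :=
    (hc.integrable_sq.const_mul 4).add (hd.integrable_sq.const_mul 4)
  refine ⟨hmem, ?_⟩
  calc _ ≤ ∫ ω, ((4 * a ^ 2 + 16 * b ω ^ 2) + (4 * c ω ^ 2 + 4 * d ω ^ 2)) ∂μ :=
        integral_mono hmem.integrable_sq (by exact i1.add i2) fun ω => sq_sum_four_le _ _ _ _
    _ = _ := by
        rw [integral_add i1 i2, integral_add (integrable_const _) (hb.integrable_sq.const_mul 16),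
          integral_add (hc.integrable_sq.const_mul 4) (hd.integrable_sq.const_mul 4),
          integral_const, probReal_univ, one_smul, integral_const_mul, integral_const_mul,
          integral_const_mul]

lemma IsNoise.sum_sq (h : IsNoise μ ε σ K) (hK : 0 ≤ K) :
    MemLp (fun ω => ∑ i, (ε i ω ^ 2 - σ ^ 2)) 2 μ ∧
      ∫ ω, (∑ i, (ε i ω ^ 2 - σ ^ 2)) ^ 2 ∂μ ≤ (2 * K + 4 * σ ^ 4) * n := by
  obtain ⟨r1, r2⟩ := h.quadratic_form hK (A := 1)
    (fun i j => by simp [Matrix.one_apply, eq_comm]) Finset.univ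
  simp only [Matrix.one_apply, ite_mul, one_mul, zero_mul, Finset.sum_ite_eq, Finset.mem_univ,
    if_true, ite_pow, one_pow, ne_eq, OfNat.ofNat_ne_zero, not_false_eq_true, zero_pow,
    Finset.sum_const, Finset.card_univ, Fintype.card_fin, nsmul_eq_mul, mul_one] at r1 r2
  have er : ∀ ω, ∑ i, (ε i ω ^ 2 - σ ^ 2) = ∑ i, ε i ω * ε i ω - σ ^ 2 * n := fun ω => by
    rw [Finset.sum_sub_distrib]; simp [sq, mul_comm]
  simp_rw [er]
  exact ⟨r1, r2⟩

lemma varEstimator_sub {Ω : Type*} {ε : Fin n → Ω → ℝ} (hX : LinearIndependent ℝ X.col) (hf : f = X *ᵥ β) {m : ℕ} (hm : m ≤ p)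
    (hd : (0 : ℝ) < (n : ℝ) - m) (ω : Ω) :
    varEstimator X m (response f ε ω) - σ ^ 2
      = (∑ l ∈ Finset.Ico m p, coef X f l ^ 2
        + 2 * ∑ l ∈ Finset.Ico m p, coef X f l * coef X (fun i => ε i ω) l
        + (∑ i, (ε i ω ^ 2 - σ ^ 2)
          - ∑ l ∈ Finset.Ico 0 m, (coef X (fun i => ε i ω) l ^ 2 - σ ^ 2))) / (n - m) := by
  rw [← sqNorm_residual (σ := σ) hX hf hm (fun i => ε i ω), sub_div,
    mul_div_cancel_left₀ _ hd.ne']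
  rfl

/-- Squared bias gives `(n τ)²`, the linear form a multiple of `n τ`, the two quadratic forms
multiples of `n`. The mixed term is absorbed through `x ≤ n + x²`, so everything is a multiple of
`n² (1/n + τ²)`. -/
lemma integral_varEstimator_le (h : IsNoise μ ε σ K) (hK : 0 ≤ K) (hn : 1 ≤ n)
    (hX : LinearIndependent ℝ X.col) (hf : f = X *ᵥ β) {m : ℕ} (hm : m ≤ p) (hmn : m < n) :
    Integrable (fun ω => (varEstimator X m (response f ε ω) - σ ^ 2) ^ 2) μ ∧
      ((n : ℝ) - m) ^ 2 * ∫ ω, (varEstimator X m (response f ε ω) - σ ^ 2) ^ 2 ∂μ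
        ≤ (4 + 16 * σ ^ 2 + 8 * (2 * K + 4 * σ ^ 4)) * ((n : ℝ) ^ 2
          * (1 / n + blockSum (theta X f) m p ^ 2)) := by
  have hd : (0 : ℝ) < (n : ℝ) - m := sub_pos.2 (by exact_mod_cast hmn)
  set τ := blockSum (theta X f) m p with hτ
  have hT : ∑ l ∈ Finset.Ico m p, coef X f l ^ 2 = n * τ := sum_coef_sq_eq hn X f le_rfl
  obtain ⟨l1, -, l3⟩ := h.sum_coef hX (S := Finset.Ico m p)
    (fun l hl => Finset.mem_range.2 (Finset.mem_Ico.1 hl).2) (coef X f)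
  rw [hT] at l3
  obtain ⟨q1, q2⟩ := h.sum_coef_sq hK hX (S := Finset.Ico 0 m)
    (fun l hl => Finset.mem_range.2 ((Finset.mem_Ico.1 hl).2.trans_le hm))
  obtain ⟨r1, r2⟩ := h.sum_sq hK
  obtain ⟨hmem, hle⟩ := integral_sq_sum_four_le l1 r1 q1 (n * τ)
  have hC : 0 ≤ 2 * K + 4 * σ ^ 4 := by positivity
  have hq : ∫ ω, (∑ l ∈ Finset.Ico 0 m, (coef X (fun i => ε i ω) l ^ 2 - σ ^ 2)) ^ 2 ∂μ
      ≤ (2 * K + 4 * σ ^ 4) * n := by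
    refine q2.trans (mul_le_mul_of_nonneg_left ?_ hC)
    rw [Nat.card_Ico]
    exact_mod_cast (by omega : m - 0 ≤ n)
  rw [l3] at hle
  have e := fun ω => varEstimator_sub (ε := ε) (σ := σ) hX hf hm hd ω
  rw [hT] at e
  simp_rw [e, div_pow]
  refine ⟨hmem.integrable_sq.div_const _, ?_⟩
  rw [integral_div, mul_div_cancel₀ _ (by positivity)]
  refine hle.trans ?_
  have hn' : (n : ℝ) ≠ 0 := by positivity
  have hx : (n : ℝ) ^ 2 * (1 / n + τ ^ 2) = n + (n * τ) ^ 2 := by field_simp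
  have hn1 : (1 : ℝ) ≤ n := by exact_mod_cast hn
  have h1 : n * τ ≤ n + (n * τ) ^ 2 := by linarith [sq_nonneg (n * τ - 1 / 2)]
  have h2 := mul_le_mul_of_nonneg_left h1 (show 0 ≤ 16 * σ ^ 2 by positivity)
  have h3 : 0 ≤ (2 * K + 4 * σ ^ 4) * (n * τ) ^ 2 := mul_nonneg hC (sq_nonneg _)
  rw [hx]
  linarith

end Expectation

/-! ### Asymptotics -/

/-- The positive part of `Q / R - 1` serves as the `o(1)` term; no lower bound on `Q` is required.
-/
lemma asympLE_of_forall {Q R : ℕ → ℝ} (hR : ∀ᶠ n in atTop, 0 < R n)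
    (h : ∀ η > 0, ∀ᶠ n in atTop, Q n ≤ (1 + η) * R n) : AsympLE Q R := by
  refine ⟨fun n => max 0 (Q n / R n - 1), ?_, ?_⟩
  · rw [Metric.tendsto_nhds]
    intro η hη
    filter_upwards [hR, h (η / 2) (by linarith)] with n hn hQ
    rw [← div_le_iff₀ hn] at hQ
    rw [Real.dist_eq, sub_zero, abs_of_nonneg (le_max_left _ _)]
    exact max_lt hη (by linarith)
  · filter_upwards [hR] with n hn
    rw [← div_le_iff₀ hn]
    linarith [le_max_right 0 (Q n / R n - 1)]

lemma psi_nonneg {p M : ℕ} {k : ℕ → ℕ} (hk : IsNestedSizes p M k) (θ : ℕ → ℝ) :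
    0 ≤ psi θ M k := by
  have h := (sums_le_psi hk θ).2
  have : 0 ≤ ∑ j ∈ Finset.range M, ((k (j + 1) : ℝ) - k j) / k (j + 1) :=
    Finset.sum_nonneg fun j hj => div_nonneg
      (sub_nonneg.2 (by exact_mod_cast (hk.lt_succ j (Finset.mem_range.1 hj)).le)) (by positivity)
  have := mul_nonneg this (sq_nonneg (1 + Real.log M))
  linarith

lemma isNestedSizes_all {p : ℕ} (hp : 1 ≤ p) : IsNestedSizes p p (fun j => j) :=
  ⟨hp, rfl, fun j _ => Nat.lt_succ_self j, le_rfl⟩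

lemma varphi_nonneg (θ : ℕ → ℝ) (p : ℕ) : 0 ≤ varphi θ p :=
  Finset.sum_nonneg fun _ _ => div_nonneg (sq_nonneg _) (blockSum_nonneg _ _ _)

/-- All increments of the sizes are one, so the sum is a quarter of a harmonic sum. -/
lemma sum_inv_le (p : ℕ) :
    ∑ j ∈ Finset.Ico 1 p, (((j + 1 : ℕ) : ℝ) - j) / (4 * j) ≤ (1 + Real.log p) / 4 := by
  have h1 := harmonic_le_one_add_log p
  have h2 : ((harmonic p : ℚ) : ℝ) = ∑ i ∈ Finset.range p, ((i : ℝ) + 1)⁻¹ := by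
    simp [harmonic]
  have h3 : ∑ j ∈ Finset.Ico 1 p, (((j + 1 : ℕ) : ℝ) - j) / (4 * j)
      = (∑ j ∈ Finset.Ico 1 p, (j : ℝ)⁻¹) / 4 := by
    rw [Finset.sum_div]
    refine Finset.sum_congr rfl fun j _ => ?_
    push_cast
    rw [add_sub_cancel_left, ← div_div, div_right_comm, one_div]
  have h4 : ∑ j ∈ Finset.Ico 1 p, (j : ℝ)⁻¹ ≤ ∑ i ∈ Finset.range p, ((i : ℝ) + 1)⁻¹ := by
    rw [Finset.sum_Ico_eq_sum_range]
    refine (Finset.sum_le_sum_of_subset_of_nonneg (Finset.range_subset_range.2 (Nat.sub_le p 1))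
      fun i _ _ => by positivity).trans_eq (Finset.sum_congr rfl fun i _ => ?_)
    push_cast
    rw [add_comm]
  rw [h3]
  rw [h2] at h1
  linarith

/-- The additive `1` covers `p = 1`, where the logarithm vanishes but `psi` may not. For `p ≥ 2` one
has `log p ≥ log 2`, so `1 + log p ≤ 3 log p` and the complexity factor is at most `3 (log p +
varphi)`; together `3 · 9 = 27`. -/
lemma psi_all_le {p : ℕ} (hp : 1 ≤ p) (θ : ℕ → ℝ) :
    psi θ p (fun j => j) ≤ 1 + 27 * ((Real.log p + varphi θ p) * Real.log p ^ 2) := by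
  have hφ := varphi_nonneg θ p
  have hl0 : 0 ≤ Real.log p := Real.log_nonneg (by exact_mod_cast hp)
  rcases hp.eq_or_lt with rfl | hp2
  · rw [psi]
    simp only [Nat.cast_one, Real.log_one]
    have := min_le_left (1 : ℝ) (1 + ∑ j ∈ Finset.Ico 1 1, (((j + 1 : ℕ) : ℝ) - j) / (4 * j)
      + ∑ j ∈ Finset.Ico 1 (cutoff θ 1 fun j => j),
        (blockSum θ (j - 1) 1 - blockSum θ j 1) / (4 * blockSum θ j 1))
    norm_num at this ⊢
  · have hx : Real.log 2 ≤ Real.log p :=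
      Real.log_le_log (by norm_num) (by exact_mod_cast hp2)
    have h2 := Real.log_two_gt_d9
    have e : ∑ j ∈ Finset.Ico 1 (cutoff θ p fun j => j),
        (blockSum θ (j - 1) p - blockSum θ j p) / (4 * blockSum θ j p) = varphi θ p / 4 := by
      rw [varphi, Finset.sum_div]
      refine Finset.sum_congr rfl fun j hj => ?_
      rw [Finset.mem_Ico] at hj
      have hjp : j ≤ p := hj.2.le.trans (cutoff_spec (θ := θ) (k := fun j => j) hp).2.1
      have : blockSum θ (j - 1) p - blockSum θ j p = θ j ^ 2 := by
        have h3 := Finset.sum_Ioc_consecutive (fun l => θ l ^ 2) (Nat.sub_le j 1) hjp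
        have h4 : Finset.Ioc (j - 1) j = {j} := by
          ext l; simp; omega
        rw [h4, Finset.sum_singleton] at h3
        rw [blockSum, blockSum, ← h3]
        ring
      rw [this, div_div, mul_comm]
    have hs := sum_inv_le p
    rw [psi, e]
    set x := Real.log p with hxdef
    set φ := varphi θ p with hφdef
    have h3 : (1 + x) ^ 2 ≤ 9 * x ^ 2 := by nlinarith
    calc _ ≤ (3 * (x + φ)) * (1 + x) ^ 2 :=
          mul_le_mul_of_nonneg_right ((min_le_right _ _).trans (by linarith)) (sq_nonneg _)
      _ ≤ (3 * (x + φ)) * (9 * x ^ 2) := mul_le_mul_of_nonneg_left h3 (by positivity)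
      _ ≤ _ := by linarith

section Main

variable {Ω : ℕ → Type*} [∀ n, MeasurableSpace (Ω n)] {μ : ∀ n, Measure (Ω n)}
  [∀ n, IsProbabilityMeasure (μ n)] {ε : ∀ n, Fin n → Ω n → ℝ} {p : ℕ → ℕ}
  {X : ∀ n, Matrix (Fin n) (Fin (p n)) ℝ} {β : ∀ n, Fin (p n) → ℝ} {f : ∀ n, Fin n → ℝ}
  {σ K : ℝ}

/-- Asymptotic optimality for nested candidate models. -/
theorem asympOptimal_nested (hf : ∀ n, f n = X n *ᵥ β n) (hσ : 0 < σ) (hK : 0 ≤ K)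
    (h : ∀ n, IsNoise (μ n) (ε n) σ K) (hX : ∀ n, 1 ≤ n → LinearIndependent ℝ (X n).col)
    {M : ℕ → ℕ} {k : ℕ → ℕ → ℕ} (hk : ∀ n, 1 ≤ n → IsNestedSizes (p n) (M n) (k n))
    {s : ∀ n, Ω n → ℝ} {what : ∀ n, Ω n → Fin (M n) → ℝ} (hw : ∀ n, Measurable (what n))
    (hopt : ∀ n, 1 ≤ n → ∀ ω, IsMMAWeight (X n) (nestedFamily (p n) (M n) (k n)) (s n ω)
      (response (f n) (ε n) ω) (what n ω))
    (hs : ∀ᶠ n in atTop, Integrable (fun ω => (s n ω - σ ^ 2) ^ 2) (μ n))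
    (hs0 : (fun n => (k n (M n) : ℝ) * ∫ ω, (s n ω - σ ^ 2) ^ 2 ∂(μ n)) =o[atTop]
      (fun n => (n : ℝ) * optRisk (μ n) (ε n) (X n) (f n) (nestedFamily (p n) (M n) (k n))))
    (hψ : (fun n => psi (theta (X n) (f n)) (M n) (k n)) =o[atTop]
      (fun n => (n : ℝ) * optRisk (μ n) (ε n) (X n) (f n) (nestedFamily (p n) (M n) (k n)))) :
    AsympOptimal μ ε σ X f (fun n => nestedFamily (p n) (M n) (k n)) what
      (fun n => optRisk (μ n) (ε n) (X n) (f n) (nestedFamily (p n) (M n) (k n))) := by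
  set R : ℕ → ℝ := fun n =>
    optRisk (μ n) (ε n) (X n) (f n) (nestedFamily (p n) (M n) (k n)) with hR
  have hRσ : ∀ n, 1 ≤ n → σ ^ 2 ≤ n * R n := fun n hn =>
    le_mul_optRisk (h n) hn (hX n hn) (hf n) (hk n hn).one_le fun w hw' =>
      sq_le_mul_plugInRisk hn (hX n hn) (hf n) (hk n hn) hw'
  have hnRpos : ∀ n, 1 ≤ n → 0 < n * R n := fun n hn =>
    lt_of_lt_of_le (by positivity) (hRσ n hn)
  have hRpos : ∀ᶠ n in atTop, 0 < R n := by
    filter_upwards [eventually_ge_atTop 1] with n hn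
    exact pos_of_mul_pos_right (hnRpos n hn) (by positivity)
  set A : ℕ → ℝ := fun n =>
    16 * (σ ^ 2 + (2 * K + 4 * σ ^ 4) / σ ^ 2) * psi (theta (X n) (f n)) (M n) (k n)
      + (k n (M n) * ∫ ω, (s n ω - σ ^ 2) ^ 2 ∂(μ n)) / σ ^ 2 with hA
  have hAo : A =o[atTop] fun n => (n : ℝ) * R n := by
    have h1 := hψ.const_mul_left (16 * (σ ^ 2 + (2 * K + 4 * σ ^ 4) / σ ^ 2))
    have h2 := hs0.const_mul_left (σ ^ 2)⁻¹
    refine (h1.add h2).congr_left fun n => ?_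
    simp only [hA]
    ring
  have hbound : ∀ η > 0, ∀ᶠ n : ℕ in atTop,
      ∫ ω, plugInRisk σ (X n) (f n) (nestedFamily (p n) (M n) (k n)) (what n ω) ∂(μ n)
          ≤ (1 + η) * R n ∧
        ∫ ω, loss (maEstimator (X n) (nestedFamily (p n) (M n) (k n)) (what n ω)
          (response (f n) (ε n) ω)) (f n) ∂(μ n) ≤ (1 + η) * R n := by
    intro η hη
    -- `δ ≤ 1/8` makes `1 + 12δ ≤ (1 - 4δ)(1 + 32δ)` and `(1 + 3δ)(1 + 32δ) + 3δ ≤ 1 + 50δ`; the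
    -- second produces the `50`. The remainder is taken below `δ ² · n R`, so that after division by
    -- `δ` it is again of order `δ`.
    set δ := min (1 / 8) (η / 50) with hδdef
    have hδ : 0 < δ := lt_min (by norm_num) (by positivity)
    have hδ8 : δ ≤ 1 / 8 := min_le_left _ _
    have hδη : 50 * δ ≤ η := by linarith [min_le_right (1 / 8) (η / 50)]
    filter_upwards [hs, eventually_ge_atTop 1, hAo.bound (show 0 < δ ^ 2 by positivity)]
      with n hsn hn hAn
    have hn' : (0 : ℝ) < n := by exact_mod_cast hn
    have hr := hnRpos n hn
    rw [Real.norm_of_nonneg hr.le] at hAn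
    have hAn' : A n ≤ δ ^ 2 * (n * R n) := (le_abs_self _).trans hAn
    obtain ⟨e1, e2⟩ := expected_oracle (A := δ ^ 2 * (n * R n)) (h n) hK hσ hn (hX n hn) (hf n)
      (hk n hn) hsn (hw n) (hopt n hn) hδ hAn'
    have d1 : 8 * (δ ^ 2 * (n * R n)) / δ = 8 * δ * (n * R n) := by field_simp
    have d2 : 3 * (δ ^ 2 * (n * R n)) / δ = 3 * δ * (n * R n) := by field_simp
    rw [d1] at e1
    rw [d2] at e2
    change (1 - 4 * δ) * _ ≤ (1 + 4 * δ) * (n * R n) + _ at e1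
    generalize ∫ ω, plugInRisk σ (X n) (f n) (nestedFamily (p n) (M n) (k n)) (what n ω) ∂(μ n)
      = P at e1 e2 ⊢
    generalize ∫ ω, loss (maEstimator (X n) (nestedFamily (p n) (M n) (k n)) (what n ω)
          (response (f n) (ε n) ω)) (f n) ∂(μ n) = Q at e2 ⊢
    have g1 : n * P ≤ (1 + 32 * δ) * (n * R n) := by
      have h4 : 0 < 1 - 4 * δ := by linarith
      rw [← mul_le_mul_iff_right₀ h4]
      have : (1 + 12 * δ) ≤ (1 - 4 * δ) * (1 + 32 * δ) := by nlinarith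
      calc _ ≤ (1 + 12 * δ) * (n * R n) := by linarith
        _ ≤ ((1 - 4 * δ) * (1 + 32 * δ)) * (n * R n) := mul_le_mul_of_nonneg_right this hr.le
        _ = _ := by ring
    have g2 : n * Q ≤ (1 + 50 * δ) * (n * R n) := by
      have : (1 + 3 * δ) * (1 + 32 * δ) + 3 * δ ≤ 1 + 50 * δ := by nlinarith
      calc _ ≤ (1 + 3 * δ) * (n * P) + 3 * δ * (n * R n) := e2
        _ ≤ (1 + 3 * δ) * ((1 + 32 * δ) * (n * R n)) + 3 * δ * (n * R n) := by gcongr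
        _ = ((1 + 3 * δ) * (1 + 32 * δ) + 3 * δ) * (n * R n) := by ring
        _ ≤ _ := mul_le_mul_of_nonneg_right this hr.le
    have hRn : 0 < R n := pos_of_mul_pos_right hr hn'.le
    constructor
    · have : P ≤ (1 + 32 * δ) * R n := by
        rw [← mul_le_mul_iff_right₀ hn']; linarith
      nlinarith
    · have : Q ≤ (1 + 50 * δ) * R n := by
        rw [← mul_le_mul_iff_right₀ hn']; linarith
      nlinarith
  refine ⟨fun n hn => ⟨integrable_loss (h n) (hX n hn) (hf n) (hw n) fun ω => (hopt n hn ω).1,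
    integrable_plugInRisk (hX n hn) (hf n) (hw n) fun ω => (hopt n hn ω).1⟩,
    asympLE_of_forall hRpos fun η hη => (hbound η hη).mono fun n hn => hn.2,
    asympLE_of_forall hRpos fun η hη => (hbound η hη).mono fun n hn => hn.1⟩

/-- Asymptotic optimality for all nested models with the least squares variance estimator. -/
theorem asympOptimal_allNested (hf : ∀ n, f n = X n *ᵥ β n) (hσ : 0 < σ) (hK : 0 ≤ K)
    (h : ∀ n, IsNoise (μ n) (ε n) σ K) (hp : ∀ n, 1 ≤ n → 1 ≤ p n ∧ p n ≤ n)
    (hX : ∀ n, 1 ≤ n → LinearIndependent ℝ (X n).col)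
    {κ : ℝ} (hκ0 : 0 < κ) (hκ1 : κ < 1) {m : ℕ → ℕ} (hm : ∀ n : ℕ, m n = min ⌊κ * n⌋₊ (p n))
    {what : ∀ n, Ω n → Fin (p n) → ℝ} (hw : ∀ n, Measurable (what n))
    (hopt : ∀ n, 1 ≤ n → ∀ ω, IsMMAWeight (X n) (allNested (p n))
      (varEstimator (X n) (m n) (response (f n) (ε n) ω)) (response (f n) (ε n) ω) (what n ω))
    (h1 : (fun n : ℕ => max (1 / (n : ℝ)) (blockSum (theta (X n) (f n)) (m n) (p n) ^ 2))
      =o[atTop] (fun n => optRisk (μ n) (ε n) (X n) (f n) (allNested (p n))))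
    (h2 : (fun n => (Real.log (p n) + varphi (theta (X n) (f n)) (p n)) * Real.log (p n) ^ 2)
      =o[atTop] (fun n => (n : ℝ) * optRisk (μ n) (ε n) (X n) (f n) (allNested (p n)))) :
    AsympOptimal μ ε σ X f (fun n => allNested (p n)) what
      (fun n => optRisk (μ n) (ε n) (X n) (f n) (allNested (p n))) := by
  have hmp : ∀ n, m n ≤ p n := fun n => (hm n).trans_le (min_le_right _ _)
  have hmκ : ∀ n : ℕ, (m n : ℝ) ≤ κ * n := fun n => by
    have : m n ≤ ⌊κ * n⌋₊ := (hm n).trans_le (min_le_left _ _)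
    exact (Nat.cast_le.2 this).trans (Nat.floor_le (by positivity))
  have hmn : ∀ n, 1 ≤ n → m n < n := fun n hn => by
    have hn' : (0 : ℝ) < n := by exact_mod_cast hn
    have : (m n : ℝ) < n := (hmκ n).trans_lt (by nlinarith)
    exact_mod_cast this
  set a : ℕ → ℝ := fun n =>
    max (1 / (n : ℝ)) (blockSum (theta (X n) (f n)) (m n) (p n) ^ 2) with ha
  have hna : (fun n : ℕ => (n : ℝ) * a n) =o[atTop]
      (fun n : ℕ => (n : ℝ) * optRisk (μ n) (ε n) (X n) (f n) (allNested (p n))) :=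
    (Asymptotics.isBigO_refl _ _).mul_isLittleO h1
  -- Since `n * a n` is negligible against `n` times the optimal risk, so are constants; this
  -- absorbs the additive `1` of `psi_all_le`.
  have hone : ∀ n : ℕ, 1 ≤ n → (1 : ℝ) ≤ n * a n := fun n hn => by
    have hn' : (0 : ℝ) < n := by exact_mod_cast hn
    calc (1 : ℝ) = n * (1 / n) := by field_simp
      _ ≤ _ := mul_le_mul_of_nonneg_left (le_max_left _ _) hn'.le
  have hE := fun n (hn : 1 ≤ n) =>
    integral_varEstimator_le (h n) hK hn (hX n hn) (hf n) (hmp n) (hmn n hn)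
  set C := 4 + 16 * σ ^ 2 + 8 * (2 * K + 4 * σ ^ 4) with hC
  have hC0 : 0 ≤ C := by positivity
  refine asympOptimal_nested (k := fun _ j => j) hf hσ hK h hX
    (fun n hn => isNestedSizes_all (hp n hn).1) hw hopt ?_ ?_ ?_
  · filter_upwards [eventually_ge_atTop 1] with n hn
    exact (hE n hn).1
  · refine Asymptotics.IsBigO.trans_isLittleO ?_ hna
    refine Asymptotics.IsBigO.of_bound (2 * C / (1 - κ) ^ 2) ?_
    filter_upwards [eventually_ge_atTop 1] with n hn
    have hn' : (0 : ℝ) < n := by exact_mod_cast hn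
    have hκ' : 0 < 1 - κ := by linarith
    have hI : 0 ≤ ∫ ω, (varEstimator (X n) (m n) (response (f n) (ε n) ω) - σ ^ 2) ^ 2 ∂(μ n) :=
      integral_nonneg fun _ => sq_nonneg _
    have hEn := (hE n hn).2
    rw [Real.norm_of_nonneg (mul_nonneg (by positivity) hI),
      Real.norm_of_nonneg (zero_le_one.trans (hone n hn))]
    generalize ∫ ω, (varEstimator (X n) (m n) (response (f n) (ε n) ω) - σ ^ 2) ^ 2 ∂(μ n) = I
      at hI hEn ⊢
    -- A fixed fraction `1 - κ` of the degrees of freedom is left for the variance estimator,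
    -- uniformly in `n`.
    have hd : ((1 - κ) * n) ^ 2 ≤ ((n : ℝ) - m n) ^ 2 :=
      pow_le_pow_left₀ (by positivity) (by linarith [hmκ n]) 2
    have hsum : 1 / (n : ℝ) + blockSum (theta (X n) (f n)) (m n) (p n) ^ 2 ≤ 2 * a n := by
      have q1 := le_max_left (1 / (n : ℝ)) (blockSum (theta (X n) (f n)) (m n) (p n) ^ 2)
      have q2 := le_max_right (1 / (n : ℝ)) (blockSum (theta (X n) (f n)) (m n) (p n) ^ 2)
      simp only [ha]
      linarith
    have h3 : (1 - κ) ^ 2 * I ≤ C * (2 * a n) := by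
      have hn2 : (0 : ℝ) < (n : ℝ) ^ 2 := by positivity
      rw [← mul_le_mul_iff_right₀ hn2]
      calc (n : ℝ) ^ 2 * ((1 - κ) ^ 2 * I) = ((1 - κ) * n) ^ 2 * I := by ring
        _ ≤ ((n : ℝ) - m n) ^ 2 * I := mul_le_mul_of_nonneg_right hd hI
        _ ≤ _ := hEn
        _ ≤ C * ((n : ℝ) ^ 2 * (2 * a n)) := by gcongr
        _ = _ := by ring
    have hpn : (p n : ℝ) ≤ n := by exact_mod_cast (hp n hn).2
    calc (p n : ℝ) * I ≤ n * I := mul_le_mul_of_nonneg_right hpn hI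
      _ = n * ((1 - κ) ^ 2 * I) / (1 - κ) ^ 2 := by field_simp
      _ ≤ n * (C * (2 * a n)) / (1 - κ) ^ 2 := by gcongr
      _ = _ := by ring
  · refine Asymptotics.IsBigO.trans_isLittleO (g := fun n : ℕ => (n : ℝ) * a n
      + 27 * ((Real.log (p n) + varphi (theta (X n) (f n)) (p n)) * Real.log (p n) ^ 2)) ?_
      (hna.add (h2.const_mul_left 27))
    refine Asymptotics.IsBigO.of_bound 1 ?_
    filter_upwards [eventually_ge_atTop 1] with n hn
    have hψ := psi_all_le (hp n hn).1 (theta (X n) (f n))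
    have hψ0 := psi_nonneg (isNestedSizes_all (hp n hn).1) (theta (X n) (f n))
    rw [Real.norm_of_nonneg hψ0, one_mul]
    refine le_trans ?_ (le_abs_self _)
    linarith [hone n hn]

end Main

end MMA

/-! ### The main theorem: sub-Gaussian noise as noise with uniformly bounded fourth moments. -/

theorem theorem2
    -- for each sample size `n`: probability space, noise variables, design matrix, coefficients
    {Ω : ℕ → Type*} [∀ n, MeasurableSpace (Ω n)] (μ : ∀ n, Measure (Ω n))
    [∀ n, IsProbabilityMeasure (μ n)] (ε : ∀ n, Fin n → Ω n → ℝ)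
    (p : ℕ → ℕ) (X : ∀ n, Matrix (Fin n) (Fin (p n)) ℝ) (β : ∀ n, Fin (p n) → ℝ)
    -- the mean vector `f = X β`
    (f : ∀ n, Fin n → ℝ) (hf : ∀ n, f n = X n *ᵥ β n)
    -- i.i.d. centred sub-Gaussian noise with variance `σ² > 0`
    (σ : ℝ) (hσ : 0 < σ) (c : ℝ≥0)
    (hε_meas : ∀ n i, Measurable (ε n i))
    (hε_indep : ∀ n, iIndepFun (ε n) (μ n))
    (hε_ident : ∀ n i j, IdentDistrib (ε n i) (ε n j) (μ n) (μ n))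
    (hε_mean : ∀ n i, ∫ ω, ε n i ω ∂(μ n) = 0)
    (hε_var : ∀ n i, ∫ ω, (ε n i ω) ^ 2 ∂(μ n) = σ ^ 2)
    (hε_subG : ∀ n i, HasSubgaussianMGF (ε n i) c (μ n))
    -- `1 ≤ p_n ≤ n` and full column rank
    (hp : ∀ n, 1 ≤ n → 1 ≤ p n ∧ p n ≤ n)
    (hX : ∀ n, 1 ≤ n → LinearIndependent ℝ (X n).col)
    -- `limsup n⁻¹ ‖f‖² < ∞`
    (hf_bdd : IsBoundedUnder (· ≤ ·) atTop (fun n => MMA.sqNorm (f n) / n)) :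
    -- general nested candidate models, general variance estimator `s`
    (∀ (M : ℕ → ℕ) (k : ℕ → ℕ → ℕ), (∀ n, 1 ≤ n → MMA.IsNestedSizes (p n) (M n) (k n)) →
      ∀ s : ∀ n, Ω n → ℝ, (∀ n, Measurable (s n)) →
      ∀ what : ∀ n, Ω n → Fin (M n) → ℝ, (∀ n, Measurable (what n)) →
      (∀ n, 1 ≤ n → ∀ ω, MMA.IsMMAWeight (X n) (MMA.nestedFamily (p n) (M n) (k n)) (s n ω)
        (MMA.response (f n) (ε n) ω) (what n ω)) →
      (∀ᶠ n in atTop, Integrable (fun ω => (s n ω - σ ^ 2) ^ 2) (μ n)) →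
      ((fun n => (k n (M n) : ℝ) * ∫ ω, (s n ω - σ ^ 2) ^ 2 ∂(μ n)) =o[atTop]
        (fun n => (n : ℝ) * MMA.optRisk (μ n) (ε n) (X n) (f n)
          (MMA.nestedFamily (p n) (M n) (k n)))) →
      ((fun n => MMA.psi (MMA.theta (X n) (f n)) (M n) (k n)) =o[atTop]
        (fun n => (n : ℝ) * MMA.optRisk (μ n) (ε n) (X n) (f n)
          (MMA.nestedFamily (p n) (M n) (k n)))) →
      MMA.AsympOptimal μ ε σ X f (fun n => MMA.nestedFamily (p n) (M n) (k n)) what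
        (fun n => MMA.optRisk (μ n) (ε n) (X n) (f n) (MMA.nestedFamily (p n) (M n) (k n)))) ∧
    -- all nested models, least squares variance estimator with `m_n = ⌊κ n⌋ ∧ p_n`
    (∀ κ : ℝ, 0 < κ → κ < 1 →
      ∀ m : ℕ → ℕ, (∀ n, m n = min ⌊κ * n⌋₊ (p n)) →
      ∀ what : ∀ n, Ω n → Fin (p n) → ℝ, (∀ n, Measurable (what n)) →
      (∀ n, 1 ≤ n → ∀ ω, MMA.IsMMAWeight (X n) (MMA.allNested (p n))
        (MMA.varEstimator (X n) (m n) (MMA.response (f n) (ε n) ω))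
        (MMA.response (f n) (ε n) ω) (what n ω)) →
      ((fun n : ℕ => max (1 / (n : ℝ)) (MMA.blockSum (MMA.theta (X n) (f n)) (m n) (p n) ^ 2))
        =o[atTop]
        (fun n => MMA.optRisk (μ n) (ε n) (X n) (f n) (MMA.allNested (p n)))) →
      ((fun n => (Real.log (p n) + MMA.varphi (MMA.theta (X n) (f n)) (p n))
          * Real.log (p n) ^ 2) =o[atTop]
        (fun n => (n : ℝ) * MMA.optRisk (μ n) (ε n) (X n) (f n) (MMA.allNested (p n)))) →
      MMA.AsympOptimal μ ε σ X f (fun n => MMA.allNested (p n)) what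
        (fun n => MMA.optRisk (μ n) (ε n) (X n) (f n) (MMA.allNested (p n)))) := by
  have h : ∀ n, MMA.IsNoise (μ n) (ε n) σ (48 * Real.exp (c / 2)) := fun n =>
    ⟨hε_meas n, hε_indep n, fun i => (MMA.fourth_moment_le (hε_subG n i)).1, hε_mean n, hε_var n,
      fun i => (MMA.fourth_moment_le (hε_subG n i)).2⟩
  have hK : 0 ≤ 48 * Real.exp (c / 2) := by positivity
  refine ⟨fun M k hk s _ what hw hopt hs hs0 hψ =>
    MMA.asympOptimal_nested hf hσ hK h hX hk hw hopt hs hs0 hψ,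
    fun κ hκ0 hκ1 m hm what hw hopt h1 h2 =>
      MMA.asympOptimal_allNested hf hσ hK h hp hX hκ0 hκ1 hm hw hopt h1 h2⟩
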